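/- **Setting.** Let $\tau\in\mathbb H$ and $\varepsilon\in\{1,-1\}$. Let $A$ be the complex vector space with basis $\mathrm{id},\mathrm{id}_L,\theta$ in degree $0$ and $\eta,\xi,\xi_L$ in degree $1$. Write $|x|'=|x|-1$; all signs are Koszul signs for the shifted degrees. Let $\langle\ ,\ \rangle$ be the skew-symmetric pairing on $A$ with $\langle \mathrm{id},\xi\rangle=\langle \mathrm{id}_L,\xi_L\rangle=\langle\theta,\eta\rangle=1$ and all other values on pairs of basis vectors zero, except those forced by skew-symmetry. Operations $m_n:A^{\otimes n}\to A$ are called cyclic if the tensors $\langle m_n(x_1,\dots,x_n),x_{n+1}\rangle$ are invariant under cyclic rotation up to the Koszul sign. *Forms.* Let $e_k(\tau)=\sum'(m\tau+n)^{-k}$ over $(m,n)\ne(0,0)$ (Eisenstein summation for $k=2$), $e_2^*=e_2-\frac{2\pi i}{\tau-\bar\tau}$ and $e_k^*=e_k$ for $k>2$. Let $g_{a,b}=g_{b,a}$ ($a,b\ge 0$) be the functions on $\mathbb H$ with $g_{a,b}=0$ for $a+b$ even, $g_{a,0}=a!\,e_{a+1}^*$ for $a$ odd, and $g_{a+1,b+1}=2\pi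 i\left(\partial_\tau+\frac{a+b+1}{\tau-\bar\tau}\right)g_{a,b}$. Let $\phi$ be the Kaneko–Zagier constant-term map, sending $F=\sum_{m\ge0}F_m(\tau)/(\tau-\bar\tau)^m$ (finite sum, $F_m$ holomorphic on $\mathbb H$) to $F_0$. *Polishchuk's algebra $A_\tau$.* The product $\mu_2$ is $\mu_2(x,y)=(-1)^{|x|'}xy$, where $xy$ means first $x$, then $y$, $\ \theta\eta=\xi$, $\eta\theta=\xi_L$, $\mathrm{id}$ and $\mathrm{id}_L$ act as the identities of the source and target objects $\mathcal O$ and $L$ (with $\theta:\mathcal O\to L$, $\eta:L\to\mathcal O[1]$, $\xi:\mathcal O\to\mathcal O[1]$, $\xi_L:L\to L[1]$), and all other products of basis vectors vanish. For $s=a+b+c+d$ odd, $$\mu_{s+3}(\xi_L^a,\eta,\xi^b,\theta,\xi_L^c,\eta,\xi^d)=(-1)^{a+b}\,\varepsilon^{\binom{s+1}{2}}\,\frac{1}{a!\,b!\,c!\,d!}\cdot\frac{1}{(2\pi i)^{s+1}}\;g_{a+c,b+d}\cdot\eta .$$ All other non-zero values of the $\mu_k$, $k\geq 3$, are the cyclic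 rotations of these with respect to the pairing, and $\mu_1=0$. The algebra $A_\tau^{\rm hol}$, with operations $\mu_k^{\rm hol}$, has the same basis, pairing and formulas, with $g_{a,b}$ replaced by $\phi(g_{a,b})$. *Maps.* Let $\psi_3:A[1]^{\otimes 3}\to A[1]$ be given by $$\psi_3(\xi,\theta,\xi_L)=-\frac{\varepsilon}{2\pi i}\,\frac{1}{(\tau-\bar\tau)^2}\,\theta$$ and its cyclic rotations with respect to the pairing, all other values on basis vectors being zero. Define $f_1=\mathrm{id}$ and, for $n\ge2$, $$f_n=\sum_{\substack{i,j,k\ge1\\ i+j+k=n}}\int\psi_3(f_i\otimes f_j\otimes f_k)\,d\bar\tau ,$$ where $\int$ is applied formally to the coefficients by $\int\frac{1}{(\tau-\bar\tau)^m}d\bar\tau=\frac{1}{m-1}\,\frac{1}{(\tau-\bar\tau)^{m-1}}$ for $m\ge2$. **Theorem.** All $g_{a,b}$ lie in $\mathcal O(\mathbb H)[\frac1{\tau-\bar\tau}]$, so $\phi(g_{a,b})$ is defined. The cochain $\psi_3$ and the products of $A_\tau$ and $A_\tau^{\rm hol}$ are cyclic. Only powers with $m\ge2$ are integrated in the definition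 of the $f_n$. For every $\tau\in\mathbb H$ the maps $\{f_n\}_{n\ge1}$ form a cyclic $A_\infty$ quasi-isomorphism $f:A_\tau\to A_\tau^{\rm hol}$. That is: 1. each $f_n$ has degree $0$ for the shifted grading, and for all $n\geq 1$ $$\sum_{r\ge1}\ \sum_{i_1+\dots+i_r=n}\mu_r^{\rm hol}(f_{i_1}\otimes\dots\otimes f_{i_r})=\sum_{i+l+t=n,\ l\geq 1} f_{i+1+t}(\mathrm{id}^{\otimes i}\otimes\mu_l\otimes\mathrm{id}^{\otimes t});$$ 2. $f_1$ induces an isomorphism on cohomology; 3. $\langle f_1(x),f_1(y)\rangle=\langle x,y\rangle$, and $\sum_{i+j=n,\ i,j\ge1}\langle f_i(x_1,\dots,x_i),f_j(x_{i+1},\dots,x_n)\rangle=0$ for $n\ge3$. Moreover, if the operations $\mu_k$ satisfy the $A_\infty$ relations, so do the $\mu_k^{\rm hol}$. -/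

import Mathlib

noncomputable section

namespace EllipticCurveAlgebra

open Finset
open scoped Polynomial

/-! ### The graded vector space with its basis -/

/-- The basis of the six-dimensional space `A = Ext(O ⊕ L, O ⊕ L)`. -/
inductive Gen : Type
  | idO | idL | theta | eta | xi | xiL
  deriving DecidableEq

open Gen

instance : Fintype Gen where
  elems := {idO, idL, theta, eta, xi, xiL}
  complete := by intro x; cases x <;> simp

/-- Cohomological degree. -/
def Gen.deg : Gen → ℤ
  | idO | idL | theta => 0
  | eta | xi | xiL => 1

/-- Shifted degree `|x|' = |x| - 1`. -/
def Gen.sdeg (x : Gen) : ℤ := x.deg - 1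

/-- Total shifted degree of `x₁ ⊗ ⋯ ⊗ xₙ`. -/
def wordDeg (w : List Gen) : ℤ := (w.map Gen.sdeg).sum

/-- The sign `(-1)^n`. -/
def koszul (R : Type) [CommRing R] (n : ℤ) : R := ((n.negOnePow : ℤ) : R)

/-- A sequence of multilinear maps `mₙ : A^{⊗ n} → A` with coefficients in `R`, given by its structure
constants: `m [x₁, …, xₙ] z` is the coefficient of the basis vector `z` in `mₙ(x₁, …, xₙ)`. -/
abbrev Ops (R : Type) : Type := List Gen → Gen → R

/-- The basis vector `x`, as an element of `A ⊗ R = (Gen → R)`. -/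
def basisVec (R : Type) [CommRing R] (x : Gen) : Gen → R := Pi.single x 1

/-- The value `mₙ(v₁, …, vₙ)` on arbitrary vectors, by multilinear extension. -/
def applyOps {R : Type} [CommRing R] : Ops R → List (Gen → R) → (Gen → R)
  | m, [] => m []
  | m, v :: vs => fun z => ∑ y : Gen, v y * applyOps (fun w => m (y :: w)) vs z

/-! ### The pairing and cyclic symmetry -/

/-- The skew-symmetric pairing on basis vectors. -/
def pairGen : Gen → Gen → ℤ
  | xi, idO => -1
  | xiL, idL => -1
  | idO, xi => 1
  | idL, xiL => 1
  | theta, eta => 1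
  | eta, theta => -1
  | _, _ => 0

/-- The pairing `⟨u, v⟩`, extended bilinearly. -/
def pairing {R : Type} [CommRing R] (u v : Gen → R) : R :=
  ∑ x : Gen, ∑ y : Gen, u x * v y * (pairGen x y : R)

/-- The tensors `c(x₁, …, xₙ₊₁) = ⟨mₙ(x₁, …, xₙ), xₙ₊₁⟩` are invariant under cyclic rotation of
their arguments, up to the Koszul sign for the shifted degrees. -/
def IsCyclicOps {R : Type} [CommRing R] (m : Ops R) : Prop :=
  ∀ (x : Gen) (w : List Gen) (y : Gen),
    pairing (m (x :: w)) (basisVec R y) =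
      koszul R (x.sdeg * (wordDeg w + y.sdeg)) * pairing (m (w ++ [y])) (basisVec R x)

/-! ### `A∞` algebras and morphisms (shifted sign conventions) -/

/-- `∑ (-1)^{|x₁|' + ⋯ + |xᵢ|'} p(x₁, …, xᵢ, q(xᵢ₊₁, …, xⱼ), xⱼ₊₁, …, xₙ)` over all `0 ≤ i < j ≤ n`
(here `j = i + l + 1`). -/
def insertSum {R : Type} [CommRing R] (p q : Ops R) : Ops R := fun w z =>
  ∑ i ∈ range w.length, ∑ l ∈ range (w.length - i),
    koszul R (wordDeg (w.take i)) *
      ∑ y : Gen, q ((w.drop i).take (l + 1)) y * p (w.take i ++ y :: w.drop (i + l + 1)) z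

/-- `∑ p_r(f(x₁, …), …, f(…, xₙ))` over all ways to cut the word `x₁ ⋯ xₙ` into `r ≥ 1` consecutive
non-empty blocks. -/
def composeSum {R : Type} [CommRing R] (p f : Ops R) : Ops R := fun w z =>
  ∑ c : Composition w.length, applyOps p ((w.splitWrtComposition c).map f) z

/-- `A∞` algebra structure `mₙ : A[1]^{⊗ n} → A[2]`, `n ≥ 1`. -/
structure IsAInfinityAlgebra {R : Type} [CommRing R] (m : Ops R) : Prop where
  no_curvature : ∀ z, m [] z = 0
  degree : ∀ w z, m w z ≠ 0 → z.sdeg = wordDeg w + 1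
  relations : ∀ w z, insertSum m m w z = 0

/-- `A∞` morphism `fₙ : A[1]^{⊗ n} → A[1]`, `n ≥ 1`, from the operations `m` to the operations `m'`. -/
structure IsAInfinityMorphism {R : Type} [CommRing R] (m m' f : Ops R) : Prop where
  no_constant : ∀ z, f [] z = 0
  degree : ∀ w z, f w z ≠ 0 → z.sdeg = wordDeg w
  equations : ∀ w z, composeSum m' f w z = insertSum f m w z

/-- `f₁` induces a bijection from the cohomology of `m₁` to the cohomology of `m'₁`. -/
structure IsQuasiIso {R : Type} [CommRing R] (m m' f : Ops R) : Prop where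
  chain_map : ∀ u : Gen → R, applyOps f [applyOps m [u]] = applyOps m' [applyOps f [u]]
  injective : ∀ u : Gen → R, applyOps m [u] = 0 →
    (∃ v', applyOps f [u] = applyOps m' [v']) → ∃ v, u = applyOps m [v]
  surjective : ∀ u' : Gen → R, applyOps m' [u'] = 0 →
    ∃ u v', applyOps m [u] = 0 ∧ u' = applyOps f [u] + applyOps m' [v']

/-- Cyclic `A∞` morphism: `f₁` preserves the pairing, and
`∑_{i + j = n} ⟨fᵢ(x₁, …, xᵢ), fⱼ(xᵢ₊₁, …, xₙ)⟩ = 0` for `n ≥ 3`. -/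
structure IsCyclicMorphism {R : Type} [CommRing R] (f : Ops R) : Prop where
  isometry : ∀ x y : Gen, pairing (f [x]) (f [y]) = (pairGen x y : R)
  higher : ∀ w : List Gen, 3 ≤ w.length →
    ∑ i ∈ Ico 1 w.length, pairing (f (w.take i)) (f (w.drop i)) = 0

/-! ### Eisenstein series and the almost holomorphic forms `g_{a,b}`

Functions on the upper half plane are functions `ℂ → ℂ` of which only the values at `0 < τ.im` matter. -/

/-- `τ - τ̄`. -/
def tauDiff (τ : ℂ) : ℂ := τ - (starRingEnd ℂ) τ

/-- The constant `2πi`. -/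
def twoPiI : ℂ := 2 * (Real.pi : ℂ) * Complex.I

/-- `e_k(τ) = ∑' (mτ + n)^{-k}` over `(m, n) ≠ (0, 0)`, by Eisenstein summation (first over `n`, then
over `m`; this matters only for `k = 2`). The term `(0, 0)` vanishes because `1 / 0 = 0`. -/
def eis (k : ℕ) (τ : ℂ) : ℂ := ∑' m : ℤ, ∑' n : ℤ, 1 / ((m : ℂ) * τ + (n : ℂ)) ^ k

/-- `e_2^* = e_2 - 2πi / (τ - τ̄)`, and `e_k^* = e_k` for `k ≠ 2`. -/
def eisStar (k : ℕ) (τ : ℂ) : ℂ :=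
  if k = 2 then eis 2 τ - twoPiI / tauDiff τ else eis k τ

/-- The Wirtinger derivative `∂_τ = (∂_x - i ∂_y) / 2`. -/
def dTau (F : ℂ → ℂ) (τ : ℂ) : ℂ :=
  (fderiv ℝ F τ 1 - Complex.I * fderiv ℝ F τ Complex.I) / 2

/-- The raising operator `∂_τ + k / (τ - τ̄)` on forms of weight `k`. -/
def hatD (k : ℕ) (F : ℂ → ℂ) (τ : ℂ) : ℂ := dTau F τ + (k : ℂ) / tauDiff τ * F τ

/-- The almost holomorphic modular form `g_{a,b} = g_{b,a}` of weight `a + b + 1`. It is zero for `a + b`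
even, `g_{a,0} = a! e_{a+1}^*` for odd `a`, and in general
`g_{a,b} = a! (2πi / (τ - τ̄))^b ∑' ω̄^b / ω^{a+1}` for `a > b` (Hecke regularized for `a = b + 1`), the
sum being over the non-zero `ω ∈ ℤτ + ℤ`; raising such a series replaces `(a, b)` by `(a+1, b+1)`. -/
def gForm : ℕ → ℕ → ℂ → ℂ
  | a, 0 => fun τ => if Odd a then (a.factorial : ℂ) * eisStar (a + 1) τ else 0
  | 0, b + 1 => fun τ => if Odd (b + 1) then ((b + 1).factorial : ℂ) * eisStar (b + 2) τ else 0
  | a + 1, b + 1 => fun τ => twoPiI * hatD (a + b + 1) (gForm a b) τ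

/-- `F = ∑_{m ≤ N} F_m / (τ - τ̄)^m` on the upper half plane, with holomorphic `F_m`. -/
def IsExpansion (F : ℂ → ℂ) (N : ℕ) (c : ℕ → ℂ → ℂ) : Prop :=
  (∀ m, DifferentiableOn ℂ (c m) {τ : ℂ | 0 < τ.im}) ∧
    ∀ τ : ℂ, 0 < τ.im → F τ = ∑ m ∈ range (N + 1), c m τ / tauDiff τ ^ m

/-- `F` belongs to `O(ℍ)[1 / (τ - τ̄)]`. -/
def IsAlmostHolomorphic (F : ℂ → ℂ) : Prop :=
  ∃ p : ℕ × (ℕ → ℂ → ℂ), IsExpansion F p.1 p.2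

open Classical in
/-- The constant term map `φ : F ↦ F_0`. (On the upper half plane the functions `F_m` are uniquely
determined by `F`.) -/
def constTerm (F : ℂ → ℂ) : ℂ → ℂ :=
  if h : IsAlmostHolomorphic F then h.choose.2 0 else 0

/-! ### The products -/

/-- The coefficient of `z` in `μ₂(x, y) = (-1)^{|x|'} x y`. Here `x y` is the Yoneda product (first `x`,
then `y`), with `θ η = ξ`, `η θ = ξ_L`, and `id`, `id_L` acting as identities. -/
def muTwo : Gen → Gen → Gen → ℤ
  | theta, eta, xi => -1
  | eta, theta, xiL => 1
  | idO, idO, idO => -1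
  | idO, theta, theta => -1
  | idO, xi, xi => -1
  | idL, idL, idL => -1
  | idL, eta, eta => -1
  | idL, xiL, xiL => -1
  | theta, idL, theta => -1
  | eta, idO, eta => 1
  | xi, idO, xi => 1
  | xiL, idL, xiL => 1
  | _, _, _ => 0

/-- The word `ξ_L^a η ξ^b θ ξ_L^c η ξ^d`. -/
def wordEta (a b c d : ℕ) : List Gen :=
  List.replicate a xiL ++ [eta] ++ List.replicate b xi ++ [theta] ++
    List.replicate c xiL ++ [eta] ++ List.replicate d xi

/-- The word `ξ^b θ ξ_L^c η ξ^d θ ξ_L^a`. -/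
def wordTheta (a b c d : ℕ) : List Gen :=
  List.replicate b xi ++ [theta] ++ List.replicate c xiL ++ [eta] ++
    List.replicate d xi ++ [theta] ++ List.replicate a xiL

/-- The word `ξ^i θ ξ_L^c η ξ^d θ ξ_L^a η ξ^j`. -/
def wordIdO (a i j c d : ℕ) : List Gen :=
  List.replicate i xi ++ [theta] ++ List.replicate c xiL ++ [eta] ++
    List.replicate d xi ++ [theta] ++ List.replicate a xiL ++ [eta] ++ List.replicate j xi

/-- The word `ξ_L^i η ξ^b θ ξ_L^c η ξ^d θ ξ_L^j`. -/
def wordIdL (i j b c d : ℕ) : List Gen :=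
  List.replicate i xiL ++ [eta] ++ List.replicate b xi ++ [theta] ++
    List.replicate c xiL ++ [eta] ++ List.replicate d xi ++ [theta] ++ List.replicate j xiL

/-- The coefficient of `η` in `μ_{s+3}(ξ_L^a, η, ξ^b, θ, ξ_L^c, η, ξ^d)`, with `s = a + b + c + d`.
The sign `ε = ±1` is a normalization of the products; it also enters `ψ₃`. -/
def muCoeff (ε : ℤˣ) (G : ℕ → ℕ → ℂ) (a b c d : ℕ) : ℂ :=
  if Odd (a + b + c + d) then
    (-1) ^ (a + b) * ((ε : ℤ) : ℂ) ^ ((a + b + c + d + 1).choose 2)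
      * (1 / ((a.factorial : ℂ) * b.factorial * c.factorial * d.factorial))
      * (1 / twoPiI ^ (a + b + c + d + 1)) * G (a + c) (b + d)
  else 0

/-- The operations `μ_k`, `k ≥ 3`: the product with output `η` and its rotations with respect to the
pairing, in which `θ`, `ξ` or `ξ_L` of the cyclic word `ξ_L^a η ξ^b θ ξ_L^c η ξ^d θ` is replaced by
the output. Each word has at most one presentation, so every sum has at most one non-zero term. -/
def muHigher (ε : ℤˣ) (G : ℕ → ℕ → ℂ) (w : List Gen) : Gen → ℂ
  | eta => ∑ a ∈ range w.length, ∑ b ∈ range w.length, ∑ c ∈ range w.length, ∑ d ∈ range w.length,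
      if w = wordEta a b c d then muCoeff ε G a b c d else 0
  | theta => ∑ a ∈ range w.length, ∑ b ∈ range w.length, ∑ c ∈ range w.length, ∑ d ∈ range w.length,
      if w = wordTheta a b c d then - muCoeff ε G a b c d else 0
  | idO => ∑ a ∈ range w.length, ∑ i ∈ range w.length, ∑ j ∈ range w.length, ∑ c ∈ range w.length,
      ∑ d ∈ range w.length,
        if w = wordIdO a i j c d then - muCoeff ε G a (i + j + 1) c d else 0
  | idL => ∑ i ∈ range w.length, ∑ j ∈ range w.length, ∑ b ∈ range w.length, ∑ c ∈ range w.length,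
      ∑ d ∈ range w.length,
        if w = wordIdL i j b c d then - muCoeff ε G (i + j + 1) b c d else 0
  | xi => 0
  | xiL => 0

/-- All operations, for given values `G a b` of the forms `g_{a,b}`. In particular `μ₁ = 0`. -/
def mu (ε : ℤˣ) (G : ℕ → ℕ → ℂ) : Ops ℂ
  | [x, y] => fun z => (muTwo x y z : ℂ)
  | w => muHigher ε G w

/-- The algebra `A_τ`. -/
def muMod (ε : ℤˣ) (τ : ℂ) : Ops ℂ := mu ε (fun a b => gForm a b τ)

/-- The algebra `A_τ^hol`: the forms `g_{a,b}` are replaced by their constant terms. -/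
def muHol (ε : ℤˣ) (τ : ℂ) : Ops ℂ := mu ε (fun a b => constTerm (gForm a b) τ)

/-! ### The cochain `ψ₃` and the maps `fₙ`

Coefficients are polynomials in the formal variable `X = 1 / (τ - τ̄)`. -/

/-- `ψ₃(ξ, θ, ξ_L) = -(ε / 2πi) (τ - τ̄)^{-2} θ` and its cyclic rotations with respect to the pairing. -/
def psiThree (ε : ℤˣ) : Ops ℂ[X]
  | [xi, theta, xiL], theta => Polynomial.C (-((ε : ℤ) : ℂ) / twoPiI) * Polynomial.X ^ 2
  | [theta, xiL, eta], idO => Polynomial.C (-((ε : ℤ) : ℂ) / twoPiI) * Polynomial.X ^ 2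
  | [xiL, eta, xi], eta => - (Polynomial.C (-((ε : ℤ) : ℂ) / twoPiI) * Polynomial.X ^ 2)
  | [eta, xi, theta], idL => Polynomial.C (-((ε : ℤ) : ℂ) / twoPiI) * Polynomial.X ^ 2
  | _, _ => 0

/-- Formal integration with respect to `τ̄`: `X^m ↦ X^{m-1} / (m-1)` for `m ≥ 2`. (The rule is not
meant for `m ≤ 1`; there it returns zero.) -/
def formalInt (p : ℂ[X]) : ℂ[X] :=
  p.sum fun m r => if 2 ≤ m then Polynomial.C (r / ((m : ℂ) - 1)) * Polynomial.X ^ (m - 1) else 0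

/-- The map `fₙ`, on words of length `n`: `f₁ = id` and
`fₙ = ∑_{i, j, k ≥ 1, i + j + k = n} ∫ ψ₃(fᵢ ⊗ fⱼ ⊗ f_k) dτ̄` for `n ≥ 2`. -/
def fMap (ε : ℤˣ) : ℕ → Ops ℂ[X]
  | 0 => fun _ _ => 0
  | 1 => fun w z => if w = [z] then 1 else 0
  | n + 2 => fun w z =>
      ∑ i : Fin (n + 2), ∑ j : Fin (n + 2), ∑ k : Fin (n + 2),
        if 1 ≤ i.val ∧ 1 ≤ j.val ∧ 1 ≤ k.val ∧ i.val + j.val + k.val = n + 2 then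
          formalInt (applyOps (psiThree ε)
            [fMap ε i.val (w.take i.val), fMap ε j.val ((w.drop i.val).take j.val),
              fMap ε k.val (w.drop (i.val + j.val))] z)
        else 0
  termination_by n => n

/-- The maps `fₙ` at the point `τ`. -/
def fAt (ε : ℤˣ) (τ : ℂ) : Ops ℂ := fun w z =>
  (fMap ε w.length w z).eval (1 / tauDiff τ)

end EllipticCurveAlgebra

end

open EllipticCurveAlgebra

/-!
The maps `fₙ` are the flow of `ψ₃`. Families of multilinear maps `A^{⊗ n} → A` with a fixed output are
encoded as formal power series in noncommuting variables indexed by the basis of `A` (`NCSeries`).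
Inserting operations `q` into others is then the signed derivation `D` with value `q_z` on the
variable `z` (`insertSum_eq_D`), and composing with operations `f` is the substitution of `f_z` for `z`
(`composeSum_eq`). Write `X = 1 / (τ - τ̄)`, so that `∂_τ̄ = X² ∂_X`. The recursion for the `fₙ` says that the
derivative of `f_z` in `X` is `ψ₃` with the `f`'s inserted in its three places, where now the factor
`X²` of `ψ₃` has been removed; hence substitution of the `f_z` is the exponential `flow = exp (X D_ψ)`
(`fMap_eq_flow`). It is multiplicative, because `D_ψ` is a derivation.

The products of `A_τ` are polynomials in `X`, and those of `A_τ^hol` are their values at `X = 0`. The key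
fact is that the products evolve by the commutator with `ψ₃`: `∂_X μ_z = D_ψ μ_z - D_μ ψ_z`
(`dX_muSeries_muPoly`). Then `D_μ exp (X D_ψ) u` and `exp (X D_ψ) D_{μ^hol} u` solve the same linear
differential equation with the same value at `X = 0`, so they agree (`D_flow`). For `u` a variable this is
the morphism equation; and as the flow is injective, `D_μ² = 0` implies `D_{μ^hol}² = 0`. The quadratic
series of the pairing is killed by `D_ψ` (`D_pairing_eq_zero`), so the flow fixes it; this is the cyclicity
of the morphism.

The evolution equation has two sides. On the side of the forms, the expansion
`g_{a,b} = ∑ c_{a,b,m} X^m` satisfies `∂_X g_{a,b} = 2πi a b g_{a-1,b-1}`, up to the constant `-2πi` for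
`{a, b} = {0, 1}`, which is the non-holomorphic part of `e_2^*`. This is proved by induction along the
definition by raising operators (`deriv_formCoeff_succ`, `mul_formCoeff_succ`). On the side of the series,
the commutator with `ψ₃` of the higher products lowers two cyclically adjacent indices of their structure
constants, and the commutator with `μ₂` accounts for the constant (`muSeries_commutator`); the numerical
factors match by `derivative_muPoly`.

The remaining analysis is the holomorphy of the Eisenstein series, including the conditionally convergent
`e_2`, which follows from the Lipschitz formula (`differentiableOn_eis`), and the uniqueness of the expansion
in powers of `X`, obtained by applying `∂_τ̄` (`eq_zero_of_sum_div_tauDiff_pow`).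
-/

/-! ### Noncommutative formal power series -/

/-- Formal power series with coefficients in `R` in noncommuting variables indexed by `α`; `u w` is the
coefficient of the word `w` in `u`. -/
structure NCSeries (α R : Type*) where
  /-- The coefficients. -/
  coeff : List α → R

namespace NCSeries

variable {α R S : Type*}

instance : CoeFun (NCSeries α R) (fun _ => List α → R) := ⟨coeff⟩

@[ext] theorem ext {u v : NCSeries α R} (h : ∀ w, u w = v w) : u = v := by
  cases u; cases v; congr; exact funext h

instance [AddCommGroup R] : Zero (NCSeries α R) := ⟨⟨fun _ => 0⟩⟩

instance [AddCommGroup R] : Add (NCSeries α R) := ⟨fun u v => ⟨fun w => u w + v w⟩⟩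

instance [AddCommGroup R] : Neg (NCSeries α R) := ⟨fun u => ⟨fun w => -u w⟩⟩

instance [AddCommGroup R] : Sub (NCSeries α R) := ⟨fun u v => ⟨fun w => u w - v w⟩⟩

instance [CommRing R] : SMul R (NCSeries α R) := ⟨fun r u => ⟨fun w => r * u w⟩⟩

@[simp] theorem zero_apply [AddCommGroup R] (w : List α) : (0 : NCSeries α R) w = 0 := rfl

@[simp] theorem add_apply [AddCommGroup R] (u v : NCSeries α R) (w : List α) :
    (u + v) w = u w + v w := rfl

@[simp] theorem neg_apply [AddCommGroup R] (u : NCSeries α R) (w : List α) : (-u) w = -u w := rfl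

@[simp] theorem sub_apply [AddCommGroup R] (u v : NCSeries α R) (w : List α) :
    (u - v) w = u w - v w := rfl

@[simp] theorem smul_apply [CommRing R] (r : R) (u : NCSeries α R) (w : List α) :
    (r • u) w = r * u w := rfl

instance [AddCommGroup R] : AddCommGroup (NCSeries α R) where
  add_assoc u v t := by ext; simp [add_assoc]
  zero_add u := by ext; simp
  add_zero u := by ext; simp
  add_comm u v := by ext; simp [add_comm]
  neg_add_cancel u := by ext; simp
  sub_eq_add_neg u v := by ext; simp [sub_eq_add_neg]
  nsmul := nsmulRec
  zsmul := zsmulRec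

instance [CommRing R] : Module R (NCSeries α R) where
  one_smul u := by ext; simp
  mul_smul r s u := by ext; simp [mul_assoc]
  smul_zero r := by ext; simp
  smul_add r u v := by ext; simp [mul_add]
  add_smul r s u := by ext; simp [add_mul]
  zero_smul u := by ext; simp

@[simp] theorem sum_apply [AddCommGroup R] {ι : Type*} (s : Finset ι) (u : ι → NCSeries α R)
    (w : List α) : (∑ i ∈ s, u i) w = ∑ i ∈ s, u i w :=
  map_sum (⟨⟨fun u => u w, rfl⟩, fun _ _ => rfl⟩ : NCSeries α R →+ R) u s

/-- The series of left quotients by the letter `x`: the coefficient of `w` is that of `x w` in `u`. -/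
def tail (x : α) (u : NCSeries α R) : NCSeries α R := ⟨fun w => u (x :: w)⟩

@[simp] theorem tail_apply (x : α) (u : NCSeries α R) (w : List α) : tail x u w = u (x :: w) := rfl

section Ring

variable [CommRing R]

/-- The Cauchy product, by recursion on the word. -/
def conv : NCSeries α R → NCSeries α R → List α → R
  | u, v, [] => u [] * v []
  | u, v, x :: w => u [] * v (x :: w) + conv (tail x u) v w

instance : Mul (NCSeries α R) := ⟨fun u v => ⟨conv u v⟩⟩

instance : One (NCSeries α R) := ⟨⟨fun w => match w with | [] => 1 | _ :: _ => 0⟩⟩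

@[simp] theorem one_nil : (1 : NCSeries α R) [] = 1 := rfl

@[simp] theorem one_cons (x : α) (w : List α) : (1 : NCSeries α R) (x :: w) = 0 := rfl

@[simp] theorem mul_nil (u v : NCSeries α R) : (u * v) [] = u [] * v [] := rfl

theorem mul_cons (u v : NCSeries α R) (x : α) (w : List α) :
    (u * v) (x :: w) = u [] * v (x :: w) + (tail x u * v) w := rfl

theorem tail_mul (u v : NCSeries α R) (x : α) :
    tail x (u * v) = u [] • tail x v + tail x u * v := rfl

@[simp] theorem tail_one (x : α) : tail x (1 : NCSeries α R) = 0 := rfl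

@[simp] theorem tail_add (x : α) (u v : NCSeries α R) : tail x (u + v) = tail x u + tail x v := rfl

@[simp] theorem tail_smul (x : α) (r : R) (v : NCSeries α R) : tail x (r • v) = r • tail x v := rfl

@[simp] theorem tail_zero (x : α) : tail x (0 : NCSeries α R) = 0 := rfl

protected theorem zero_mul (v : NCSeries α R) : 0 * v = 0 := by
  ext w; induction w with
  | nil => simp
  | cons x w ih => simp [mul_cons, ih]

protected theorem mul_zero (v : NCSeries α R) : v * 0 = 0 := by
  ext w; induction w generalizing v with
  | nil => simp
  | cons x w ih => simp [mul_cons, ih]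

protected theorem add_mul (u u' v : NCSeries α R) : (u + u') * v = u * v + u' * v := by
  ext w; induction w generalizing u u' with
  | nil => simp [add_mul]
  | cons x w ih => simp [mul_cons, ih]; ring

protected theorem mul_add (u v v' : NCSeries α R) : u * (v + v') = u * v + u * v' := by
  ext w; induction w generalizing u with
  | nil => simp [mul_add]
  | cons x w ih => simp [mul_cons, ih]; ring

protected theorem smul_mul (r : R) (u v : NCSeries α R) : (r • u) * v = r • (u * v) := by
  ext w; induction w generalizing u with
  | nil => simp [mul_assoc]
  | cons x w ih => simp [mul_cons, ih]; ring

protected theorem mul_smul (r : R) (u v : NCSeries α R) : u * (r • v) = r • (u * v) := by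
  ext w; induction w generalizing u with
  | nil => simp [mul_left_comm]
  | cons x w ih => simp [mul_cons, ih]; ring

protected theorem one_mul (v : NCSeries α R) : 1 * v = v := by
  ext w; cases w <;> simp [mul_cons, NCSeries.zero_mul]

protected theorem mul_one (v : NCSeries α R) : v * 1 = v := by
  ext w; induction w generalizing v with
  | nil => simp
  | cons x w ih => simp [mul_cons, ih]

protected theorem mul_assoc (u v t : NCSeries α R) : u * v * t = u * (v * t) := by
  ext w; induction w generalizing u with
  | nil => simp [mul_assoc]
  | cons x w ih =>
    simp only [mul_cons, tail_mul, NCSeries.add_mul, NCSeries.smul_mul, add_apply, smul_apply,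
      mul_nil, ih]
    ring

instance : Ring (NCSeries α R) where
  __ := (inferInstance : AddCommGroup (NCSeries α R))
  mul := (· * ·)
  one := 1
  zero_mul := NCSeries.zero_mul
  mul_zero := NCSeries.mul_zero
  left_distrib := NCSeries.mul_add
  right_distrib := NCSeries.add_mul
  mul_assoc := NCSeries.mul_assoc
  one_mul := NCSeries.one_mul
  mul_one := NCSeries.mul_one

instance : IsScalarTower R (NCSeries α R) (NCSeries α R) := ⟨NCSeries.smul_mul⟩

instance : SMulCommClass R (NCSeries α R) (NCSeries α R) := ⟨fun r u v => (NCSeries.mul_smul r u v).symm⟩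

/-- The Cauchy product as a sum over all ways to cut a word in two. -/
theorem mul_apply (u v : NCSeries α R) (w : List α) :
    (u * v) w = ∑ i ∈ Finset.range (w.length + 1), u (w.take i) * v (w.drop i) := by
  induction w generalizing u with
  | nil => simp
  | cons x w ih =>
    rw [mul_cons, ih, List.length_cons, Finset.sum_range_succ' _ (w.length + 1)]
    simp [add_comm]

section Letter

variable [DecidableEq α]

/-- The variable `x` as a series. -/
def letter (x : α) : NCSeries α R where
  coeff
    | [y] => if y = x then 1 else 0
    | _ => 0

@[simp] theorem letter_nil (x : α) : (letter x : NCSeries α R) [] = 0 := rfl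

theorem tail_letter (x y : α) : tail y (letter x : NCSeries α R) = if y = x then 1 else 0 := by
  ext w
  cases w <;> simp only [tail_apply, letter] <;> split_ifs <;> simp

@[simp] theorem letter_mul_nil (x : α) (u : NCSeries α R) : (letter x * u : NCSeries α R) [] = 0 := by simp

@[simp] theorem letter_mul_cons (x y : α) (u : NCSeries α R) (w : List α) :
    (letter x * u : NCSeries α R) (y :: w) = if y = x then u w else 0 := by
  rw [mul_cons, tail_letter]; split_ifs <;> simp

/-- Every series is the sum of its constant term and of its parts with a given first letter. -/
theorem eq_sum_letter_mul_tail [Fintype α] (u : NCSeries α R) :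
    u = u [] • 1 + ∑ x, letter x * tail x u := by
  ext w
  cases w with
  | nil => simp
  | cons y w => simp

end Letter

end Ring

section Map

variable [CommRing R] [CommRing S]

/-- Change of coefficients. -/
def map (φ : R →+* S) (u : NCSeries α R) : NCSeries α S := ⟨fun w => φ (u w)⟩

@[simp] theorem map_apply (φ : R →+* S) (u : NCSeries α R) (w : List α) : map φ u w = φ (u w) := rfl

theorem map_mul (φ : R →+* S) (u v : NCSeries α R) : map φ (u * v) = map φ u * map φ v := by
  ext w; simp [mul_apply]

end Map

end NCSeries

namespace NCSeries

variable {α R S : Type*} [CommRing R] [CommRing S]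

/-! ### Twisted derivations -/

/-- The automorphism multiplying every letter `x` by the scalar `s x`. -/
def twist (s : α → R) (u : NCSeries α R) : NCSeries α R := ⟨fun w => (w.map s).prod * u w⟩

@[simp] theorem twist_nil (s : α → R) (u : NCSeries α R) : twist s u [] = u [] := by simp [twist]

theorem twist_cons (s : α → R) (u : NCSeries α R) (x : α) (w : List α) :
    twist s u (x :: w) = s x * twist s (tail x u) w := by
  simp [twist, mul_assoc]

theorem tail_twist (s : α → R) (u : NCSeries α R) (x : α) :
    tail x (twist s u) = s x • twist s (tail x u) := by
  ext w; simp [twist_cons]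

theorem twist_add (s : α → R) (u v : NCSeries α R) : twist s (u + v) = twist s u + twist s v := by
  ext w; simp [twist, mul_add]

theorem twist_smul (s : α → R) (r : R) (v : NCSeries α R) : twist s (r • v) = r • twist s v := by
  ext w; simp [twist, mul_left_comm]

@[simp] theorem twist_one (s : α → R) : twist s (1 : NCSeries α R) = 1 := by
  ext w; cases w <;> simp [twist]

theorem twist_const_one (u : NCSeries α R) : twist (fun _ => 1) u = u := by
  ext w; simp [twist]

theorem twist_mul (s : α → R) (u v : NCSeries α R) : twist s (u * v) = twist s u * twist s v := by
  ext w; induction w generalizing u with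
  | nil => simp
  | cons x w ih =>
    rw [twist_cons, tail_mul, mul_cons, tail_twist, twist_add, add_apply, ih, twist_smul, smul_mul_assoc,
      twist_cons]
    simp; ring

theorem twist_letter [DecidableEq α] (s : α → R) (x : α) : twist s (letter x) = s x • letter x := by
  ext w
  cases w with
  | nil => simp
  | cons y w =>
    rw [twist_cons, tail_letter, smul_apply, ← tail_apply y (letter x), tail_letter]
    split_ifs with h
    · simp [h]
    · simp [twist]

variable [Fintype α]

/-- The `s`-derivation of the series ring with values `q x` on the variables: on a monomial, the sum over
all its letters `y` of the monomial with `y` replaced by `q y`, every letter in front of `y` being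
multiplied by its scalar `s`. (The `q x` are meant to have no constant term.) -/
def der (s : α → R) (q : α → NCSeries α R) : NCSeries α R → List α → R
  | _, [] => 0
  | u, x :: w => (∑ y, q y * tail y u) (x :: w) + s x * der s q (tail x u) w

/-- The value of an `s`-derivation, as a series. -/
def D (s : α → R) (q : α → NCSeries α R) (u : NCSeries α R) : NCSeries α R := ⟨der s q u⟩

variable (s : α → R) (q : α → NCSeries α R)

@[simp] theorem D_nil (u : NCSeries α R) : D s q u [] = 0 := rfl

theorem D_cons (u : NCSeries α R) (x : α) (w : List α) :
    D s q u (x :: w) = (∑ y, q y * tail y u) (x :: w) + s x * D s q (tail x u) w := rfl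

theorem tail_D (u : NCSeries α R) (x : α) :
    tail x (D s q u) = tail x (∑ y, q y * tail y u) + s x • D s q (tail x u) := rfl

theorem D_add (u v : NCSeries α R) : D s q (u + v) = D s q u + D s q v := by
  ext w; induction w generalizing u v with
  | nil => simp
  | cons x w ih => simp [D_cons, ih, mul_add, Finset.sum_add_distrib]; ring

theorem D_smul (r : R) (u : NCSeries α R) : D s q (r • u) = r • D s q u := by
  ext w; induction w generalizing u with
  | nil => simp
  | cons x w ih => simp [D_cons, ih, mul_add, Finset.mul_sum, mul_smul_comm]; ring

@[simp] theorem D_zero : D s q 0 = 0 := by simpa using D_smul s q 0 0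

theorem D_neg (u : NCSeries α R) : D s q (-u) = -D s q u := by simpa using D_smul s q (-1) u

theorem D_sub (u v : NCSeries α R) : D s q (u - v) = D s q u - D s q v := by
  rw [sub_eq_add_neg, D_add, D_neg, sub_eq_add_neg]

theorem D_add_right (q q' : α → NCSeries α R) (u : NCSeries α R) :
    D s (fun x => q x + q' x) u = D s q u + D s q' u := by
  ext w; induction w generalizing u with
  | nil => simp
  | cons x w ih => simp [D_cons, ih, add_mul, Finset.sum_add_distrib]; ring

@[simp] theorem D_zero_right (u : NCSeries α R) : D s (fun _ => 0) u = 0 := by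
  ext w; induction w generalizing u with
  | nil => simp
  | cons x w ih => simp [D_cons, ih]

@[simp] theorem D_one : D s q 1 = 0 := by
  ext w; cases w <;> simp [D_cons]

variable {q} in
/-- The twisted Leibniz rule. -/
theorem D_mul (hq : ∀ y, q y [] = 0) (u v : NCSeries α R) :
    D s q (u * v) = D s q u * v + twist s u * D s q v := by
  ext w; induction w generalizing u with
  | nil => simp
  | cons x w ih =>
    have h1 : (∑ y, q y * tail y (u * v)) =
        u [] • ∑ y, q y * tail y v + (∑ y, q y * tail y u) * v := by
      simp only [tail_mul, mul_add, Finset.sum_add_distrib, Finset.sum_mul, Finset.smul_sum,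
        mul_smul_comm, mul_assoc]
    have h2 : (∑ y, q y * tail y u) [] = 0 := by simp [hq]
    have h3 : D s q (tail x (u * v)) w = u [] * D s q (tail x v) w + D s q (tail x u * v) w := by
      rw [tail_mul, D_add, D_smul]; rfl
    rw [D_cons, h1, h3, ih]
    rw [add_apply, add_apply, add_apply, mul_cons (∑ y, q y * tail y u), h2, mul_cons (D s q u), tail_D,
      mul_cons (twist s u), D_cons, tail_twist, add_mul]
    simp only [add_apply, smul_apply, twist_nil, D_nil, zero_mul, zero_add, smul_mul_assoc]
    ring

variable {q} in
theorem D_letter [DecidableEq α] (hq : ∀ y, q y [] = 0) (x : α) : D s q (letter x) = q x := by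
  ext w
  cases w with
  | nil => simp [hq]
  | cons y w =>
    have h : D s q (tail y (letter x)) = 0 := by
      rw [tail_letter]; split_ifs <;> simp
    have h2 : (∑ z, q z * tail z (letter x)) = q x := by simp [tail_letter]
    rw [D_cons, h, h2]; simp

/-- An `s`-derivation is determined by its values on the variables. -/
theorem eq_D_of_leibniz [DecidableEq α] (T : NCSeries α R →ₗ[R] NCSeries α R)
    (hT : ∀ u v, T (u * v) = T u * v + twist s u * T v) (h0 : ∀ x, T (letter x) [] = 0)
    (u : NCSeries α R) : T u = D s (fun x => T (letter x)) u := by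
  have h1 : T 1 = 0 := by simpa using hT 1 1
  have key : ∀ u, T u = ∑ x, T (letter x) * tail x u + ∑ x, twist s (letter x) * T (tail x u) := by
    intro u
    conv_lhs => rw [eq_sum_letter_mul_tail u]
    simp only [map_add, map_smul, h1, smul_zero, zero_add, map_sum, hT, Finset.sum_add_distrib]
  ext w
  induction w generalizing u with
  | nil => rw [key]; simp [h0]
  | cons y w ih =>
    rw [key, D_cons, add_apply]
    congr 1
    simp [twist_letter, ih, smul_mul_assoc]

section Commutation

variable {s} {q}

/-- If the values `q y` are, up to the factor `κ`, homogeneous for the character `s` of the same weight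
as `y`, then the derivation commutes with the twist up to `κ`. -/
theorem twist_D {κ : R} {t : α → R} (hq : ∀ y, twist s (q y) = (κ * s y) • q y) (u : NCSeries α R) :
    twist s (D t q u) = κ • D t q (twist s u) := by
  ext w; induction w generalizing u with
  | nil => simp
  | cons x w ih =>
    have h1 : twist s (D t q u) (x :: w) =
        twist s (∑ y, q y * tail y u) (x :: w) + s x * (t x * twist s (D t q (tail x u)) w) := by
      simp only [twist, D_cons, List.map_cons, List.prod_cons]; ring
    have h2 : twist s (∑ y, q y * tail y u) = κ • ∑ y, q y * tail y (twist s u) := by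
      have : twist s (∑ y, q y * tail y u) = ∑ y, twist s (q y * tail y u) := by
        ext w; simp [twist, Finset.mul_sum]
      rw [this, Finset.smul_sum]
      refine Finset.sum_congr rfl fun y _ => ?_
      rw [twist_mul, hq, tail_twist, smul_mul_assoc, mul_smul_comm, mul_smul]
    rw [h1, h2, ih, smul_apply, smul_apply, smul_apply, D_cons, tail_twist, D_smul, smul_apply]
    ring

end Commutation

theorem map_D (φ : R →+* S) (u : NCSeries α R) :
    map φ (D s q u) = D (fun x => φ (s x)) (fun x => map φ (q x)) (map φ u) := by
  ext w; induction w generalizing u with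
  | nil => simp
  | cons x w ih =>
    have h : ∀ y, φ ((q y * tail y u) (x :: w)) = (map φ (q y) * tail y (map φ u)) (x :: w) := by
      intro y; rw [← map_apply φ, map_mul]; rfl
    rw [map_apply, D_cons, D_cons, map_add, _root_.map_mul, sum_apply, map_sum, sum_apply]
    simp only [h]
    congr 2
    exact ih (tail x u)

/-- `D` as a linear map. -/
def DLin : NCSeries α R →ₗ[R] NCSeries α R where
  toFun := D s q
  map_add' := D_add s q
  map_smul' := D_smul s q

@[simp] theorem DLin_apply (u : NCSeries α R) : DLin s q u = D s q u := rfl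

variable {s q} in
/-- The commutator of an untwisted derivation with an `s`-derivation is the `s`-derivation given by the
commutators on the variables. -/
theorem D_commutator {p : α → NCSeries α R} (hq : ∀ y, q y [] = 0) (hp : ∀ y, p y [] = 0)
    (hps : ∀ y, twist s (p y) = s y • p y) (u : NCSeries α R) :
    D (fun _ => 1) p (D s q u) - D s q (D (fun _ => 1) p u) =
      D s (fun y => D (fun _ => 1) p (q y) - D s q (p y)) u := by
  classical
  have hcomm : ∀ u, twist s (D (fun _ => 1) p u) = D (fun _ => 1) p (twist s u) := by
    intro u; simpa using twist_D (κ := 1) (t := fun _ => (1 : R)) (by simpa using hps) u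
  have h := eq_D_of_leibniz s (DLin (fun _ => 1) p ∘ₗ DLin s q - DLin s q ∘ₗ DLin (fun _ => 1) p)
    (by
      intro u v
      simp only [LinearMap.sub_apply, LinearMap.comp_apply, DLin_apply, D_mul _ hq, D_mul _ hp, D_add,
        twist_const_one, hcomm, sub_mul, mul_sub]
      abel)
    (by intro x; simp) u
  simpa [D_letter _ hq, D_letter _ hp] using h

variable {s q} in
/-- An odd derivation whose square vanishes on the variables has square zero. -/
theorem D_sq_eq_zero (hs : ∀ x, s x * s x = 1) (hq : ∀ y, q y [] = 0)
    (hqs : ∀ y, twist s (q y) = -(s y • q y)) (h : ∀ y, D s q (q y) = 0) (u : NCSeries α R) :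
    D s q (D s q u) = 0 := by
  classical
  have hcomm : ∀ u, twist s (D s q u) = -D s q (twist s u) := by
    intro u; simpa using twist_D (κ := -1) (t := s) (by simpa using hqs) u
  have htt : ∀ u : NCSeries α R, twist s (twist s u) = u := by
    intro u; ext w
    have : (w.map s).prod * (w.map s).prod = 1 := by
      induction w with
      | nil => simp
      | cons x w ih =>
        simp only [List.map_cons, List.prod_cons]
        linear_combination (s x * s x) * ih + hs x
    simp [twist, ← mul_assoc, this]
  have h2 := eq_D_of_leibniz (fun _ => 1) (DLin s q ∘ₗ DLin s q)
    (by
      intro u v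
      simp only [LinearMap.comp_apply, DLin_apply, D_mul _ hq, D_add, twist_const_one, hcomm, htt,
        neg_mul]
      abel)
    (by intro x; simp) u
  simpa [D_letter _ hq, h] using h2

end NCSeries

namespace NCSeries

/-! ### Gradings and the order filtration -/

section Homogeneous

variable {α R : Type*} [CommRing R]

/-- All words occurring in `u` have total degree `d`, for the degrees `g` of the letters. -/
def IsHomog (g : α → ℤ) (u : NCSeries α R) (d : ℤ) : Prop := ∀ w, u w ≠ 0 → (w.map g).sum = d

variable {g : α → ℤ} {u v : NCSeries α R} {d e : ℤ}

theorem IsHomog.mul (hu : IsHomog g u d) (hv : IsHomog g v e) : IsHomog g (u * v) (d + e) := by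
  intro w hw
  rw [mul_apply] at hw
  obtain ⟨i, -, hi⟩ := Finset.exists_ne_zero_of_sum_ne_zero hw
  rw [← hu _ (left_ne_zero_of_mul hi), ← hv _ (right_ne_zero_of_mul hi), ← List.sum_append,
    ← List.map_append, List.take_append_drop]

theorem IsHomog.tail (hu : IsHomog g u d) (x : α) : IsHomog g (tail x u) (d - g x) := by
  intro w hw
  have := hu (x :: w) hw
  simp at this; omega

theorem isHomog_zero : IsHomog g (0 : NCSeries α R) d := fun _ hw => absurd rfl hw

theorem IsHomog.add (hu : IsHomog g u d) (hv : IsHomog g v d) : IsHomog g (u + v) d := by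
  intro w hw
  by_cases h : u w = 0
  · exact hv w fun h' => hw (by simp [h, h'])
  · exact hu w h

theorem IsHomog.smul (hu : IsHomog g u d) (r : R) : IsHomog g (r • u) d :=
  fun w hw => hu w (right_ne_zero_of_mul hw)

theorem IsHomog.neg (hu : IsHomog g u d) : IsHomog g (-u) d :=
  fun w hw => hu w fun h => hw (by simp [h])

theorem IsHomog.sub (hu : IsHomog g u d) (hv : IsHomog g v d) : IsHomog g (u - v) d := by
  rw [sub_eq_add_neg]; exact hu.add hv.neg

theorem isHomog_one : IsHomog g (1 : NCSeries α R) 0 := by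
  intro w hw
  cases w with
  | nil => simp
  | cons x w => exact absurd rfl hw

theorem isHomog_letter [DecidableEq α] (x : α) : IsHomog g (letter x : NCSeries α R) (g x) := by
  intro w hw
  match w, hw with
  | [y], hw =>
    have : y = x := by by_contra h; exact hw (if_neg h)
    simp [this]
  | [], hw => exact absurd rfl hw
  | _ :: _ :: _, hw => exact absurd rfl hw

theorem IsHomog.sum {ι : Type*} (t : Finset ι) {f : ι → NCSeries α R}
    (h : ∀ i ∈ t, IsHomog g (f i) d) : IsHomog g (∑ i ∈ t, f i) d := by
  intro w hw
  rw [sum_apply] at hw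
  obtain ⟨i, hi, hw⟩ := Finset.exists_ne_zero_of_sum_ne_zero hw
  exact h i hi w hw

theorem IsHomog.D [Fintype α] {s : α → R} {q : α → NCSeries α R}
    (hq : ∀ y, IsHomog g (q y) (g y + e)) (hu : IsHomog g u d) : IsHomog g (D s q u) (d + e) := by
  intro w hw
  induction w generalizing u d with
  | nil => exact absurd rfl hw
  | cons x w ih =>
    rw [D_cons] at hw
    by_cases h : (∑ y, q y * NCSeries.tail y u) (x :: w) = 0
    · rw [h, zero_add] at hw
      have := ih (hu.tail x) (right_ne_zero_of_mul hw)
      simp [this]; ring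
    · refine IsHomog.sum _ (fun y _ => ?_) _ h
      have := (hq y).mul (hu.tail y)
      rwa [show g y + e + (d - g y) = d + e by ring] at this

/-- A homogeneous series is an eigenvector of the twist by a character of the grading. -/
theorem IsHomog.twist {s : α → R} {χ : ℤ → R} (hχ : ∀ w : List α, (w.map s).prod = χ (w.map g).sum)
    (hu : IsHomog g u d) : NCSeries.twist s u = χ d • u := by
  ext w
  by_cases h : u w = 0
  · simp [NCSeries.twist, h]
  · simp [NCSeries.twist, hχ, hu w h]

end Homogeneous

section Order

variable {α R : Type*} [CommRing R] [Fintype α]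

/-- If the values on the variables start in length two, the derivation raises the length. -/
theorem D_apply_eq_zero {s : α → R} {q : α → NCSeries α R} (hq : ∀ y w, w.length < 2 → q y w = 0)
    (u : NCSeries α R) (n : ℕ) (hu : ∀ w, w.length < n → u w = 0) (w : List α)
    (hw : w.length < n + 1) : D s q u w = 0 := by
  induction w generalizing u n with
  | nil => simp
  | cons x w ih =>
    rw [List.length_cons] at hw
    obtain ⟨m, rfl⟩ : ∃ m, n = m + 1 := ⟨n - 1, by omega⟩
    have h1 : D s q (tail x u) w = 0 :=
      ih _ m (fun w' hw' => hu _ (by simpa using hw')) (by omega)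
    rw [D_cons, h1, mul_zero, add_zero, sum_apply]
    refine Finset.sum_eq_zero fun y _ => ?_
    rw [mul_apply]
    refine Finset.sum_eq_zero fun i hi => ?_
    rcases lt_or_ge i 2 with h | h
    · rw [hq y _ (lt_of_le_of_lt (List.length_take_le _ _) h), zero_mul]
    · rw [tail_apply, hu, mul_zero]
      simp at hi ⊢; omega

theorem D_iterate_apply_eq_zero {s : α → R} {q : α → NCSeries α R}
    (hq : ∀ y w, w.length < 2 → q y w = 0) (u : NCSeries α R) (n : ℕ)
    (hu : ∀ w, w.length < n → u w = 0) (k : ℕ) (w : List α) (hw : w.length < n + k) :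
    (D s q)^[k] u w = 0 := by
  induction k generalizing w with
  | zero => exact hu w hw
  | succ k ih =>
    rw [Function.iterate_succ_apply']
    exact D_apply_eq_zero hq _ (n + k) ih w hw

end Order

/-! ### The flow of a derivation -/

open Polynomial

variable {α K : Type*} [Field K]

/-- The series of the `k`-th coefficients. -/
def coeffX (k : ℕ) (U : NCSeries α K[X]) : NCSeries α K := ⟨fun w => (U w).coeff k⟩

@[simp] theorem coeffX_apply (k : ℕ) (U : NCSeries α K[X]) (w : List α) :
    coeffX k U w = (U w).coeff k := rfl

/-- Differentiation of the coefficients with respect to `X`. -/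
noncomputable def dX (U : NCSeries α K[X]) : NCSeries α K[X] := ⟨fun w => derivative (U w)⟩

@[simp] theorem dX_apply (U : NCSeries α K[X]) (w : List α) : dX U w = derivative (U w) := rfl

theorem dX_mul (U V : NCSeries α K[X]) : dX (U * V) = dX U * V + U * dX V := by
  ext1 w; simp [mul_apply, Finset.sum_add_distrib]

theorem dX_add (U V : NCSeries α K[X]) : dX (U + V) = dX U + dX V := by
  ext1 w; simp

theorem coeffX_map_C_mul (k : ℕ) (u : NCSeries α K) (V : NCSeries α K[X]) :
    coeffX k (map C u * V) = u * coeffX k V := by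
  ext w; simp [mul_apply]

theorem coeffX_zero_mul (U V : NCSeries α K[X]) : coeffX 0 (U * V) = coeffX 0 U * coeffX 0 V := by
  ext w; simp [mul_apply, mul_coeff_zero]

variable [Fintype α]

/-- The untwisted derivation over `K[X]` with constant values `p` on the variables. -/
noncomputable abbrev DC (p : α → NCSeries α K) : NCSeries α K[X] → NCSeries α K[X] :=
  D (fun _ => 1) (fun y => map C (p y))

theorem coeffX_DC (p : α → NCSeries α K) (k : ℕ) (U : NCSeries α K[X]) :
    coeffX k (DC p U) = D (fun _ => 1) p (coeffX k U) := by
  ext w; induction w generalizing U with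
  | nil => simp
  | cons x w ih =>
    have h : ∀ y, ((map C (p y) * tail y U) (x :: w)).coeff k =
        (p y * tail y (coeffX k U)) (x :: w) := fun y =>
      congrArg (fun V => V.coeff (x :: w)) (coeffX_map_C_mul k (p y) (tail y U))
    have h2 := ih (tail x U)
    rw [coeffX_apply] at h2
    rw [coeffX_apply, D_cons, D_cons, sum_apply, sum_apply, coeff_add, finsetSum_coeff, one_mul,
      one_mul, h2]
    simp only [h]
    rfl

theorem coeffX_zero_D (s : α → K) (μ : α → NCSeries α K[X]) (U : NCSeries α K[X]) :
    coeffX 0 (D (fun x => C (s x)) μ U) = D s (fun x => coeffX 0 (μ x)) (coeffX 0 U) := by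
  have h : ∀ V : NCSeries α K[X], coeffX 0 V = map constantCoeff V := fun V => rfl
  simp only [h, map_D, constantCoeff_apply, coeff_C_zero]

theorem dX_D (s : α → K) (μ : α → NCSeries α K[X]) (U : NCSeries α K[X]) :
    dX (D (fun x => C (s x)) μ U) =
      D (fun x => C (s x)) (fun x => dX (μ x)) U + D (fun x => C (s x)) μ (dX U) := by
  ext1 w; induction w generalizing U with
  | nil => simp
  | cons x w ih =>
    have h : ∀ y, derivative ((μ y * tail y U) (x :: w)) =
        (dX (μ y) * tail y U) (x :: w) + (μ y * tail y (dX U)) (x :: w) := fun y =>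
      congrArg (fun V => V.coeff (x :: w)) (dX_mul (μ y) (tail y U))
    have h2 := ih (tail x U)
    rw [dX_apply] at h2
    rw [dX_apply, add_apply, D_cons, D_cons, D_cons, sum_apply, sum_apply, sum_apply, derivative_add,
      derivative_sum, derivative_mul, derivative_C, zero_mul, zero_add, h2]
    simp only [h, Finset.sum_add_distrib, add_apply]
    rw [show dX (tail x U) = tail x (dX U) from rfl]
    ring

variable [CharZero K]

/-- Uniqueness for the differential equation `dU/dX = DC p U`. -/
theorem eq_of_ode {p : α → NCSeries α K} {U V : NCSeries α K[X]} (hU : dX U = DC p U)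
    (hV : dX V = DC p V) (h0 : coeffX 0 U = coeffX 0 V) : U = V := by
  have key : ∀ k, coeffX k U = coeffX k V := by
    intro k
    induction k with
    | zero => exact h0
    | succ k ih =>
      have h : coeffX k (dX U) = coeffX k (dX V) := by rw [hU, hV, coeffX_DC, coeffX_DC, ih]
      ext w
      have := congrArg (fun u => u.coeff w) h
      simp only [coeffX_apply, dX_apply, coeff_derivative] at this
      exact mul_right_cancel₀ (by exact_mod_cast Nat.succ_ne_zero k) this
  ext w k
  exact congrArg (fun u => u.coeff w) (key k)

/-- The flow `exp (X D)` of the derivation `D` with values `p` on the variables, applied to `u`. The sum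
is cut off where the terms vanish when the `p y` start in length two. -/
noncomputable def flow (p : α → NCSeries α K) (u : NCSeries α K) : NCSeries α K[X] :=
  ⟨fun w => ∑ k ∈ Finset.range (w.length + 1),
    monomial k ((D (fun _ => 1) p)^[k] u w / (k.factorial : K))⟩

variable {p : α → NCSeries α K}

omit [CharZero K] in
theorem coeffX_flow (hp : ∀ y w, w.length < 2 → p y w = 0) (u : NCSeries α K) (k : ℕ) :
    coeffX k (flow p u) = ((k.factorial : K)⁻¹) • (D (fun _ => 1) p)^[k] u := by
  ext w
  simp only [coeffX_apply, flow, finsetSum_coeff, coeff_monomial, Finset.sum_ite_eq',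
    Finset.mem_range, smul_apply]
  split_ifs with h
  · rw [div_eq_inv_mul]
  · rw [D_iterate_apply_eq_zero hp u 0 (by simp) k w (by omega), mul_zero]

omit [CharZero K] in
theorem coeffX_zero_flow (hp : ∀ y w, w.length < 2 → p y w = 0) (u : NCSeries α K) :
    coeffX 0 (flow p u) = u := by
  rw [coeffX_flow hp]; simp

theorem flow_ode (hp : ∀ y w, w.length < 2 → p y w = 0) (u : NCSeries α K) :
    dX (flow p u) = DC p (flow p u) := by
  have key : ∀ k, coeffX k (dX (flow p u)) = coeffX k (DC p (flow p u)) := by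
    intro k
    rw [coeffX_DC, coeffX_flow hp, D_smul, ← Function.iterate_succ_apply' (D _ p)]
    ext w
    have h := congrArg (fun u => u.coeff w) (coeffX_flow hp u (k + 1))
    simp only [coeffX_apply, smul_apply] at h
    simp only [coeffX_apply, dX_apply, coeff_derivative, h, smul_apply]
    have : (k.factorial : K) ≠ 0 := by exact_mod_cast k.factorial_ne_zero
    have : (k : K) + 1 ≠ 0 := by exact_mod_cast k.succ_ne_zero
    rw [Nat.factorial_succ]; push_cast
    field_simp
  ext w k
  exact congrArg (fun u => u.coeff w) (key k)

theorem eq_flow (hp : ∀ y w, w.length < 2 → p y w = 0) {U : NCSeries α K[X]} {u : NCSeries α K}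
    (hU : dX U = DC p U) (h0 : coeffX 0 U = u) : U = flow p u :=
  eq_of_ode hU (flow_ode hp u) (by rw [h0, coeffX_zero_flow hp])

theorem flow_add (hp : ∀ y w, w.length < 2 → p y w = 0) (u v : NCSeries α K) :
    flow p (u + v) = flow p u + flow p v := by
  refine (eq_flow hp ?_ ?_).symm
  · rw [dX_add, flow_ode hp, flow_ode hp, ← D_add]
  · ext w; rw [coeffX_apply, add_apply, coeff_add, ← coeffX_apply, ← coeffX_apply,
      coeffX_zero_flow hp, coeffX_zero_flow hp, add_apply]

theorem flow_smul (hp : ∀ y w, w.length < 2 → p y w = 0) (r : K) (u : NCSeries α K) :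
    flow p (r • u) = C r • flow p u := by
  refine (eq_flow hp ?_ ?_).symm
  · have h : dX (C r • flow p u) = C r • dX (flow p u) := by ext1 w; simp
    rw [h, flow_ode hp, ← D_smul]
  · ext w; rw [coeffX_apply, smul_apply, coeff_C_mul, ← coeffX_apply, coeffX_zero_flow hp, smul_apply]

/-- A series killed by the derivation is constant along the flow. -/
theorem flow_eq_of_D_eq_zero (hp : ∀ y w, w.length < 2 → p y w = 0) {u : NCSeries α K}
    (hu : D (fun _ => 1) p u = 0) : flow p u = map C u := by
  refine (eq_flow hp ?_ ?_).symm
  · have h : DC p (map C u) = map C (D (fun _ => 1) p u) := by rw [map_D]; simp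
    rw [h, hu]; ext1 w; simp
  · ext w; simp

/-- The flow of a derivation is multiplicative. -/
theorem flow_mul (hp : ∀ y w, w.length < 2 → p y w = 0) (u v : NCSeries α K) :
    flow p (u * v) = flow p u * flow p v := by
  refine (eq_flow hp ?_ ?_).symm
  · have hp0 : ∀ y, map C (p y) [] = 0 := fun y => by simp [hp y [] (by simp)]
    rw [dX_mul, flow_ode hp, flow_ode hp, DC, D_mul _ hp0, twist_const_one]
  · rw [coeffX_zero_mul, coeffX_zero_flow hp, coeffX_zero_flow hp]

theorem flow_one (hp : ∀ y w, w.length < 2 → p y w = 0) : flow p (1 : NCSeries α K) = 1 := by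
  rw [flow_eq_of_D_eq_zero hp (D_one _ _)]
  ext1 w; cases w <;> simp

theorem flow_D (hp : ∀ y w, w.length < 2 → p y w = 0) (u : NCSeries α K) :
    flow p (D (fun _ => 1) p u) = DC p (flow p u) := by
  refine (eq_flow hp ?_ ?_).symm
  · have h := dX_D (fun _ => (1 : K)) (fun y => map C (p y)) (flow p u)
    have h2 : (fun x => dX (map C (p x))) = fun _ : α => (0 : NCSeries α K[X]) := by
      funext x; ext1 w; simp
    rw [h2] at h
    simp only [C_1, D_zero_right, zero_add] at h
    rw [h, flow_ode hp]
  · rw [coeffX_DC, coeffX_zero_flow hp]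

/-- If the values `μ z` of an `s`-derivation evolve by the commutator with the derivation `p`, then the
flow of `p` intertwines the derivation at time zero with the derivation at time `X`. -/
theorem D_flow (hp : ∀ y w, w.length < 2 → p y w = 0) {s : α → K}
    (hps : ∀ y, twist s (p y) = s y • p y) {μ : α → NCSeries α K[X]} (hμ0 : ∀ y, μ y [] = 0)
    (hμ : ∀ z, dX (μ z) = DC p (μ z) - D (fun x => C (s x)) μ (map C (p z))) (u : NCSeries α K) :
    D (fun x => C (s x)) μ (flow p u) = flow p (D s (fun z => coeffX 0 (μ z)) u) := by
  refine eq_flow hp ?_ ?_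
  · have h := D_commutator (s := fun x => C (s x)) (p := fun y => map C (p y)) hμ0
      (fun y => by simp [hp y [] (by simp)]) (fun y => ?_) (flow p u)
    · rw [dX_D, flow_ode hp]
      simp only [hμ]
      rw [← h]
      abel
    · have h := congrArg (map C) (hps y)
      ext1 w
      have h' := congrArg (fun u => u.coeff w) h
      simp only [map_apply, smul_apply, twist, C_mul] at h' ⊢
      rw [← h', map_list_prod, List.map_map]
      rfl
  · rw [coeffX_zero_D, coeffX_zero_flow hp]

omit [CharZero K] in
/-- The flow is injective at every time. -/
theorem eq_zero_of_eval_flow (hp : ∀ y w, w.length < 2 → p y w = 0) (x : K) {u : NCSeries α K}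
    (hu : ∀ w, (flow p u w).eval x = 0) : u = 0 := by
  have key : ∀ n w, w.length < n → u w = 0 := by
    intro n
    induction n with
    | zero => simp
    | succ n ih =>
      intro w hw
      have h := hu w
      simp only [flow, eval_finsetSum, eval_monomial] at h
      rw [Finset.sum_eq_single 0 (fun k _ hk => ?_) (by simp)] at h
      · simpa using h
      · rw [D_iterate_apply_eq_zero hp u n ih k w (by omega)]; simp
  ext w
  exact key _ w (Nat.lt_succ_self _)

omit [CharZero K] in
theorem IsHomog.flow {g : α → ℤ} (hg : ∀ y, IsHomog g (p y) (g y)) {u : NCSeries α K} {d : ℤ}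
    (hu : IsHomog g u d) : IsHomog g (flow p u) d := by
  have h : ∀ k, IsHomog g ((NCSeries.D (fun _ => 1) p)^[k] u) d := by
    intro k
    induction k with
    | zero => exact hu
    | succ k ih =>
      rw [Function.iterate_succ_apply']
      simpa using IsHomog.D (e := 0) (by simpa using hg) ih
  intro w hw
  simp only [NCSeries.flow] at hw
  obtain ⟨k, -, hk⟩ := Finset.exists_ne_zero_of_sum_ne_zero hw
  exact h k w fun h0 => hk (by simp [h0])

end NCSeries

namespace NCSeries

/-! ### Insertion and composition of operations as operators on series -/

/-- Three-fold products of series without constant term, as sums over cuttings into non-empty words. -/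
theorem mul_mul_apply_of_nil {α R : Type*} [CommRing R] {u v t : NCSeries α R} (hu : u [] = 0)
    (hv : v [] = 0) (ht : t [] = 0) (n : ℕ) (w : List α)
    (hw : w.length = n) : (u * (v * t)) w = ∑ i : Fin n, ∑ j : Fin n, ∑ k : Fin n,
      if 1 ≤ i.val ∧ 1 ≤ j.val ∧ 1 ≤ k.val ∧ i.val + j.val + k.val = n then
        u (w.take i) * (v ((w.drop i).take j) * t (w.drop (i + j))) else 0 := by
  subst hw
  rw [mul_apply, Finset.sum_range_succ]
  have hlast : (v * t) (w.drop w.length) = 0 := by simp [hv]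
  rw [hlast, mul_zero, add_zero, Finset.sum_range]
  refine Finset.sum_congr rfl fun i _ => ?_
  have hi := i.2
  have inner : ∀ j : Fin w.length, (∑ k : Fin w.length,
      if 1 ≤ i.val ∧ 1 ≤ j.val ∧ 1 ≤ k.val ∧ i.val + j.val + k.val = w.length then
        u (w.take i) * (v ((w.drop i).take j) * t (w.drop (i + j))) else 0) =
      if 1 ≤ i.val ∧ 1 ≤ j.val ∧ i.val + j.val + 1 ≤ w.length then
        u (w.take i) * (v ((w.drop i).take j) * t (w.drop (i + j))) else 0 := by
    intro j
    split_ifs with h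
    · rw [Finset.sum_eq_single ⟨w.length - (i + j), by omega⟩]
      · rw [if_pos]; simp; omega
      · intro k _ hk
        rw [if_neg]
        rintro ⟨-, -, -, h'⟩
        exact hk (Fin.ext (by simp; omega))
      · simp
    · refine Finset.sum_eq_zero fun k _ => if_neg ?_
      omega
  simp only [inner]
  by_cases hi0 : i.val = 0
  · simp [hi0, hu]
  rw [mul_apply, Finset.mul_sum, ← Finset.sum_range (n := w.length) (f := fun j =>
    if 1 ≤ i.val ∧ 1 ≤ j ∧ i.val + j + 1 ≤ w.length then
        u (w.take i) * (v ((w.drop i).take j) * t (w.drop (i + j))) else 0)]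
  have hsub : Finset.range (w.length - i) ⊆ Finset.range w.length := by
    intro j; simp; omega
  rw [List.length_drop, Finset.sum_range_succ, ← Finset.sum_subset hsub]
  · have h0 : t ((w.drop i).drop (w.length - i)) = 0 := by
      rw [List.drop_eq_nil_of_le (by simp)]; exact ht
    rw [h0, mul_zero, mul_zero, add_zero]
    refine Finset.sum_congr rfl fun j hj => ?_
    rw [Finset.mem_range] at hj
    by_cases hj0 : j = 0
    · simp [hj0, hv]
    · rw [if_pos (by omega), List.drop_drop]
  · intro j _ hj
    rw [Finset.mem_range, not_lt] at hj
    rw [if_neg (by omega)]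

/-- A composition of `n + 1` is its first block followed by a composition of what remains. -/
theorem sum_composition_succ {M : Type*} [AddCommMonoid M] (n : ℕ) (F : List ℕ → M) :
    ∑ c : Composition (n + 1), F c.blocks =
      ∑ i ∈ Finset.range (n + 1), ∑ c : Composition (n - i), F ((i + 1) :: c.blocks) := by
  rw [Finset.sum_sigma']
  symm
  refine Finset.sum_bij (fun a ha => ⟨(a.1 + 1) :: a.2.blocks, ?_, ?_⟩) ?_ ?_ ?_ ?_
  · intro i hi
    rcases List.mem_cons.1 hi with rfl | hi
    · omega
    · exact a.2.blocks_pos hi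
  · have := Finset.mem_range.1 (Finset.mem_sigma.1 ha).1
    rw [List.sum_cons, a.2.blocks_sum]; omega
  · simp
  · rintro ⟨i, c⟩ hi ⟨j, c'⟩ hj h
    simp only [Composition.mk.injEq, List.cons.injEq, add_left_inj] at h
    obtain ⟨rfl, h⟩ := h
    rw [Composition.ext h]
  · intro c _
    obtain ⟨blocks, hpos, hsum⟩ := c
    cases blocks with
    | nil => simp at hsum
    | cons b bs =>
      have hb : 0 < b := hpos (by simp)
      rw [List.sum_cons] at hsum
      refine ⟨⟨b - 1, ⟨bs, fun hi => hpos (List.mem_cons_of_mem _ hi), by omega⟩⟩, by simp; omega, ?_⟩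
      ext1
      simp; omega
  · intro a ha
    rfl

end NCSeries

namespace EllipticCurveAlgebra

open NCSeries

section Columns

variable {R : Type} [CommRing R]

/-- The coefficient of the basis vector `z` in the operations `m`, as a series in the inputs. -/
def column (m : Ops R) (z : Gen) : NCSeries Gen R := ⟨fun w => m w z⟩

omit [CommRing R] in
@[simp] theorem column_apply (m : Ops R) (z : Gen) (w : List Gen) : column m z w = m w z := rfl

/-- The Koszul sign of a basis vector in the shifted grading. -/
def koszulSign (R : Type) [CommRing R] (x : Gen) : R := koszul R x.sdeg

theorem koszul_add (m n : ℤ) : koszul R (m + n) = koszul R m * koszul R n := by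
  simp [koszul, Int.negOnePow_add]

@[simp] theorem koszul_zero : koszul R 0 = 1 := by simp [koszul]

theorem prod_koszulSign (w : List Gen) :
    (w.map (koszulSign R)).prod = koszul R (w.map Gen.sdeg).sum := by
  induction w with
  | nil => simp
  | cons x w ih => simp [ih, koszul_add, koszulSign]

theorem koszulSign_mul_self (x : Gen) : koszulSign R x * koszulSign R x = 1 := by
  cases x <;> simp [koszulSign, koszul, Gen.sdeg, Gen.deg]

/-- Inserting the operations `q` into `p` is applying the derivation with values `q`. -/
theorem insertSum_eq_D (p q : Ops R) (hq : ∀ z, q [] z = 0) (w : List Gen) (z : Gen) :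
    insertSum p q w z = D (koszulSign R) (column q) (column p z) w := by
  induction w generalizing p with
  | nil => simp [insertSum]
  | cons x w ih =>
    have h1 : insertSum p q (x :: w) z =
        (∑ l ∈ Finset.range (w.length + 1),
          ∑ y : Gen, q ((x :: w).take (l + 1)) y * p (y :: (x :: w).drop (l + 1)) z) +
        koszulSign R x * insertSum (fun t => p (x :: t)) q w z := by
      rw [insertSum, List.length_cons, Finset.sum_range_succ', add_comm]
      congr 1
      · simp [wordDeg]
      · rw [insertSum, Finset.mul_sum]
        refine Finset.sum_congr rfl fun i _ => ?_
        rw [Finset.mul_sum, Nat.add_sub_add_right]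
        refine Finset.sum_congr rfl fun l _ => ?_
        rw [← mul_assoc, koszulSign, ← koszul_add, show i + 1 + l + 1 = (i + l + 1) + 1 by ring]
        simp [wordDeg]
    rw [h1, ih, D_cons, Finset.sum_comm, NCSeries.sum_apply]
    congr 1
    refine Finset.sum_congr rfl fun y _ => ?_
    rw [mul_apply, List.length_cons, Finset.sum_range_succ' _ (w.length + 1)]
    simp [hq]

/-- Composition with operations `f` is the multiplicative substitution of the series of `f` for the
variables. -/
theorem composeSum_eq (T : NCSeries Gen R →ₗ[R] NCSeries Gen R) (hmul : ∀ u v, T (u * v) = T u * T v)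
    (hone : T 1 = 1) (h0 : ∀ x, T (letter x) [] = 0) (p : Ops R) (w : List Gen) (z : Gen) :
    composeSum p (fun w y => T (letter y) w) w z = T (column p z) w := by
  have key : ∀ (n : ℕ) (p : Ops R) (w : List Gen), w.length = n →
      ∑ c : Composition n, applyOps p
        ((w.splitWrtCompositionAux c.blocks).map fun w y => T (letter y) w) z = T (column p z) w := by
    intro n
    induction n using Nat.strong_induction_on with
    | _ n ih =>
      intro p w hw
      have hT : T (column p z) w = p [] z * (1 : NCSeries Gen R) w +
          ∑ y, (T (letter y) * T (tail y (column p z))) w := by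
        conv_lhs => rw [eq_sum_letter_mul_tail (column p z)]
        simp [hmul, hone]
      cases n with
      | zero =>
        obtain rfl : w = [] := List.length_eq_zero_iff.1 hw
        have hc : ∀ c : Composition 0, c.blocks = [] := fun c => by simp
        rw [hT]
        simp [hc, List.splitWrtCompositionAux, applyOps, h0, composition_card]
      | succ n =>
        rw [hT]
        have hw1 : (1 : NCSeries Gen R) w = 0 := by
          cases w with
          | nil => simp at hw
          | cons x w => rfl
        rw [hw1, mul_zero, zero_add, sum_composition_succ n (fun b => applyOps p
          ((w.splitWrtCompositionAux b).map fun w y => T (letter y) w) z)]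
        simp only [List.splitWrtCompositionAux_cons, List.map_cons, applyOps]
        have hih : ∀ i ∈ Finset.range (n + 1), ∀ y : Gen,
            ∑ c : Composition (n - i), applyOps (fun t => p (y :: t))
              (((w.drop (i + 1)).splitWrtCompositionAux c.blocks).map fun w y => T (letter y) w) z =
            T (tail y (column p z)) (w.drop (i + 1)) := by
          intro i hi y
          rw [Finset.mem_range] at hi
          exact ih (n - i) (by omega) _ _ (by simp [hw])
        have hsw : ∀ i ∈ Finset.range (n + 1), (∑ c : Composition (n - i), ∑ y : Gen,
            T (letter y) (w.take (i + 1)) * applyOps (fun t => p (y :: t))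
              (((w.drop (i + 1)).splitWrtCompositionAux c.blocks).map fun w y => T (letter y) w) z) =
            ∑ y : Gen, T (letter y) (w.take (i + 1)) * T (tail y (column p z)) (w.drop (i + 1)) := by
          intro i hi
          rw [Finset.sum_comm]
          refine Finset.sum_congr rfl fun y _ => ?_
          rw [← Finset.mul_sum, hih i hi]
        rw [Finset.sum_congr rfl hsw, Finset.sum_comm]
        refine Finset.sum_congr rfl fun y _ => ?_
        rw [mul_apply, hw, Finset.sum_range_succ' _ (n + 1)]
        simp only [List.take_zero, h0, zero_mul, add_zero]
  exact key w.length p w rfl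

end Columns

/-! ### The cochain `ψ₃` and its flow -/

open Polynomial

/-- The three letters on which the component of `ψ₃` with a given output does not vanish; the components
with output `ξ`, `ξ_L` are zero, and the value there is irrelevant. -/
def psiLetters : Gen → Gen × Gen × Gen
  | .theta => (.xi, .theta, .xiL)
  | .idO => (.theta, .xiL, .eta)
  | .eta => (.xiL, .eta, .xi)
  | .idL => (.eta, .xi, .theta)
  | .xi | .xiL => (.xi, .xi, .xi)

/-- The signs of the rotations of `ψ₃(ξ, θ, ξ_L)`. -/
def psiSign : Gen → ℤ
  | .theta | .idO | .idL => 1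
  | .eta => -1
  | .xi | .xiL => 0

/-- The constant `-ε / 2πi`. -/
noncomputable def psiConst (ε : ℤˣ) : ℂ := -((ε : ℤ) : ℂ) / twoPiI

/-- The cochain `ψ₃` without the factor `(τ - τ̄)⁻²`, as a family of series. -/
noncomputable def psiSeries (ε : ℤˣ) (z : Gen) : NCSeries Gen ℂ :=
  (psiSign z * psiConst ε : ℂ) •
    (letter (psiLetters z).1 * (letter (psiLetters z).2.1 * letter (psiLetters z).2.2))

theorem psiThree_eq (ε : ℤˣ) (w : List Gen) (z : Gen) :
    psiThree ε w z = if w = [(psiLetters z).1, (psiLetters z).2.1, (psiLetters z).2.2] then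
      C (psiSign z * psiConst ε) * X ^ 2 else 0 := by
  unfold psiThree
  split
  · simp [psiLetters, psiSign, psiConst]
  · simp [psiLetters, psiSign, psiConst]
  · simp [psiLetters, psiSign, psiConst]
  · simp [psiLetters, psiSign, psiConst]
  · cases z <;> simp_all [psiLetters, psiSign]

theorem applyOps_psiThree (ε : ℤˣ) (F₁ F₂ F₃ : Gen → ℂ[X]) (z : Gen) :
    applyOps (psiThree ε) [F₁, F₂, F₃] z =
      X ^ 2 * (C (psiSign z * psiConst ε) *
        (F₁ (psiLetters z).1 * (F₂ (psiLetters z).2.1 * F₃ (psiLetters z).2.2))) := by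
  simp only [applyOps, psiThree_eq, List.cons.injEq, and_true, ite_and, mul_ite, mul_zero,
    Finset.mul_sum]
  rw [Finset.sum_eq_single (psiLetters z).1 (fun x _ hx => by simp [hx]) (by simp),
    Finset.sum_eq_single (psiLetters z).2.1 (fun x _ hx => by simp [hx]) (by simp)]
  simp; ring

theorem psiSeries_apply_eq_zero (ε : ℤˣ) (z : Gen) (w : List Gen) (hw : w.length < 2) :
    psiSeries ε z w = 0 := by
  match w, hw with
  | [], _ => simp [psiSeries]
  | [x], _ => simp [psiSeries]

theorem formalInt_coeff (q : ℂ[X]) (m : ℕ) :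
    (formalInt q).coeff m = if 1 ≤ m then q.coeff (m + 1) / m else 0 := by
  have h : ∀ k : ℕ, (if 2 ≤ k then C (q.coeff k / ((k : ℂ) - 1)) * X ^ (k - 1) else 0 : ℂ[X]).coeff m =
      if k = m + 1 then (if 1 ≤ m then q.coeff (m + 1) / m else 0) else 0 := by
    intro k
    by_cases hk : k = m + 1
    · subst hk
      by_cases hm : 1 ≤ m
      · simp [hm, coeff_X_pow]
      · simp [hm]
    · rw [if_neg hk]
      split_ifs with h2
      · rw [coeff_C_mul, coeff_X_pow, if_neg (by omega), mul_zero]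
      · simp
  rw [formalInt, Polynomial.sum, finsetSum_coeff, Finset.sum_congr rfl fun k _ => h k,
    Finset.sum_ite_eq']
  split_ifs with h1 h2 h2 <;> simp_all

theorem formalInt_zero : formalInt 0 = 0 := by ext m; simp [formalInt_coeff]

theorem formalInt_sum {ι : Type*} (s : Finset ι) (q : ι → ℂ[X]) :
    formalInt (∑ i ∈ s, q i) = ∑ i ∈ s, formalInt (q i) := by
  ext m
  rw [formalInt_coeff, finsetSum_coeff, finsetSum_coeff, Finset.sum_div]
  simp only [formalInt_coeff]
  split_ifs <;> simp

/-- With `X = 1 / (τ - τ̄)`, formal integration of `X² q'` with respect to `τ̄` gives back `q`, up to the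
constant term. -/
theorem formalInt_X_sq_mul_derivative {q : ℂ[X]} (hq : q.coeff 0 = 0) :
    formalInt (X ^ 2 * derivative q) = q := by
  ext m
  rw [formalInt_coeff]
  rcases m with _ | m
  · simp [hq]
  · rw [if_pos (by omega), show m + 1 + 1 = m + 2 by ring, coeff_X_pow_mul, coeff_derivative]
    push_cast
    field_simp

theorem fMap_add_two (ε : ℤˣ) (n : ℕ) (w : List Gen) (z : Gen) :
    fMap ε (n + 2) w z = ∑ i : Fin (n + 2), ∑ j : Fin (n + 2), ∑ k : Fin (n + 2),
        if 1 ≤ i.val ∧ 1 ≤ j.val ∧ 1 ≤ k.val ∧ i.val + j.val + k.val = n + 2 then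
          formalInt (applyOps (psiThree ε)
            [fMap ε i.val (w.take i.val), fMap ε j.val ((w.drop i.val).take j.val),
              fMap ε k.val (w.drop (i.val + j.val))] z)
        else 0 := by
  rw [fMap]

theorem flow_letter_nil (ε : ℤˣ) (x : Gen) : flow (psiSeries ε) (letter x) [] = 0 := by
  simp [flow]

theorem derivative_flow_letter (ε : ℤˣ) (z : Gen) (w : List Gen) :
    derivative (flow (psiSeries ε) (letter z) w) = (C (psiSign z * psiConst ε : ℂ) •
      (flow (psiSeries ε) (letter (psiLetters z).1) * (flow (psiSeries ε) (letter (psiLetters z).2.1) *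
        flow (psiSeries ε) (letter (psiLetters z).2.2)))) w := by
  have hp := psiSeries_apply_eq_zero ε
  have h : flow (psiSeries ε) (psiSeries ε z) = dX (flow (psiSeries ε) (letter z)) := by
    rw [flow_ode hp, ← flow_D hp, D_letter _ (fun y => hp y [] (by simp))]
  rw [← flow_mul hp, ← flow_mul hp, ← flow_smul hp, ← dX_apply, ← h]
  rfl

/-- The maps `fₙ` are the flow of the derivation given by `ψ₃`, applied to the variables. -/
theorem fMap_eq_flow (ε : ℤˣ) (n : ℕ) (w : List Gen) (hw : w.length = n) (z : Gen) :
    fMap ε n w z = flow (psiSeries ε) (letter z) w := by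
  have hnil := flow_letter_nil ε
  have hcoeff : ∀ w z, (flow (psiSeries ε) (letter z) w).coeff 0 = letter z w := fun w z =>
    congrArg (fun u => u.coeff w) (coeffX_zero_flow (psiSeries_apply_eq_zero ε) (letter z))
  induction n using Nat.strong_induction_on generalizing w z with
  | _ n ih =>
    match n, hw with
    | 0, hw =>
      obtain rfl : w = [] := List.length_eq_zero_iff.1 hw
      rw [hnil]; simp [fMap]
    | 1, hw =>
      obtain ⟨x, rfl⟩ := List.length_eq_one_iff.1 hw
      have h0 : derivative (flow (psiSeries ε) (letter z) [x]) = 0 := by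
        rw [derivative_flow_letter]; simp [mul_cons, hnil]
      rw [eq_C_of_derivative_eq_zero h0, hcoeff]
      simp only [fMap, letter, List.cons.injEq, and_true]
      split_ifs <;> simp
    | n + 2, hw =>
      have h0 : (letter z : NCSeries Gen ℂ) w = 0 := by
        match w, hw with
        | _ :: _ :: _, _ => rfl
      rw [← formalInt_X_sq_mul_derivative ((hcoeff w z).trans h0), derivative_flow_letter, NCSeries.smul_apply,
        mul_mul_apply_of_nil (hnil _) (hnil _) (hnil _) (n + 2) w hw, fMap_add_two]
      simp only [Finset.mul_sum, formalInt_sum]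
      refine Finset.sum_congr rfl fun i _ => Finset.sum_congr rfl fun j _ =>
        Finset.sum_congr rfl fun k _ => ?_
      split_ifs with h
      · rw [applyOps_psiThree, ih i i.2 _ (by simp; omega), ih j j.2 _ (by simp; omega),
          ih k k.2 _ (by simp; omega)]
      · simp [formalInt_zero]

end EllipticCurveAlgebra

namespace NCSeries

/-! ### Series of the form `∑ x^a K_a` -/

section PowSum

variable {α R S : Type*} [CommRing R] [CommRing S] [DecidableEq α]

/-- The coefficients of `powSum`, by recursion on the word. -/
def powSumAux (x : α) : (ℕ → NCSeries α R) → List α → R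
  | K, [] => K 0 []
  | K, y :: w => K 0 (y :: w) + if y = x then powSumAux x (fun a => K (a + 1)) w else 0

/-- The series `∑ₐ x^a K a`. -/
def powSum (x : α) (K : ℕ → NCSeries α R) : NCSeries α R := ⟨powSumAux x K⟩

@[simp] theorem powSum_nil (x : α) (K : ℕ → NCSeries α R) : powSum x K [] = K 0 [] := rfl

theorem powSum_cons (x y : α) (K : ℕ → NCSeries α R) (w : List α) :
    powSum x K (y :: w) = K 0 (y :: w) + if y = x then powSum x (fun a => K (a + 1)) w else 0 := rfl

theorem powSum_eq (x : α) (K : ℕ → NCSeries α R) :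
    powSum x K = K 0 + letter x * powSum x (fun a => K (a + 1)) := by
  ext w; cases w <;> simp [powSum_cons]

@[simp] theorem powSum_zero (x : α) : powSum x (fun _ => (0 : NCSeries α R)) = 0 := by
  ext w; induction w with
  | nil => simp
  | cons y w ih => simp [powSum_cons, ih]

theorem powSum_add (x : α) (K K' : ℕ → NCSeries α R) :
    powSum x (fun a => K a + K' a) = powSum x K + powSum x K' := by
  ext w; induction w generalizing K K' with
  | nil => simp
  | cons y w ih => simp only [powSum_cons, ih, add_apply]; split_ifs <;> ring

theorem powSum_smul (x : α) (r : R) (K : ℕ → NCSeries α R) :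
    powSum x (fun a => r • K a) = r • powSum x K := by
  ext w; induction w generalizing K with
  | nil => simp
  | cons y w ih => simp only [powSum_cons, ih, smul_apply]; split_ifs <;> ring

theorem powSum_mul (x : α) (K : ℕ → NCSeries α R) (v : NCSeries α R) :
    powSum x K * v = powSum x (fun a => K a * v) := by
  ext w; induction w generalizing K with
  | nil => simp
  | cons y w ih =>
    rw [powSum_eq, add_mul, mul_assoc, add_apply, powSum_cons, letter_mul_cons, ih]

/-- The letter `x` commutes with its own powers. -/
theorem letter_mul_powSum_comm (x : α) (K : ℕ → NCSeries α R) :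
    powSum x (fun a => letter x * K a) = letter x * powSum x K := by
  ext w; induction w generalizing K with
  | nil => simp
  | cons y w ih =>
    rw [powSum_cons, letter_mul_cons, letter_mul_cons, ih]
    split_ifs
    · rw [powSum_eq x K, add_apply]
    · simp

/-- Multiplication by `x` shifts the index. -/
theorem letter_mul_powSum (x : α) (K : ℕ → NCSeries α R) :
    letter x * powSum x K = powSum x (fun a => if 0 < a then K (a - 1) else 0) := by
  rw [powSum_eq x (fun a => if 0 < a then K (a - 1) else 0)]
  simp

theorem powSum_of_succ_eq_zero (x : α) (K : ℕ → NCSeries α R) (h : ∀ a, K (a + 1) = 0) :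
    powSum x K = K 0 := by
  rw [powSum_eq]; simp [h]

theorem powSum_of_two_le_eq_zero (x : α) (K : ℕ → NCSeries α R) (h : ∀ a, K (a + 2) = 0) :
    powSum x K = K 0 + letter x * K 1 := by
  rw [powSum_eq, powSum_of_succ_eq_zero x (fun a => K (a + 1)) h]

theorem map_powSum (φ : R →+* S) (x : α) (K : ℕ → NCSeries α R) :
    map φ (powSum x K) = powSum x (fun a => map φ (K a)) := by
  ext w; induction w generalizing K with
  | nil => simp
  | cons y w ih =>
    rw [map_apply, powSum_cons, powSum_cons, map_add, ← map_apply φ (K 0), ← ih]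
    split_ifs <;> simp

theorem map_letter (φ : R →+* S) (x : α) : map φ (letter x : NCSeries α R) = letter x := by
  ext w
  match w with
  | [] => simp
  | [y] => simp [letter, apply_ite φ]
  | _ :: _ :: _ => simp [letter]

omit [DecidableEq α] in
theorem map_smul_one (φ : R →+* S) (r : R) : map φ (r • (1 : NCSeries α R)) = φ r • 1 := by
  ext w; cases w <;> simp

/-- A derivation that does not move `x` acts term by term on `∑ x^a K_a`. -/
theorem D_powSum [Fintype α] {s : α → R} {q : α → NCSeries α R} (hq : ∀ y, q y [] = 0) {x : α}
    (hx : q x = 0) (hs : s x = 1) (K : ℕ → NCSeries α R) :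
    D s q (powSum x K) = powSum x (fun a => D s q (K a)) := by
  have h : ∀ K : ℕ → NCSeries α R, D s q (powSum x K) =
      D s q (K 0) + letter x * D s q (powSum x (fun a => K (a + 1))) := by
    intro K
    have ht : twist s (letter x) = letter x := by rw [twist_letter, hs, one_smul]
    conv_lhs => rw [powSum_eq]
    rw [D_add, D_mul _ hq, D_letter _ hq, hx, zero_mul, zero_add, ht]
  ext w; induction w generalizing K with
  | nil => simp
  | cons y w ih =>
    rw [h, powSum_cons, add_apply, letter_mul_cons, ih]

theorem IsHomog.powSum {g : α → ℤ} {x : α} (hx : g x = 0) {K : ℕ → NCSeries α R} {d : ℤ}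
    (hK : ∀ a, IsHomog g (K a) d) : IsHomog g (powSum x K) d := by
  intro w hw
  induction w generalizing K with
  | nil => exact hK 0 _ hw
  | cons y w ih =>
    rw [powSum_cons] at hw
    by_cases h : K 0 (y :: w) = 0
    · rw [h, zero_add] at hw
      split_ifs at hw with hy
      · simp [hy, hx, ih (fun a => hK (a + 1)) hw]
      · exact absurd rfl hw
    · exact hK 0 _ h

/-! ### Right quotients -/

/-- The series of right quotients by the letter `y`: the coefficient of `w` is that of `w y` in `u`. -/
def rtail (y : α) (u : NCSeries α R) : NCSeries α R := ⟨fun w => u (w ++ [y])⟩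

omit [CommRing R] [DecidableEq α] in
@[simp] theorem rtail_apply (y : α) (u : NCSeries α R) (w : List α) : rtail y u w = u (w ++ [y]) := rfl

theorem rtail_letter_mul (x y : α) (u : NCSeries α R) :
    rtail y (letter x * u) = letter x * rtail y u + if y = x then u [] • 1 else 0 := by
  ext w
  cases w with
  | nil => simp only [rtail_apply, List.nil_append, letter_mul_cons, add_apply, letter_mul_nil]
           split_ifs <;> simp
  | cons z w =>
    simp only [rtail_apply, List.cons_append, letter_mul_cons, add_apply]
    split_ifs <;> simp

theorem rtail_powSum (x y : α) (K : ℕ → NCSeries α R) (hK : ∀ a, K a [] = 0) :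
    rtail y (powSum x K) = powSum x (fun a => rtail y (K a)) := by
  ext w
  induction w generalizing K with
  | nil => simp [powSum_cons, hK]
  | cons z w ih =>
    have := ih (fun a => K (a + 1)) (fun a => hK _)
    rw [rtail_apply] at this
    rw [rtail_apply, List.cons_append, powSum_cons, powSum_cons, this]
    rfl

theorem rtail_powSum_smul_one (x y : α) (k : ℕ → R) :
    rtail y (powSum x (fun a => k a • (1 : NCSeries α R))) =
      if y = x then powSum x (fun a => k (a + 1) • 1) else 0 := by
  ext w
  induction w generalizing k with
  | nil =>
    simp [powSum_cons]
    split_ifs <;> simp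
  | cons z w ih =>
    have := ih (fun a => k (a + 1))
    rw [rtail_apply] at this
    rw [rtail_apply, List.cons_append, powSum_cons, this]
    split_ifs <;> simp [powSum_cons, *]

theorem tail_letter_mul (x y : α) (u : NCSeries α R) :
    tail y (letter x * u) = if y = x then u else 0 := by
  ext w; simp only [tail_apply, letter_mul_cons]; split_ifs <;> simp

theorem tail_powSum (x y : α) (K : ℕ → NCSeries α R) :
    tail y (powSum x K) = tail y (K 0) + if y = x then powSum x (fun a => K (a + 1)) else 0 := by
  ext w; simp only [tail_apply, powSum_cons, add_apply]; split_ifs <;> simp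

/-! ### Truncation to words of bounded length -/

/-- The series with the single word `v`. -/
def mono (v : List α) : NCSeries α R := ⟨fun w => if w = v then 1 else 0⟩

theorem mono_apply (v w : List α) : (mono v : NCSeries α R) w = if w = v then 1 else 0 := rfl

theorem letter_mul_mono (x : α) (v : List α) : letter x * (mono v : NCSeries α R) = mono (x :: v) := by
  ext w
  cases w with
  | nil => simp [mono]
  | cons y w => simp only [letter_mul_cons, mono_apply, List.cons.injEq, ite_and]

theorem mono_nil : (mono [] : NCSeries α R) = 1 := by
  ext w; cases w <;> simp [mono]

theorem letter_mul_letter (x y : α) : (letter x * letter y : NCSeries α R) = mono [x, y] := by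
  rw [← letter_mul_mono, ← letter_mul_mono, mono_nil, mul_one]

/-- Equality of the coefficients of all words of length at most `N`. -/
def AgreeTo (N : ℕ) (u v : NCSeries α R) : Prop := ∀ w, w.length ≤ N → u w = v w

theorem AgreeTo.letter_mul {N : ℕ} {u v : NCSeries α R} (x : α) (h : AgreeTo N u v) :
    AgreeTo (N + 1) (letter x * u) (letter x * v) := by
  intro w hw
  cases w with
  | nil => simp
  | cons y w =>
    rw [letter_mul_cons, letter_mul_cons, h w (by simpa using hw)]

omit [DecidableEq α] in
theorem AgreeTo.sum {ι : Type*} {N : ℕ} (t : Finset ι) {u v : ι → NCSeries α R}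
    (h : ∀ i, AgreeTo N (u i) (v i)) : AgreeTo N (∑ i ∈ t, u i) (∑ i ∈ t, v i) := by
  intro w hw
  rw [sum_apply, sum_apply]
  exact Finset.sum_congr rfl fun i _ => h i w hw

omit [DecidableEq α] [CommRing R] in
theorem AgreeTo.mono_le {N M : ℕ} {u v : NCSeries α R} (h : AgreeTo N u v) (hM : M ≤ N) :
    AgreeTo M u v := fun w hw => h w (hw.trans hM)

theorem AgreeTo.pow_mul {N : ℕ} {u v : NCSeries α R} (x : α) (a : ℕ) (h : AgreeTo N u v) :
    AgreeTo N (letter x ^ a * u) (letter x ^ a * v) := by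
  induction a with
  | zero => simpa using h
  | succ a ih =>
    rw [pow_succ', mul_assoc, mul_assoc]
    exact (ih.letter_mul x).mono_le (Nat.le_succ N)

/-- Up to length `N` only the first `N + 1` terms contribute to `powSum x K`. -/
theorem powSum_agreeTo (x : α) (N : ℕ) (K : ℕ → NCSeries α R) :
    AgreeTo N (powSum x K) (∑ a ∈ Finset.range (N + 1), letter x ^ a * K a) := by
  induction N generalizing K with
  | zero =>
    intro w hw
    obtain rfl : w = [] := List.length_eq_zero_iff.1 (by omega)
    simp
  | succ N ih =>
    intro w hw
    rw [powSum_eq, Finset.sum_range_succ']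
    have h := (ih (fun a => K (a + 1))).letter_mul x w hw
    rw [add_apply, h, Finset.mul_sum, add_apply, add_comm]
    simp [pow_succ', mul_assoc]

/-- If the `K a` have no constant term, one term fewer contributes; the sums in `muHigher` are cut off
accordingly. -/
theorem powSum_agreeTo_of_nil (x : α) (N : ℕ) (K : ℕ → NCSeries α R) (hK : ∀ a, K a [] = 0) :
    AgreeTo N (powSum x K) (∑ a ∈ Finset.range N, letter x ^ a * K a) := by
  induction N generalizing K with
  | zero =>
    intro w hw
    obtain rfl : w = [] := List.length_eq_zero_iff.1 (by omega)
    simp [hK]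
  | succ N ih =>
    intro w hw
    rw [powSum_eq, Finset.sum_range_succ']
    have h := (ih (fun a => K (a + 1)) (fun a => hK _)).letter_mul x w hw
    rw [add_apply, h, Finset.mul_sum, add_apply, add_comm]
    simp [pow_succ', mul_assoc]

theorem pow_mul_mono (x : α) (a : ℕ) (v : List α) :
    letter x ^ a * (mono v : NCSeries α R) = mono (List.replicate a x ++ v) := by
  induction a with
  | zero => simp
  | succ a ih => rw [pow_succ', mul_assoc, ih, letter_mul_mono, List.replicate_succ, List.cons_append]

end PowSum

section PowSumDeriv

variable {α K : Type*} [DecidableEq α] [Field K]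

open Polynomial

theorem dX_powSum (x : α) (V : ℕ → NCSeries α K[X]) : dX (powSum x V) = powSum x (fun a => dX (V a)) := by
  ext1 w; induction w generalizing V with
  | nil => simp
  | cons y w ih =>
    rw [dX_apply, powSum_cons, powSum_cons, derivative_add, ← dX_apply (V 0), ← ih]
    split_ifs <;> simp

theorem dX_letter_mul (x : α) (V : NCSeries α K[X]) : dX (letter x * V) = letter x * dX V := by
  ext1 w
  cases w with
  | nil => simp
  | cons y w => simp only [dX_apply, letter_mul_cons]; split_ifs <;> simp

omit [DecidableEq α] in
theorem dX_smul_one (r : K[X]) : dX (r • (1 : NCSeries α K[X])) = derivative r • 1 := by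
  ext1 w; cases w <;> simp

end PowSumDeriv

end NCSeries

namespace EllipticCurveAlgebra

open NCSeries Gen

/-! ### The products as series -/

section Products

variable {R S : Type} [CommRing R] [CommRing S]

/-- `∑ h a b c d • ξ_L^a η ξ^b θ ξ_L^c η ξ^d`. -/
def serEta (h : ℕ → ℕ → ℕ → ℕ → R) : NCSeries Gen R :=
  powSum xiL fun a => letter eta * powSum xi fun b => letter theta * powSum xiL fun c =>
    letter eta * powSum xi fun d => h a b c d • 1

/-- `∑ h a b c d • ξ^b θ ξ_L^c η ξ^d θ ξ_L^a`. -/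
def serTheta (h : ℕ → ℕ → ℕ → ℕ → R) : NCSeries Gen R :=
  powSum xi fun b => letter theta * powSum xiL fun c => letter eta * powSum xi fun d =>
    letter theta * powSum xiL fun a => h a b c d • 1

/-- `∑ k a i j c d • ξ^i θ ξ_L^c η ξ^d θ ξ_L^a η ξ^j`. -/
def serIdO (k : ℕ → ℕ → ℕ → ℕ → ℕ → R) : NCSeries Gen R :=
  powSum xi fun i => letter theta * powSum xiL fun c => letter eta * powSum xi fun d =>
    letter theta * powSum xiL fun a => letter eta * powSum xi fun j => k a i j c d • 1

/-- `∑ k i j b c d • ξ_L^i η ξ^b θ ξ_L^c η ξ^d θ ξ_L^j`. -/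
def serIdL (k : ℕ → ℕ → ℕ → ℕ → ℕ → R) : NCSeries Gen R :=
  powSum xiL fun i => letter eta * powSum xi fun b => letter theta * powSum xiL fun c =>
    letter eta * powSum xi fun d => letter theta * powSum xiL fun j => k i j b c d • 1

/-- The series of the operations `μ_k`, `k ≥ 3`, with structure constants `h a b c d` in the component
with output `η`. -/
def higherSeries (h : ℕ → ℕ → ℕ → ℕ → R) : Gen → NCSeries Gen R
  | eta => serEta h
  | theta => serTheta fun a b c d => -h a b c d
  | idO => serIdO fun a i j c d => -h a (i + j + 1) c d
  | idL => serIdL fun i j b c d => -h (i + j + 1) b c d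
  | xi | xiL => 0

/-- The series of the product `μ₂`. -/
def twoSeries (R : Type) [CommRing R] : Gen → NCSeries Gen R
  | xi => -(letter theta * letter eta) - letter idO * letter xi + letter xi * letter idO
  | xiL => letter eta * letter theta - letter idL * letter xiL + letter xiL * letter idL
  | idO => -(letter idO * letter idO)
  | idL => -(letter idL * letter idL)
  | theta => -(letter idO * letter theta) - letter theta * letter idL
  | eta => -(letter idL * letter eta) + letter eta * letter idO

/-- The series of all products. -/
def muSeries (h : ℕ → ℕ → ℕ → ℕ → R) (z : Gen) : NCSeries Gen R := twoSeries R z + higherSeries h z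

/-- The series of `ψ₃` with constant `c`. -/
def psiSer (c : R) (z : Gen) : NCSeries Gen R :=
  ((psiSign z : R) * c) •
    (letter (psiLetters z).1 * (letter (psiLetters z).2.1 * letter (psiLetters z).2.2))

theorem higherSeries_nil (h : ℕ → ℕ → ℕ → ℕ → R) (z : Gen) : higherSeries h z [] = 0 := by
  cases z <;> simp [higherSeries, serEta, serTheta, serIdO, serIdL]

theorem twoSeries_nil (z : Gen) : twoSeries R z [] = 0 := by
  cases z <;> simp [twoSeries]

theorem muSeries_nil (h : ℕ → ℕ → ℕ → ℕ → R) (z : Gen) : muSeries h z [] = 0 := by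
  simp [muSeries, higherSeries_nil, twoSeries_nil]

theorem psiSer_nil (c : R) (z : Gen) : psiSer c z [] = 0 := by simp [psiSer]

/-! ### The evolution equation of the products -/

section Evolution

/-- Inserting the word `x e y` for the letter `e` between a block of `x` and a block of `y` shifts the
exponents of both blocks. This is how `ψ₃` acts on the letters `θ` and `η`. -/
theorem powSum_lower_pair (x e y : Gen) (V : ℕ → ℕ → NCSeries Gen R) :
    powSum x (fun a => letter x * (letter e * (letter y * powSum y (V a)))) =
      powSum x fun a => letter e * powSum y fun b =>
        if 0 < a ∧ 0 < b then V (a - 1) (b - 1) else 0 := by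
  rw [letter_mul_powSum_comm, letter_mul_powSum]
  congr 1
  funext a
  by_cases ha : 0 < a
  · simp only [ha, if_true, true_and, letter_mul_powSum]
  · simp [ha]

/-- The structure constants with the indices `a` and `b` lowered. -/
def lowAB (h : ℕ → ℕ → ℕ → ℕ → R) (a b c d : ℕ) : R := if 0 < a ∧ 0 < b then h (a - 1) (b - 1) c d else 0

/-- The structure constants with the indices `b` and `c` lowered. -/
def lowBC (h : ℕ → ℕ → ℕ → ℕ → R) (a b c d : ℕ) : R := if 0 < b ∧ 0 < c then h a (b - 1) (c - 1) d else 0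

/-- The structure constants with the indices `c` and `d` lowered. -/
def lowCD (h : ℕ → ℕ → ℕ → ℕ → R) (a b c d : ℕ) : R := if 0 < c ∧ 0 < d then h a b (c - 1) (d - 1) else 0

/-- The structure constants with the indices `d` and `a` lowered. -/
def lowDA (h : ℕ → ℕ → ℕ → ℕ → R) (a b c d : ℕ) : R := if 0 < a ∧ 0 < d then h (a - 1) b c (d - 1) else 0

theorem ite_smul_one (P : Prop) [Decidable P] (r : R) :
    (if P then r • (1 : NCSeries Gen R) else 0) = (if P then r else 0) • 1 := by
  split_ifs <;> simp

theorem ite_letter_mul_powSum (P : Prop) [Decidable P] (x y : Gen) (K : ℕ → NCSeries Gen R) :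
    (if P then letter x * powSum y K else 0) = letter x * powSum y fun a => if P then K a else 0 := by
  split_ifs <;> simp

theorem D_untwisted_letter_mul {p : Gen → NCSeries Gen R} (hp : ∀ y, p y [] = 0) (x : Gen)
    (u : NCSeries Gen R) :
    D (fun _ => 1) p (letter x * u) = p x * u + letter x * D (fun _ => 1) p u := by
  rw [D_mul _ hp, D_letter _ hp, twist_const_one]

theorem psiSer_xi (c : R) : psiSer c xi = 0 := by simp [psiSer, psiSign]

theorem psiSer_xiL (c : R) : psiSer c xiL = 0 := by simp [psiSer, psiSign]

theorem psiSer_eta (c : R) : psiSer c eta = (-c) • (letter xiL * (letter eta * letter xi)) := by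
  simp [psiSer, psiSign, psiLetters]

theorem psiSer_theta (c : R) : psiSer c theta = c • (letter xi * (letter theta * letter xiL)) := by
  simp [psiSer, psiSign, psiLetters]

theorem psiSer_idO (c : R) : psiSer c idO = c • (letter theta * (letter xiL * letter eta)) := by
  simp [psiSer, psiSign, psiLetters]

theorem psiSer_idL (c : R) : psiSer c idL = c • (letter eta * (letter xi * letter theta)) := by
  simp [psiSer, psiSign, psiLetters]

theorem D_serEta (c : R) (h : ℕ → ℕ → ℕ → ℕ → R) :
    D (fun _ => 1) (psiSer c) (serEta h) =
      c • (serEta (lowBC h) - serEta (lowAB h) - serEta (lowCD h)) := by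
  have hp := psiSer_nil c
  simp only [serEta, D_powSum hp (psiSer_xi c), D_powSum hp (psiSer_xiL c), D_untwisted_letter_mul hp,
    D_smul, D_one, smul_zero, mul_zero, add_zero, powSum_zero, psiSer_eta, psiSer_theta, mul_add,
    powSum_add, smul_mul_assoc, mul_smul_comm, powSum_smul, mul_assoc, powSum_lower_pair,
    ite_letter_mul_powSum, ite_smul_one, lowAB, lowBC, lowCD]
  module

theorem D_serTheta (c : R) (h : ℕ → ℕ → ℕ → ℕ → R) :
    D (fun _ => 1) (psiSer c) (serTheta h) =
      c • (serTheta (lowBC h) - serTheta (lowCD h) + serTheta (lowDA h)) := by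
  have hp := psiSer_nil c
  simp only [serTheta, D_powSum hp (psiSer_xi c), D_powSum hp (psiSer_xiL c), D_untwisted_letter_mul hp,
    D_smul, D_one, smul_zero, mul_zero, add_zero, powSum_zero, psiSer_eta, psiSer_theta, mul_add,
    powSum_add, smul_mul_assoc, mul_smul_comm, powSum_smul, mul_assoc, powSum_lower_pair,
    ite_letter_mul_powSum, ite_smul_one, lowBC, lowCD, lowDA, and_comm]
  module

theorem D_serIdO (c : R) (k : ℕ → ℕ → ℕ → ℕ → ℕ → R) :
    D (fun _ => 1) (psiSer c) (serIdO k) =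
      c • (serIdO (fun a i j c d => if 0 < i ∧ 0 < c then k a (i - 1) j (c - 1) d else 0)
        - serIdO (fun a i j c d => if 0 < c ∧ 0 < d then k a i j (c - 1) (d - 1) else 0)
        + serIdO (fun a i j c d => if 0 < d ∧ 0 < a then k (a - 1) i j c (d - 1) else 0)
        - serIdO (fun a i j c d => if 0 < a ∧ 0 < j then k (a - 1) i (j - 1) c d else 0)) := by
  have hp := psiSer_nil c
  simp only [serIdO, D_powSum hp (psiSer_xi c), D_powSum hp (psiSer_xiL c), D_untwisted_letter_mul hp,
    D_smul, D_one, smul_zero, mul_zero, add_zero, powSum_zero, psiSer_eta, psiSer_theta, mul_add,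
    powSum_add, smul_mul_assoc, mul_smul_comm, powSum_smul, mul_assoc, powSum_lower_pair,
    ite_letter_mul_powSum, ite_smul_one]
  module

theorem D_serIdL (c : R) (k : ℕ → ℕ → ℕ → ℕ → ℕ → R) :
    D (fun _ => 1) (psiSer c) (serIdL k) =
      c • (serIdL (fun i j b c d => if 0 < b ∧ 0 < c then k i j (b - 1) (c - 1) d else 0)
        - serIdL (fun i j b c d => if 0 < i ∧ 0 < b then k (i - 1) j (b - 1) c d else 0)
        - serIdL (fun i j b c d => if 0 < c ∧ 0 < d then k i j b (c - 1) (d - 1) else 0)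
        + serIdL (fun i j b c d => if 0 < d ∧ 0 < j then k i (j - 1) b c (d - 1) else 0)) := by
  have hp := psiSer_nil c
  simp only [serIdL, D_powSum hp (psiSer_xi c), D_powSum hp (psiSer_xiL c), D_untwisted_letter_mul hp,
    D_smul, D_one, smul_zero, mul_zero, add_zero, powSum_zero, psiSer_eta, psiSer_theta, mul_add,
    powSum_add, smul_mul_assoc, mul_smul_comm, powSum_smul, mul_assoc, powSum_lower_pair,
    ite_letter_mul_powSum, ite_smul_one]
  module

theorem powSum_smul_one_mul_letter (x : Gen) (k : ℕ → R) :
    powSum x (fun a => k a • (1 : NCSeries Gen R)) * letter x =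
      powSum x fun a => (if 0 < a then k (a - 1) else 0) • 1 := by
  have h : ∀ a, k a • (1 : NCSeries Gen R) * letter x = letter x * (k a • 1) := by
    intro a; rw [smul_mul_assoc, mul_smul_comm, one_mul, mul_one]
  simp only [powSum_mul, h, letter_mul_powSum_comm, letter_mul_powSum, ite_smul_one]

theorem powSum_smul_one_mul_letter_mul (x : Gen) (k : ℕ → R) (u : NCSeries Gen R) :
    powSum x (fun a => k a • (1 : NCSeries Gen R)) * (letter x * u) =
      powSum x fun a => (if 0 < a then k (a - 1) else 0) • u := by
  rw [← mul_assoc, powSum_smul_one_mul_letter, powSum_mul]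
  simp only [smul_mul_assoc, one_mul]

/-- The part of `D_μ ψ_η` in which the middle letter of `ψ_η` is replaced. -/
theorem xiL_mul_serEta_mul_xi (h : ℕ → ℕ → ℕ → ℕ → R) :
    letter xiL * (serEta h * letter xi) = serEta (lowDA h) := by
  simp only [serEta, powSum_mul _ (fun a => letter _ * _), mul_assoc, powSum_smul_one_mul_letter,
    letter_mul_powSum, ite_letter_mul_powSum, lowDA, ite_and]
  simp only [ite_smul_one]

theorem xi_mul_serTheta_mul_xiL (h : ℕ → ℕ → ℕ → ℕ → R) :
    letter xi * (serTheta h * letter xiL) = serTheta (lowAB h) := by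
  simp only [serTheta, powSum_mul _ (fun a => letter _ * _), mul_assoc, powSum_smul_one_mul_letter,
    letter_mul_powSum, ite_letter_mul_powSum, lowAB]
  simp only [ite_smul_one, ← ite_and, and_comm]

theorem powSum_ite_eq_zero (x : Gen) (P : Prop) [Decidable P] (r : R) :
    powSum x (fun j => (if j = 0 ∧ P then r else 0) • (1 : NCSeries Gen R)) =
      (if P then r else 0) • 1 := by
  rw [powSum_of_succ_eq_zero _ _ (by simp)]; simp

theorem smul_eq_letter_mul (r : R) (x : Gen) :
    r • (letter x : NCSeries Gen R) = letter x * (r • 1) := by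
  rw [mul_smul_comm, mul_one]

theorem serTheta_mul_xiL_mul_eta (h : ℕ → ℕ → ℕ → ℕ → R) :
    serTheta h * (letter xiL * letter eta) =
      serIdO fun a i j c d => if j = 0 ∧ 0 < a then h (a - 1) i c d else 0 := by
  simp only [serTheta, serIdO, powSum_mul _ (fun a => letter _ * _), mul_assoc,
    powSum_smul_one_mul_letter_mul, powSum_ite_eq_zero, smul_eq_letter_mul]

theorem theta_mul_xiL_mul_serEta (h : ℕ → ℕ → ℕ → ℕ → R) :
    letter theta * (letter xiL * serEta h) =
      serIdO fun a i j c d => if i = 0 ∧ 0 < c then h (c - 1) d a j else 0 := by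
  rw [serIdO, powSum_of_succ_eq_zero _ _ (by simp)]
  simp only [serEta, letter_mul_powSum, ite_letter_mul_powSum, ite_smul_one, true_and]

theorem serEta_mul_xi_mul_theta (h : ℕ → ℕ → ℕ → ℕ → R) :
    serEta h * (letter xi * letter theta) =
      serIdL fun i j b c d => if j = 0 ∧ 0 < d then h i b c (d - 1) else 0 := by
  simp only [serEta, serIdL, powSum_mul _ (fun a => letter _ * _), mul_assoc,
    powSum_smul_one_mul_letter_mul, powSum_ite_eq_zero, smul_eq_letter_mul]

theorem eta_mul_xi_mul_serTheta (h : ℕ → ℕ → ℕ → ℕ → R) :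
    letter eta * (letter xi * serTheta h) =
      serIdL fun i j b c d => if i = 0 ∧ 0 < b then h j (b - 1) c d else 0 := by
  rw [serIdL, powSum_of_succ_eq_zero _ _ (by simp)]
  simp only [serTheta, letter_mul_powSum, ite_letter_mul_powSum, ite_smul_one, true_and]

/-! ### Linearity of the families -/

theorem serEta_add (h h' : ℕ → ℕ → ℕ → ℕ → R) :
    serEta (fun a b c d => h a b c d + h' a b c d) = serEta h + serEta h' := by
  simp only [serEta, add_smul, powSum_add, mul_add]

theorem serEta_smul (r : R) (h : ℕ → ℕ → ℕ → ℕ → R) :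
    serEta (fun a b c d => r * h a b c d) = r • serEta h := by
  simp only [serEta, mul_smul, powSum_smul, mul_smul_comm]

theorem serTheta_add (h h' : ℕ → ℕ → ℕ → ℕ → R) :
    serTheta (fun a b c d => h a b c d + h' a b c d) = serTheta h + serTheta h' := by
  simp only [serTheta, add_smul, powSum_add, mul_add]

theorem serTheta_smul (r : R) (h : ℕ → ℕ → ℕ → ℕ → R) :
    serTheta (fun a b c d => r * h a b c d) = r • serTheta h := by
  simp only [serTheta, mul_smul, powSum_smul, mul_smul_comm]

theorem serIdO_add (k k' : ℕ → ℕ → ℕ → ℕ → ℕ → R) :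
    serIdO (fun a i j c d => k a i j c d + k' a i j c d) = serIdO k + serIdO k' := by
  simp only [serIdO, add_smul, powSum_add, mul_add]

theorem serIdO_smul (r : R) (k : ℕ → ℕ → ℕ → ℕ → ℕ → R) :
    serIdO (fun a i j c d => r * k a i j c d) = r • serIdO k := by
  simp only [serIdO, mul_smul, powSum_smul, mul_smul_comm]

theorem serIdO_sub (k k' : ℕ → ℕ → ℕ → ℕ → ℕ → R) :
    serIdO (fun a i j c d => k a i j c d - k' a i j c d) = serIdO k - serIdO k' := by
  have h := serIdO_smul (-1) k'
  have h2 := serIdO_add k (fun a i j c d => -1 * k' a i j c d)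
  rw [h] at h2
  simpa [sub_eq_add_neg] using h2

theorem serIdL_add (k k' : ℕ → ℕ → ℕ → ℕ → ℕ → R) :
    serIdL (fun i j b c d => k i j b c d + k' i j b c d) = serIdL k + serIdL k' := by
  simp only [serIdL, add_smul, powSum_add, mul_add]

theorem serIdL_smul (r : R) (k : ℕ → ℕ → ℕ → ℕ → ℕ → R) :
    serIdL (fun i j b c d => r * k i j b c d) = r • serIdL k := by
  simp only [serIdL, mul_smul, powSum_smul, mul_smul_comm]

theorem serIdL_sub (k k' : ℕ → ℕ → ℕ → ℕ → ℕ → R) :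
    serIdL (fun i j b c d => k i j b c d - k' i j b c d) = serIdL k - serIdL k' := by
  have h := serIdL_smul (-1) k'
  have h2 := serIdL_add k (fun i j b c d => -1 * k' i j b c d)
  rw [h] at h2
  simpa [sub_eq_add_neg] using h2

theorem koszulSign_theta : koszulSign R theta = -1 := by simp [koszulSign, koszul, Gen.sdeg, Gen.deg]

theorem koszulSign_eta : koszulSign R eta = 1 := by simp [koszulSign, koszul, Gen.sdeg, Gen.deg]

theorem koszulSign_xi : koszulSign R xi = 1 := by simp [koszulSign, koszul, Gen.sdeg, Gen.deg]

theorem koszulSign_xiL : koszulSign R xiL = 1 := by simp [koszulSign, koszul, Gen.sdeg, Gen.deg]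

/-- The part of the derivative of the structure constants that comes from the higher products. -/
def lowered (c : R) (h : ℕ → ℕ → ℕ → ℕ → R) (i j k l : ℕ) : R :=
  -c * (lowAB h i j k l - lowBC h i j k l + lowCD h i j k l - lowDA h i j k l)

theorem D_koszul_letter_mul {q : Gen → NCSeries Gen R} (hq : ∀ y, q y [] = 0) (x : Gen)
    (u : NCSeries Gen R) :
    D (koszulSign R) q (letter x * u) = q x * u + koszulSign R x • (letter x * D (koszulSign R) q u) := by
  rw [D_mul _ hq, D_letter _ hq, twist_letter, smul_mul_assoc]

/-- The commutator of the higher products with `ψ₃`. The four ways to lower two cyclically adjacent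
indices come from the four letters of the cyclic word `η ξ^b θ ξ_L^c η ξ^d θ ξ_L^a` that `ψ₃` can
produce. -/
theorem higherSeries_commutator (c : R) (h : ℕ → ℕ → ℕ → ℕ → R)
    (hrot : ∀ i j k l, h k l i j = -h i j k l) (z : Gen) :
    D (fun _ => 1) (psiSer c) (higherSeries h z) -
      D (koszulSign R) (higherSeries h) (psiSer c z) = higherSeries (lowered c h) z := by
  have hq := higherSeries_nil h
  have hneg : ∀ h : ℕ → ℕ → ℕ → ℕ → R, serTheta (fun a b c d => -h a b c d) = (-1 : R) • serTheta h := by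
    intro h; rw [← serTheta_smul]; simp
  cases z with
  | xi => simp [higherSeries, psiSer_xi]
  | xiL => simp [higherSeries, psiSer_xiL]
  | eta =>
    rw [psiSer_eta, D_smul, D_koszul_letter_mul hq, D_koszul_letter_mul hq, D_letter _ hq]
    simp only [higherSeries, zero_mul, mul_zero, smul_zero, add_zero, zero_add, koszulSign_xiL, one_smul,
      xiL_mul_serEta_mul_xi, D_serEta]
    have : serEta (lowered c h) = (-c) • (serEta (lowAB h) + (-1 : R) • serEta (lowBC h) +
        serEta (lowCD h) + (-1 : R) • serEta (lowDA h)) := by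
      simp only [← serEta_add, ← serEta_smul]
      congr 1; funext i j k l; simp only [lowered]; ring
    rw [this]; module
  | theta =>
    rw [psiSer_theta, D_smul, D_koszul_letter_mul hq, D_koszul_letter_mul hq, D_letter _ hq]
    simp only [higherSeries, zero_mul, mul_zero, smul_zero, add_zero, zero_add, koszulSign_xi, one_smul,
      hneg, smul_mul_assoc, mul_smul_comm, xi_mul_serTheta_mul_xiL, D_serTheta, D_smul]
    have : serTheta (lowered c h) = (-c) • (serTheta (lowAB h) + (-1 : R) • serTheta (lowBC h) +
        serTheta (lowCD h) + (-1 : R) • serTheta (lowDA h)) := by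
      simp only [← serTheta_add, ← serTheta_smul]
      congr 1; funext i j k l; simp only [lowered]; ring
    rw [this]; module
  | idO =>
    rw [psiSer_idO, D_smul, D_koszul_letter_mul hq, D_koszul_letter_mul hq, D_letter _ hq]
    simp only [higherSeries, zero_mul, zero_add, koszulSign_theta,
      koszulSign_xiL, one_smul, D_serIdO]
    simp only [theta_mul_xiL_mul_serEta, hneg, smul_mul_assoc,
      serTheta_mul_xiL_mul_eta, ← serIdO_smul, ← serIdO_add, ← serIdO_sub]
    congr 1
    funext a i j c' d
    -- the block `ξ^(i+j+1)` is cut by the output: the boundary terms `i = 0` and `j = 0` are the ones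
    -- that come from `D_μ ψ`
    simp only [lowered, lowAB, lowBC, lowCD, lowDA, hrot a j (c' - 1) d]
    cases i <;> cases j <;> cases a <;> cases c' <;> cases d <;> simp <;> ring_nf
  | idL =>
    rw [psiSer_idL, D_smul, D_koszul_letter_mul hq, D_koszul_letter_mul hq, D_letter _ hq]
    simp only [higherSeries, zero_mul, zero_add, koszulSign_eta,
      koszulSign_xi, one_smul, serEta_mul_xi_mul_theta, hneg, mul_smul_comm, eta_mul_xi_mul_serTheta,
      D_serIdL, ← serIdL_smul, ← serIdL_add, ← serIdL_sub]
    congr 1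
    funext i j b c' d
    simp only [lowered, lowAB, lowBC, lowCD, lowDA]
    cases i <;> cases j <;> cases b <;> cases c' <;> cases d <;> simp <;> ring_nf

end Evolution

end Products

end EllipticCurveAlgebra

namespace EllipticCurveAlgebra

open NCSeries Gen

/-! ### The commutator of `μ₂` with `ψ₃` -/

section Products

variable {R S : Type} [CommRing R] [CommRing S]

section Evolution

/-- The structure constants, of the products with four inputs, that arise from the commutator of `μ₂`
with `ψ₃`. -/
def lowest (c : R) (i j k l : ℕ) : R := if i + j + k + l = 1 then (-1) ^ (i + j) * c else 0

theorem lowest_eq_zero (c : R) {i j k l : ℕ} (h : 2 ≤ i + j + k + l) : lowest c i j k l = 0 :=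
  if_neg (by omega)

theorem lowest_vanishing (c : R) :
    ((∀ i j k l, lowest c (i + 2) j k l = 0) ∧ (∀ i j k l, lowest c i (j + 2) k l = 0) ∧
      (∀ i j k l, lowest c i j (k + 2) l = 0) ∧ (∀ i j k l, lowest c i j k (l + 2) = 0)) ∧
    ((∀ j k l, lowest c 1 (j + 1) k l = 0) ∧ (∀ j k l, lowest c 1 j (k + 1) l = 0) ∧
      (∀ j k l, lowest c 1 j k (l + 1) = 0) ∧ (∀ i k l, lowest c i 1 (k + 1) l = 0) ∧
      (∀ i k l, lowest c i 1 k (l + 1) = 0) ∧ (∀ i j l, lowest c i j 1 (l + 1) = 0)) ∧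
    ((∀ i k l, lowest c (i + 1) 1 k l = 0) ∧ (∀ i j l, lowest c (i + 1) j 1 l = 0) ∧
      (∀ i j k, lowest c (i + 1) j k 1 = 0)) := by
  refine ⟨⟨?_, ?_, ?_, ?_⟩, ⟨?_, ?_, ?_, ?_, ?_, ?_⟩, ?_, ?_, ?_⟩ <;> intros <;>
    exact lowest_eq_zero c (by omega)

theorem higherSeries_lowest_eta (c : R) : higherSeries (lowest c) eta = c •
    (letter eta * (letter theta * (letter eta * letter xi)) +
      letter eta * (letter theta * (letter xiL * letter eta)) -
      letter eta * (letter xi * (letter theta * letter eta)) -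
      letter xiL * (letter eta * (letter theta * letter eta))) := by
  obtain ⟨⟨h1, h2, h3, h4⟩, ⟨h5, h6, h7, h8, h9, h10⟩, -⟩ := lowest_vanishing c
  rw [higherSeries, serEta, powSum_of_two_le_eq_zero xiL _ (by intro a; simp [h1]),
    powSum_of_two_le_eq_zero xi _ (by intro a; simp [h2]),
    powSum_of_two_le_eq_zero xiL _ (by intro a; simp [h3]),
    powSum_of_two_le_eq_zero xi _ (by intro a; simp [h4])]
  rw [powSum_of_succ_eq_zero xi _ (by intro a; simp [h10]),
    powSum_of_succ_eq_zero xiL _ (by intro a; simp [h8]),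
    powSum_of_succ_eq_zero xi _ (by intro a; simp [h9]),
    powSum_of_succ_eq_zero xi _ (by intro a; simp [h5]),
    powSum_of_succ_eq_zero xiL _ (by intro a; simp [h6]),
    powSum_of_succ_eq_zero xi _ (by intro a; simp [h7])]
  simp [lowest, mul_add, mul_smul_comm]
  module

theorem higherSeries_lowest_theta (c : R) : higherSeries (lowest c) theta = c •
    (letter theta * (letter eta * (letter theta * letter xiL)) +
      letter xi * (letter theta * (letter eta * letter theta)) -
      letter theta * (letter eta * (letter xi * letter theta)) -
      letter theta * (letter xiL * (letter eta * letter theta))) := by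
  obtain ⟨⟨h1, h2, h3, h4⟩, ⟨h5, h6, h7, h8, h9, h10⟩, h11, h12, h13⟩ := lowest_vanishing c
  rw [higherSeries, serTheta, powSum_of_two_le_eq_zero xi _ (by intro a; simp [h2]),
    powSum_of_two_le_eq_zero xiL _ (by intro a; simp [h3]),
    powSum_of_two_le_eq_zero xi _ (by intro a; simp [h4]),
    powSum_of_two_le_eq_zero xiL _ (by intro a; simp [h1])]
  rw [powSum_of_succ_eq_zero xiL _ (by intro a; simp [h13]),
    powSum_of_succ_eq_zero xi _ (by intro a; simp [h10]),
    powSum_of_succ_eq_zero xiL _ (by intro a; simp [h12]),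
    powSum_of_succ_eq_zero xiL _ (by intro a; simp [h8]),
    powSum_of_succ_eq_zero xi _ (by intro a; simp [h9]),
    powSum_of_succ_eq_zero xiL _ (by intro a; simp [h11])]
  simp [lowest, mul_add, mul_smul_comm]
  module

theorem higherSeries_lowest_idO (c : R) : higherSeries (lowest c) idO = c •
    (letter theta * (letter eta * (letter theta * letter eta))) := by
  rw [higherSeries, serIdO, powSum_of_succ_eq_zero xi _ (fun i => by
      simp [show ∀ a j c' d, lowest c a (i + 1 + j + 1) c' d = 0 from
        fun a j c' d => lowest_eq_zero c (by omega)])]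
  rw [powSum_of_succ_eq_zero xiL _ (fun i => by
      simp [show ∀ a j d, lowest c a (j + 1) (i + 1) d = 0 from
        fun a j d => lowest_eq_zero c (by omega)]),
    powSum_of_succ_eq_zero xi _ (fun i => by
      simp [show ∀ a j, lowest c a (j + 1) 0 (i + 1) = 0 from
        fun a j => lowest_eq_zero c (by omega)]),
    powSum_of_succ_eq_zero xiL _ (fun i => by
      simp [show ∀ j, lowest c (i + 1) (j + 1) 0 0 = 0 from
        fun j => lowest_eq_zero c (by omega)]),
    powSum_of_succ_eq_zero xi _ (fun i => by
      rw [lowest_eq_zero c (by omega)]; simp)]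
  simp [lowest, mul_smul_comm]

theorem higherSeries_lowest_idL (c : R) : higherSeries (lowest c) idL = c •
    (letter eta * (letter theta * (letter eta * letter theta))) := by
  rw [higherSeries, serIdL, powSum_of_succ_eq_zero xiL _ (fun i => by
      simp [show ∀ j b c' d, lowest c (i + 1 + j + 1) b c' d = 0 from
        fun j b c' d => lowest_eq_zero c (by omega)])]
  rw [powSum_of_succ_eq_zero xi _ (fun i => by
      simp [show ∀ j c' d, lowest c (j + 1) (i + 1) c' d = 0 from
        fun j c' d => lowest_eq_zero c (by omega)]),
    powSum_of_succ_eq_zero xiL _ (fun i => by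
      simp [show ∀ j d, lowest c (j + 1) 0 (i + 1) d = 0 from
        fun j d => lowest_eq_zero c (by omega)]),
    powSum_of_succ_eq_zero xi _ (fun i => by
      simp [show ∀ j, lowest c (j + 1) 0 0 (i + 1) = 0 from
        fun j => lowest_eq_zero c (by omega)]),
    powSum_of_succ_eq_zero xiL _ (fun i => by
      rw [lowest_eq_zero c (by omega)]; simp)]
  simp [lowest, mul_smul_comm]

/-- The commutator of `μ₂` with `ψ₃`. It accounts for the derivative of the non-holomorphic term of
`e₂^*`. -/
theorem twoSeries_commutator (c : R) (z : Gen) :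
    D (fun _ => 1) (psiSer c) (twoSeries R z) - D (koszulSign R) (twoSeries R) (psiSer c z) =
      higherSeries (lowest c) z := by
  have hp := psiSer_nil c
  have hq := twoSeries_nil (R := R)
  cases z with
  | xi =>
    simp only [psiSer_xi, twoSeries, higherSeries, D_add, D_sub, D_neg, D_untwisted_letter_mul hp,
      D_letter _ hp, psiSer_theta, psiSer_eta, psiSer_idO, D_zero, smul_mul_assoc, mul_smul_comm, mul_assoc,
      mul_zero, zero_mul]
    module
  | xiL =>
    simp only [psiSer_xiL, twoSeries, higherSeries, D_add, D_sub, D_untwisted_letter_mul hp,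
      D_letter _ hp, psiSer_theta, psiSer_eta, psiSer_idL, D_zero, smul_mul_assoc, mul_smul_comm, mul_assoc,
      mul_zero, zero_mul]
    module
  | eta =>
    rw [higherSeries_lowest_eta, psiSer_eta, D_smul, D_koszul_letter_mul hq, D_koszul_letter_mul hq,
      D_letter _ hq]
    simp only [psiSer_eta, psiSer_idL, psiSer_idO, twoSeries, D_add, D_neg, D_untwisted_letter_mul hp,
      D_letter _ hp, koszulSign_xiL, koszulSign_eta, one_smul, smul_mul_assoc, mul_smul_comm, mul_assoc,
      mul_add, add_mul, mul_sub, sub_mul, neg_mul, mul_neg]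
    module
  | theta =>
    rw [higherSeries_lowest_theta, psiSer_theta, D_smul, D_koszul_letter_mul hq, D_koszul_letter_mul hq,
      D_letter _ hq]
    simp only [psiSer_theta, psiSer_idL, psiSer_idO, twoSeries, D_sub, D_neg, D_untwisted_letter_mul hp,
      D_letter _ hp, koszulSign_xi, koszulSign_theta, one_smul, smul_mul_assoc, mul_smul_comm, mul_assoc,
      mul_add, add_mul, mul_sub, sub_mul, neg_mul, mul_neg]
    module
  | idO =>
    rw [higherSeries_lowest_idO, psiSer_idO, D_smul, D_koszul_letter_mul hq, D_koszul_letter_mul hq,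
      D_letter _ hq]
    simp only [psiSer_idO, twoSeries, D_neg, D_untwisted_letter_mul hp,
      D_letter _ hp, koszulSign_xiL, koszulSign_theta, one_smul, smul_mul_assoc, mul_smul_comm, mul_assoc,
      mul_add, add_mul, mul_sub, sub_mul, neg_mul, mul_neg]
    module
  | idL =>
    rw [higherSeries_lowest_idL, psiSer_idL, D_smul, D_koszul_letter_mul hq, D_koszul_letter_mul hq,
      D_letter _ hq]
    simp only [psiSer_idL, twoSeries, D_neg, D_untwisted_letter_mul hp,
      D_letter _ hp, koszulSign_eta, koszulSign_xi, one_smul, smul_mul_assoc, mul_smul_comm, mul_assoc,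
      mul_add, add_mul, mul_sub, sub_mul, neg_mul, mul_neg]
    module

theorem higherSeries_add (h h' : ℕ → ℕ → ℕ → ℕ → R) (z : Gen) :
    higherSeries (fun i j k l => h i j k l + h' i j k l) z = higherSeries h z + higherSeries h' z := by
  cases z <;> simp only [higherSeries, add_zero, ← serEta_add, ← serTheta_add, ← serIdO_add,
    ← serIdL_add, neg_add]

/-- The commutator of all products with `ψ₃`. -/
theorem muSeries_commutator (c : R) (h : ℕ → ℕ → ℕ → ℕ → R)
    (hrot : ∀ i j k l, h k l i j = -h i j k l) (z : Gen) :
    D (fun _ => 1) (psiSer c) (muSeries h z) - D (koszulSign R) (muSeries h) (psiSer c z) =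
      higherSeries (fun i j k l => lowest c i j k l + lowered c h i j k l) z := by
  rw [higherSeries_add, ← twoSeries_commutator, ← higherSeries_commutator c h hrot]
  have : D (koszulSign R) (muSeries h) (psiSer c z) =
      D (koszulSign R) (twoSeries R) (psiSer c z) + D (koszulSign R) (higherSeries h) (psiSer c z) :=
    D_add_right _ _ _ _
  rw [this, muSeries, D_add]
  abel

/-- The pairing tensor is killed by the derivation given by `ψ₃`. -/
theorem D_pairing_eq_zero (c : R) :
    D (fun _ => 1) (psiSer c) (∑ x : Gen, ∑ y : Gen, (pairGen x y : R) • (letter x * letter y)) = 0 := by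
  have hp := psiSer_nil c
  have hu : (∑ x : Gen, ∑ y : Gen, (pairGen x y : R) • (letter x * letter y : NCSeries Gen R)) =
      letter idO * letter xi - letter xi * letter idO + (letter idL * letter xiL -
        letter xiL * letter idL) + (letter theta * letter eta - letter eta * letter theta) := by
    have huniv : (Finset.univ : Finset Gen) = {idO, idL, theta, eta, xi, xiL} := rfl
    simp [huniv, pairGen]
    abel
  rw [hu]
  simp only [D_add, D_sub, D_untwisted_letter_mul hp, D_letter _ hp, psiSer_theta, psiSer_eta, psiSer_idO,
    psiSer_idL, psiSer_xi, psiSer_xiL, smul_mul_assoc, mul_smul_comm, mul_assoc, mul_zero, zero_mul]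
  module

end Evolution

end Products

end EllipticCurveAlgebra

namespace NCSeries

theorem AgreeTo.powSum {α R : Type*} [CommRing R] [DecidableEq α] {N : ℕ} (x : α)
    {K K' : ℕ → NCSeries α R} (hK : ∀ a, K a [] = 0) (h : ∀ a, AgreeTo N (K a) (K' a)) :
    AgreeTo N (powSum x K) (∑ a ∈ Finset.range N, letter x ^ a * K' a) := by
  intro w hw
  rw [powSum_agreeTo_of_nil x N K hK w hw]
  exact AgreeTo.sum _ (fun a => (h a).pow_mul x a) w hw

end NCSeries

namespace EllipticCurveAlgebra

open NCSeries Gen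

/-! ### The products are given by the series -/

section Sums

variable {M : Type*} [AddCommMonoid M] (s : Finset ℕ)

theorem sum_rotate_three (f : ℕ → ℕ → ℕ → M) :
    ∑ b ∈ s, ∑ c ∈ s, ∑ a ∈ s, f a b c = ∑ a ∈ s, ∑ b ∈ s, ∑ c ∈ s, f a b c := by
  rw [Finset.sum_comm]
  rw [Finset.sum_congr rfl fun c _ => Finset.sum_comm, Finset.sum_comm]
  exact Finset.sum_congr rfl fun a _ => Finset.sum_comm

theorem sum_rotate_four (f : ℕ → ℕ → ℕ → ℕ → M) :
    ∑ b ∈ s, ∑ c ∈ s, ∑ d ∈ s, ∑ a ∈ s, f a b c d =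
      ∑ a ∈ s, ∑ b ∈ s, ∑ c ∈ s, ∑ d ∈ s, f a b c d := by
  rw [Finset.sum_congr rfl fun b _ => sum_rotate_three s fun a c d => f a b c d]
  exact Finset.sum_comm

end Sums

/-- The finite sums over presentations of a word in `muHigher` are the truncations of the series. -/
theorem muHigher_eq (ε : ℤˣ) (G : ℕ → ℕ → ℂ) (w : List Gen) (z : Gen) :
    muHigher ε G w z = higherSeries (muCoeff ε G) z w := by
  rcases w.length.eq_zero_or_pos with hw | hw
  · obtain rfl := List.length_eq_zero_iff.1 hw
    rw [higherSeries_nil]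
    cases z <;> simp [muHigher]
  obtain ⟨N, hN⟩ : ∃ N, w.length = N + 1 := ⟨w.length - 1, by omega⟩
  have e1 : ∀ (x y : Gen) (k : ℕ → ℂ), AgreeTo (N + 1) (letter x * powSum y fun a => k a • (1 : NCSeries Gen ℂ))
      (letter x * ∑ a ∈ Finset.range (N + 1), letter y ^ a * (k a • (1 : NCSeries Gen ℂ))) :=
    fun x y k => (powSum_agreeTo y N _).letter_mul x
  have e2 : ∀ (x y : Gen) (K K' : ℕ → NCSeries Gen ℂ), (∀ a, K a [] = 0) →
      (∀ a, AgreeTo (N + 1) (K a) (K' a)) → AgreeTo (N + 1) (letter x * powSum y K)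
        (letter x * ∑ a ∈ Finset.range (N + 1), letter y ^ a * K' a) :=
    fun x y K K' h0 h => ((AgreeTo.powSum y h0 h).letter_mul x).mono_le (Nat.le_succ _)
  cases z with
  | xi => simp [muHigher, higherSeries]
  | xiL => simp [muHigher, higherSeries]
  | eta =>
    have key := AgreeTo.powSum (N := N + 1) xiL (K := fun a => letter eta * powSum xi fun b =>
      letter theta * powSum xiL fun c => letter eta * powSum xi fun d => muCoeff ε G a b c d • 1)
      (by simp) (fun a => e2 _ _ _ _ (by simp) fun b => e2 _ _ _ _ (by simp) fun c => e1 _ _ _) w hN.le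
    rw [higherSeries, serEta, key]
    simp only [muHigher, hN, Finset.mul_sum, mul_smul_comm, ← mono_nil, pow_mul_mono, letter_mul_mono,
      NCSeries.sum_apply, NCSeries.smul_apply, mono_apply, mul_ite, mul_one, mul_zero, wordEta, List.append_assoc,
      List.cons_append, List.append_nil, List.nil_append]
  | theta =>
    have key := AgreeTo.powSum (N := N + 1) xi (K := fun b => letter theta * powSum xiL fun c =>
      letter eta * powSum xi fun d => letter theta * powSum xiL fun a => -muCoeff ε G a b c d • 1)
      (by simp) (fun a => e2 _ _ _ _ (by simp) fun b => e2 _ _ _ _ (by simp) fun c => e1 _ _ _) w hN.le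
    rw [higherSeries, serTheta, key]
    simp only [Finset.mul_sum, mul_smul_comm, ← mono_nil, pow_mul_mono, letter_mul_mono,
      NCSeries.sum_apply, NCSeries.smul_apply, mono_apply, mul_ite, mul_one, mul_zero]
    rw [sum_rotate_four]
    simp only [muHigher, hN, wordTheta, List.append_assoc, List.cons_append,
      List.append_nil, List.nil_append]
  | idO =>
    have key := AgreeTo.powSum (N := N + 1) xi (K := fun i => letter theta * powSum xiL fun c =>
      letter eta * powSum xi fun d => letter theta * powSum xiL fun a => letter eta * powSum xi fun j =>
        -muCoeff ε G a (i + j + 1) c d • 1)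
      (by simp) (fun a => e2 _ _ _ _ (by simp) fun b => e2 _ _ _ _ (by simp) fun c =>
        e2 _ _ _ _ (by simp) fun d => e1 _ _ _) w hN.le
    rw [higherSeries, serIdO, key]
    simp only [Finset.mul_sum, mul_smul_comm, ← mono_nil, pow_mul_mono, letter_mul_mono,
      NCSeries.sum_apply, NCSeries.smul_apply, mono_apply, mul_ite, mul_one, mul_zero]
    rw [Finset.sum_congr rfl fun i _ => (sum_rotate_four (Finset.range (N + 1)) _).trans
      (Finset.sum_congr rfl fun j _ => sum_rotate_three (Finset.range (N + 1)) _), sum_rotate_three]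
    simp only [muHigher, hN, wordIdO, List.append_assoc, List.cons_append,
      List.append_nil, List.nil_append]
  | idL =>
    have key := AgreeTo.powSum (N := N + 1) xiL (K := fun i => letter eta * powSum xi fun b =>
      letter theta * powSum xiL fun c => letter eta * powSum xi fun d => letter theta * powSum xiL fun j =>
        -muCoeff ε G (i + j + 1) b c d • 1)
      (by simp) (fun a => e2 _ _ _ _ (by simp) fun b => e2 _ _ _ _ (by simp) fun c =>
        e2 _ _ _ _ (by simp) fun d => e1 _ _ _) w hN.le
    rw [higherSeries, serIdL, key]
    simp only [Finset.mul_sum, mul_smul_comm, ← mono_nil, pow_mul_mono, letter_mul_mono,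
      NCSeries.sum_apply, NCSeries.smul_apply, mono_apply, mul_ite, mul_one, mul_zero]
    rw [Finset.sum_congr rfl fun i _ => (sum_rotate_four (Finset.range (N + 1)) _)]
    simp only [muHigher, hN, wordIdL, List.append_assoc, List.cons_append,
      List.append_nil, List.nil_append]

theorem muHigher_eq_zero (ε : ℤˣ) (G : ℕ → ℕ → ℂ) {w : List Gen} (hw : w.length < 3) (z : Gen) :
    muHigher ε G w z = 0 := by
  have h1 : ∀ a b c d, w ≠ wordEta a b c d := fun a b c d h => by
    have := congrArg List.length h; simp [wordEta] at this; omega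
  have h2 : ∀ a b c d, w ≠ wordTheta a b c d := fun a b c d h => by
    have := congrArg List.length h; simp [wordTheta] at this; omega
  have h3 : ∀ a i j c d, w ≠ wordIdO a i j c d := fun a i j c d h => by
    have := congrArg List.length h; simp [wordIdO] at this; omega
  have h4 : ∀ i j b c d, w ≠ wordIdL i j b c d := fun i j b c d h => by
    have := congrArg List.length h; simp [wordIdL] at this; omega
  cases z <;> simp [muHigher, h1, h2, h3, h4]

theorem twoSeries_pair (x y z : Gen) : twoSeries ℂ z [x, y] = (muTwo x y z : ℂ) := by
  cases z <;> simp only [twoSeries, letter_mul_letter, NCSeries.add_apply, NCSeries.sub_apply, NCSeries.neg_apply, mono_apply, List.cons.injEq,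
    and_true] <;> cases x <;> cases y <;> simp [muTwo]

theorem twoSeries_apply_eq_zero (z : Gen) (w : List Gen) (hw : w.length ≠ 2) : twoSeries ℂ z w = 0 := by
  have hm : ∀ a b : Gen, (letter a * letter b : NCSeries Gen ℂ) w = 0 := fun a b => by
    rw [letter_mul_letter, mono_apply, if_neg]
    rintro rfl; simp at hw
  cases z <;> simp [twoSeries, hm]

theorem column_mu (ε : ℤˣ) (G : ℕ → ℕ → ℂ) (z : Gen) : column (mu ε G) z = muSeries (muCoeff ε G) z := by
  ext w
  rw [column_apply, muSeries, NCSeries.add_apply]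
  by_cases hw : w.length = 2
  · obtain ⟨x, y, rfl⟩ := List.length_eq_two.1 hw
    rw [← muHigher_eq, muHigher_eq_zero ε G (by simp), add_zero, twoSeries_pair]
    rfl
  · rw [twoSeries_apply_eq_zero z w hw, zero_add, ← muHigher_eq]
    match w, hw with
    | [], _ => rfl
    | [x], _ => rfl
    | [x, y], hw => simp at hw
    | x :: y :: t :: w, _ => rfl

/-! ### Degrees and cyclic symmetry of the products -/

section Cyclic

variable {R : Type} [CommRing R]

theorem isHomog_higherSeries (h : ℕ → ℕ → ℕ → ℕ → R) (z : Gen) :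
    IsHomog Gen.sdeg (higherSeries h z) (z.sdeg - 1) := by
  have hs : ∀ (x : Gen) (hx : x = xi ∨ x = xiL) {K : ℕ → NCSeries Gen R} {d : ℤ},
      (∀ a, IsHomog Gen.sdeg (K a) d) → IsHomog Gen.sdeg (powSum x K) d := by
    rintro x (rfl | rfl) K d hK <;> exact IsHomog.powSum (by simp [Gen.sdeg, Gen.deg]) hK
  have hxi := fun {K d} => hs xi (Or.inl rfl) (K := K) (d := d)
  have hxiL := fun {K d} => hs xiL (Or.inr rfl) (K := K) (d := d)
  have heta : ∀ {u : NCSeries Gen R} {d : ℤ}, IsHomog Gen.sdeg u d →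
      IsHomog Gen.sdeg (letter eta * u) d := fun {u d} hu => by
    simpa [Gen.sdeg, Gen.deg] using (isHomog_letter (R := R) (g := Gen.sdeg) eta).mul hu
  have htheta : ∀ {u : NCSeries Gen R} {d : ℤ}, IsHomog Gen.sdeg u d →
      IsHomog Gen.sdeg (letter theta * u) (-1 + d) := fun {u d} hu => by
    simpa [Gen.sdeg, Gen.deg] using (isHomog_letter (R := R) (g := Gen.sdeg) theta).mul hu
  have hone : ∀ r : R, IsHomog Gen.sdeg (r • (1 : NCSeries Gen R)) 0 := fun r => isHomog_one.smul r
  cases z with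
  | xi => exact isHomog_zero
  | xiL => exact isHomog_zero
  | eta =>
    exact hxiL fun a => heta <| hxi fun b => htheta <| hxiL fun c => heta <| hxi fun d => hone _
  | theta =>
    exact hxi fun b => htheta <| hxiL fun c => heta <| hxi fun d => htheta <| hxiL fun a => hone _
  | idO =>
    exact hxi fun i => htheta <| hxiL fun c => heta <| hxi fun d => htheta <| hxiL fun a => heta <|
      hxi fun j => hone _
  | idL =>
    exact hxiL fun i => heta <| hxi fun b => htheta <| hxiL fun c => heta <| hxi fun d => htheta <|
      hxiL fun j => hone _

theorem isHomog_twoSeries (z : Gen) : IsHomog Gen.sdeg (twoSeries R z) (z.sdeg - 1) := by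
  have h : ∀ x y : Gen, x.sdeg + y.sdeg = z.sdeg - 1 →
      IsHomog Gen.sdeg (letter x * letter y : NCSeries Gen R) (z.sdeg - 1) := fun x y hxy => by
    rw [← hxy]; exact (isHomog_letter x).mul (isHomog_letter y)
  cases z
  · exact (h _ _ rfl).neg
  · exact (h _ _ rfl).neg
  · exact (h _ _ rfl).neg.sub (h _ _ rfl)
  · exact (h _ _ rfl).neg.add (h _ _ rfl)
  · exact ((h _ _ rfl).neg.sub (h _ _ rfl)).add (h _ _ rfl)
  · exact ((h _ _ rfl).sub (h _ _ rfl)).add (h _ _ rfl)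

theorem isHomog_muSeries (h : ℕ → ℕ → ℕ → ℕ → R) (z : Gen) :
    IsHomog Gen.sdeg (muSeries h z) (z.sdeg - 1) :=
  (isHomog_twoSeries z).add (isHomog_higherSeries h z)

theorem pairing_basisVec (u : Gen → R) (y : Gen) :
    pairing u (basisVec R y) = ∑ x : Gen, u x * (pairGen x y : R) := by
  simp [pairing, basisVec, Pi.single_apply]

/-- The series of the cyclic tensors of the higher products with last argument `y`. -/
def cyclicSeries (h : ℕ → ℕ → ℕ → ℕ → R) : Gen → NCSeries Gen R
  | theta => serEta fun i j k l => -h i j k l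
  | eta => higherSeries h theta
  | xi => higherSeries h idO
  | xiL => higherSeries h idL
  | idO | idL => 0

theorem sum_higherSeries_pairGen (h : ℕ → ℕ → ℕ → ℕ → R) (w : List Gen) (y : Gen) :
    ∑ x : Gen, higherSeries h x w * (pairGen x y : R) = cyclicSeries h y w := by
  have huniv : (Finset.univ : Finset Gen) = {idO, idL, theta, eta, xi, xiL} := rfl
  have hneg : serEta (fun i j k l => -h i j k l) = -serEta h := by
    have := serEta_smul (-1) h
    simpa using this
  cases y <;> simp [huniv, pairGen, cyclicSeries, higherSeries, hneg]

theorem rtail_zero {α : Type*} (y : α) : rtail y (0 : NCSeries α R) = 0 := rfl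

/-- Cyclic rotation of the tensors moves the last argument `y` to the front, at the cost of a sign for
`x = θ`. -/
theorem tail_cyclicSeries (h : ℕ → ℕ → ℕ → ℕ → R) (hrot : ∀ i j k l, h k l i j = -h i j k l)
    (x y : Gen) : tail x (cyclicSeries h y) =
      (if x = theta then -1 else 1 : R) • rtail y (cyclicSeries h x) := by
  have h0 : ∀ i j k, h k 0 i j = -h i j k 0 := fun i j k => hrot i j k 0
  have h1 : ∀ i j k l, h k (l + 1) i j = -h i j k (l + 1) := fun i j k l => hrot i j k (l + 1)
  have h2 : ∀ a j : ℕ, a + 1 + j + 1 = a + (j + 1) + 1 := fun a j => by omega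
  cases x <;> cases y <;> simp [-neg_smul, cyclicSeries, higherSeries, serEta, serTheta, serIdO,
    serIdL, tail_powSum, tail_letter_mul, rtail_powSum, rtail_letter_mul, rtail_powSum_smul_one,
    rtail_zero]
  case xi.xi | xiL.xiL => simp only [h2]
  all_goals
    simp only [← powSum_smul, ← mul_smul_comm, smul_smul, h0, h1, neg_mul_neg, one_mul, neg_neg]

theorem koszul_of_even {n : ℤ} (hn : Even n) : koszul R n = 1 := by
  simp [koszul, Int.negOnePow_even n hn]

theorem koszul_of_odd {n : ℤ} (hn : Odd n) : koszul R n = -1 := by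
  simp [koszul, Int.negOnePow_odd n hn]

theorem koszul_eq_ite (n : ℤ) : koszul R n = ((if n % 2 = 0 then 1 else -1 : ℤ) : R) := by
  split_ifs with h
  · simp [koszul_of_even (R := R) (Int.even_iff.2 h)]
  · simp [koszul_of_odd (R := R) (Int.odd_iff.2 (Int.emod_two_ne_zero.1 h))]

/-- Cyclic symmetry of `μ₂`. -/
theorem pairing_twoSeries (x t y : Gen) :
    pairing (fun z => (muTwo x t z : R)) (basisVec R y) =
      koszul R (x.sdeg * (t.sdeg + y.sdeg)) * pairing (fun z => (muTwo t y z : R)) (basisVec R x) := by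
  have key : ∀ x t y : Gen, ∑ z : Gen, muTwo x t z * pairGen z y =
      (if x.sdeg * (t.sdeg + y.sdeg) % 2 = 0 then 1 else -1) * ∑ z : Gen, muTwo t y z * pairGen z x := by
    decide
  rw [koszul_eq_ite, pairing_basisVec, pairing_basisVec]
  exact_mod_cast congrArg (Int.cast : ℤ → R) (key x t y)

end Cyclic

/-- The structure constants change sign under the rotation of the cyclic word by half a turn: the
total exponent is odd, so the signs of the two presentations differ. -/
theorem muCoeff_rotate (ε : ℤˣ) (G : ℕ → ℕ → ℂ) (a b c d : ℕ) :
    muCoeff ε G c d a b = -muCoeff ε G a b c d := by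
  have e : c + d + a + b = a + b + c + d := by ring
  unfold muCoeff
  rw [e, add_comm c a, add_comm d b]
  split_ifs with h
  · have : (-1 : ℂ) ^ (c + d) = -(-1) ^ (a + b) := by
      rcases Nat.even_or_odd (a + b) with h' | h'
      · have h2 : Odd (c + d) := by
          rw [Nat.odd_iff] at h ⊢; rw [Nat.even_iff] at h'; omega
        rw [h2.neg_one_pow, h'.neg_one_pow]
      · have h2 : Even (c + d) := by
          rw [Nat.odd_iff] at h h'; rw [Nat.even_iff]; omega
        rw [h2.neg_one_pow, h'.neg_one_pow, neg_neg]
    rw [this]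
    ring
  · simp

theorem isCyclicOps_mu (ε : ℤˣ) (G : ℕ → ℕ → ℂ) : IsCyclicOps (mu ε G) := by
  intro x w y
  by_cases hw : w.length = 1
  · obtain ⟨t, rfl⟩ := List.length_eq_one_iff.1 hw
    have ht : wordDeg [t] = t.sdeg := by simp [wordDeg]
    rw [ht]
    exact pairing_twoSeries x t y
  have hhigh : ∀ v : List Gen, v.length ≠ 2 → ∀ y, pairing (mu ε G v) (basisVec ℂ y) =
      cyclicSeries (muCoeff ε G) y v := by
    intro v hv y
    rw [← sum_higherSeries_pairGen, pairing_basisVec]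
    refine Finset.sum_congr rfl fun z _ => ?_
    rw [← muHigher_eq]
    match v, hv with
    | [], _ => rfl
    | [x], _ => rfl
    | [x, y], hv => simp at hv
    | x :: y :: t :: v, _ => rfl
  rw [hhigh _ (by simpa using hw), hhigh _ (by simpa using hw)]
  have key := congrArg (fun u : NCSeries Gen ℂ => u w) (tail_cyclicSeries _ (muCoeff_rotate ε G) x y)
  simp only [tail_apply, rtail_apply, NCSeries.smul_apply] at key
  rw [key]
  cases x with
  | theta =>
    by_cases h0 : cyclicSeries (muCoeff ε G) theta (w ++ [y]) = 0
    · rw [h0]; simp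
    -- a non-zero value forces the remaining arguments to have total degree `-1`
    · have hdeg := isHomog_higherSeries (fun i j k l => -muCoeff ε G i j k l) eta (w ++ [y]) h0
      have hdeg' : wordDeg w + y.sdeg = -1 := by
        simpa [wordDeg, Gen.sdeg, Gen.deg] using hdeg
      rw [hdeg', koszul_of_odd (by decide)]
      simp
  | eta => simp [Gen.sdeg, Gen.deg]
  | xi => simp [Gen.sdeg, Gen.deg]
  | xiL => simp [Gen.sdeg, Gen.deg]
  | idO => simp [cyclicSeries]
  | idL => simp [cyclicSeries]

open Polynomial in
theorem isCyclicOps_psiThree (ε : ℤˣ) : IsCyclicOps (psiThree ε) := by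
  have key : ∀ x t u y : Gen,
      ∑ z : Gen, (if [x, t, u] = [(psiLetters z).1, (psiLetters z).2.1, (psiLetters z).2.2] then
        psiSign z else 0) * pairGen z y =
      (if x.sdeg * (t.sdeg + u.sdeg + y.sdeg) % 2 = 0 then 1 else -1) *
        ∑ z : Gen, (if [t, u, y] = [(psiLetters z).1, (psiLetters z).2.1, (psiLetters z).2.2] then
          psiSign z else 0) * pairGen z x := by
    decide +kernel
  have hval : ∀ (v : List Gen) (y : Gen), pairing (psiThree ε v) (basisVec ℂ[X] y) =
      C (psiConst ε) * X ^ 2 *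
        ((∑ z : Gen, (if v = [(psiLetters z).1, (psiLetters z).2.1, (psiLetters z).2.2] then
          psiSign z else 0) * pairGen z y : ℤ) : ℂ[X]) := by
    intro v y
    rw [pairing_basisVec]
    push_cast
    rw [Finset.mul_sum]
    refine Finset.sum_congr rfl fun z _ => ?_
    rw [psiThree_eq]
    split_ifs
    · simp; ring
    · simp
  have hzero : ∀ (v : List Gen) (y : Gen), v.length ≠ 3 →
      pairing (psiThree ε v) (basisVec ℂ[X] y) = 0 := by
    intro v y hv
    rw [hval, Finset.sum_eq_zero, Int.cast_zero, mul_zero]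
    intro z _
    rw [if_neg, zero_mul]
    rintro rfl
    exact hv rfl
  intro x w y
  by_cases hw : w.length = 2
  · obtain ⟨t, u, rfl⟩ := List.length_eq_two.1 hw
    have hdeg : wordDeg [t, u] = t.sdeg + u.sdeg := by simp [wordDeg]
    rw [hval, List.cons_append, List.cons_append, List.nil_append, hval, key, hdeg,
      koszul_eq_ite]
    push_cast
    ring
  · rw [hzero _ _ (by simpa using hw), hzero _ _ (by simpa using hw), mul_zero]

end EllipticCurveAlgebra

namespace EllipticCurveAlgebra

open Complex

/-! ### Holomorphy of the Eisenstein series -/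

theorem isOpen_im_pos : IsOpen {τ : ℂ | 0 < τ.im} := isOpen_lt continuous_const continuous_im

/-- The series `∑ n^k q^n`, `q = exp (2πiz)`, which the Lipschitz formula attaches to
`∑ (z + n)^{-k-1}`. -/
noncomputable def fourierSum (k : ℕ) (z : ℂ) : ℂ :=
  ∑' n : ℕ, (n : ℂ) ^ k * cexp (2 * Real.pi * I * z) ^ n

theorem norm_cexp_two_pi_I_mul (z : ℂ) :
    ‖cexp (2 * Real.pi * I * z)‖ = Real.exp (-(2 * Real.pi * z.im)) := by
  rw [norm_exp]; simp

theorem exp_neg_two_pi_mul_lt_one {δ : ℝ} (hδ : 0 < δ) : Real.exp (-(2 * Real.pi * δ)) < 1 := by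
  rw [Real.exp_lt_one_iff]; have := Real.pi_pos; nlinarith [mul_pos this hδ]

theorem summable_pow_mul_exp (k : ℕ) {δ : ℝ} (hδ : 0 < δ) :
    Summable fun n : ℕ => (n : ℝ) ^ k * Real.exp (-(2 * Real.pi * δ)) ^ n :=
  summable_pow_mul_geometric_of_norm_lt_one k <| by
    rw [Real.norm_of_nonneg (Real.exp_pos _).le]; exact exp_neg_two_pi_mul_lt_one hδ

theorem differentiableOn_fourierSum (k : ℕ) : DifferentiableOn ℂ (fourierSum k) {z | 0 < z.im} := by
  intro z hz
  have hδ : 0 < z.im / 2 := half_pos hz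
  have hopen : IsOpen {w : ℂ | z.im / 2 < w.im} := isOpen_lt continuous_const continuous_im
  refine DifferentiableAt.differentiableWithinAt ?_
  refine DifferentiableOn.differentiableAt (s := {w : ℂ | z.im / 2 < w.im}) ?_
    (hopen.mem_nhds (show z.im / 2 < z.im from half_lt_self hz))
  refine differentiableOn_tsum_of_summable_norm (summable_pow_mul_exp k hδ) (fun n => by fun_prop)
    hopen fun n w hw => ?_
  rw [norm_mul, norm_pow, norm_pow, norm_cexp_two_pi_I_mul, norm_natCast]
  have hw' : z.im / 2 ≤ w.im := le_of_lt hw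
  have := Real.pi_pos
  gcongr

/-- The sum starts at `n = 1`, so it decays like `q`; this makes the outer sum of `eis` absolutely
convergent even for `e_2`. -/
theorem norm_fourierSum_le {k : ℕ} (hk : 1 ≤ k) {δ : ℝ} (hδ : 0 < δ) :
    ∃ K, 0 ≤ K ∧ ∀ z : ℂ, δ ≤ z.im → ‖fourierSum k z‖ ≤ K * Real.exp (-(2 * Real.pi * z.im)) := by
  set r := Real.exp (-(2 * Real.pi * δ)) with hr
  have hr0 : 0 < r := Real.exp_pos _
  refine ⟨(∑' n : ℕ, (n : ℝ) ^ k * r ^ n) / r,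
    div_nonneg (tsum_nonneg fun n => by positivity) hr0.le, fun z hz => ?_⟩
  set q := Real.exp (-(2 * Real.pi * z.im)) with hq
  have hqr : q ≤ r := by have := Real.pi_pos; rw [hq, hr]; gcongr
  have hq0 : 0 < q := Real.exp_pos _
  have hs := ((summable_pow_mul_exp k hδ).hasSum.mul_left (q / r))
  rw [← hr] at hs
  refine (tsum_of_norm_bounded hs fun n => ?_).trans_eq (by ring)
  rw [norm_mul, norm_pow, norm_pow, norm_cexp_two_pi_I_mul, norm_natCast, ← hq]
  cases n with
  | zero => simp [show k ≠ 0 by omega]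
  | succ n =>
    have : q / r * (((n + 1 : ℕ) : ℝ) ^ k * r ^ (n + 1)) = ((n + 1 : ℕ) : ℝ) ^ k * (r ^ n * q) := by
      field_simp
      ring
    rw [this, pow_succ]
    gcongr

/-- The Lipschitz formula for the inner sums of `eis`; the sums for `m` and `-m` agree as the exponent is
even. -/
theorem tsum_one_div_linear_pow {k : ℕ} (hk : Odd k) {m : ℤ} (hm : m ≠ 0) {τ : ℂ} (hτ : 0 < τ.im) :
    ∑' n : ℤ, 1 / ((m : ℂ) * τ + n) ^ (k + 1) =
      (-2 * Real.pi * I) ^ (k + 1) / (k.factorial : ℂ) * fourierSum k (m.natAbs * τ) := by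
  have him : 0 < ((m.natAbs : ℂ) * τ).im := by
    have : 0 < m.natAbs := Int.natAbs_pos.2 hm
    simp; positivity
  have key := EisensteinSeries.qExpansion_identity hk.pos ⟨_, him⟩
  rw [fourierSum]
  refine Eq.trans ?_ key
  rcases Int.natAbs_eq m with h | h
  · conv_lhs => rw [h]
    simp
  · conv_lhs => rw [h]
    rw [← (Equiv.neg ℤ).tsum_eq]
    refine tsum_congr fun n => ?_
    have hev : Even (k + 1) := hk.add_one
    rw [← hev.neg_pow]
    simp only [Equiv.neg_apply, Int.cast_neg, Int.cast_natCast]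
    congr 2
    ring

theorem differentiableOn_eis {k : ℕ} (hk : Odd k) :
    DifferentiableOn ℂ (eis (k + 1)) {τ | 0 < τ.im} := by
  intro τ₀ hτ₀
  have hδ : 0 < τ₀.im / 2 := half_pos hτ₀
  have hopen : IsOpen {w : ℂ | τ₀.im / 2 < w.im} := isOpen_lt continuous_const continuous_im
  refine DifferentiableAt.differentiableWithinAt ?_
  refine DifferentiableOn.differentiableAt (s := {w : ℂ | τ₀.im / 2 < w.im}) ?_
    (hopen.mem_nhds (show τ₀.im / 2 < τ₀.im from half_lt_self hτ₀))
  obtain ⟨K, hK, hbound⟩ := norm_fourierSum_le hk.pos hδ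
  set c : ℂ := ∑' n : ℤ, 1 / (n : ℂ) ^ (k + 1)
  set A : ℂ := (-2 * Real.pi * I) ^ (k + 1) / (k.factorial : ℂ)
  set r := Real.exp (-(2 * Real.pi * (τ₀.im / 2))) with hr
  have hr0 : 0 < r := Real.exp_pos _
  have hsum : Summable fun m : ℤ => (‖c‖ + ‖A‖ * K) * r ^ m.natAbs := by
    refine Summable.mul_left _ (Summable.of_nat_of_neg ?_ ?_) <;>
      simpa using summable_geometric_of_lt_one hr0.le (exp_neg_two_pi_mul_lt_one hδ)
  have heq : Set.EqOn (eis (k + 1))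
      (fun τ => ∑' m : ℤ, if m = 0 then c else A * fourierSum k (m.natAbs * τ))
      {w : ℂ | τ₀.im / 2 < w.im} := by
    intro τ hτ
    refine tsum_congr fun m => ?_
    split_ifs with hm
    · simp [hm, c]
    · exact tsum_one_div_linear_pow hk hm (hδ.trans hτ)
  refine DifferentiableOn.congr ?_ heq
  refine differentiableOn_tsum_of_summable_norm hsum (fun m => ?_) hopen fun m τ hτ => ?_
  · split_ifs with hm
    · exact differentiableOn_const _
    · refine DifferentiableOn.const_mul ?_ _
      refine (differentiableOn_fourierSum k).comp (by fun_prop) fun τ hτ => ?_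
      have : 0 < m.natAbs := Int.natAbs_pos.2 hm
      have hτ' : 0 < τ.im := hδ.trans hτ
      simp; positivity
  · split_ifs with hm
    · simp only [hm, Int.natAbs_zero, pow_zero, mul_one]
      have : 0 ≤ ‖A‖ * K := by positivity
      linarith
    · have hm1 : 1 ≤ m.natAbs := Int.natAbs_pos.2 hm
      have hτ' : τ₀.im / 2 ≤ τ.im := le_of_lt hτ
      have him : ((m.natAbs : ℂ) * τ).im = m.natAbs * τ.im := by simp
      have h1 : τ₀.im / 2 ≤ ((m.natAbs : ℂ) * τ).im := by
        rw [him]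
        have : (1 : ℝ) ≤ m.natAbs := by exact_mod_cast hm1
        nlinarith
      have h2 : Real.exp (-(2 * Real.pi * ((m.natAbs : ℂ) * τ).im)) ≤ r ^ m.natAbs := by
        rw [hr, ← Real.exp_nat_mul, him]
        refine Real.exp_le_exp.2 ?_
        have := Real.pi_pos
        have h3 : (m.natAbs : ℝ) * (τ₀.im / 2) ≤ m.natAbs * τ.im := by gcongr
        nlinarith
      rw [norm_mul]
      calc ‖A‖ * ‖fourierSum k (m.natAbs * τ)‖ ≤ ‖A‖ * (K * r ^ m.natAbs) := by
            gcongr; exact (hbound _ h1).trans (by gcongr)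
        _ ≤ (‖c‖ + ‖A‖ * K) * r ^ m.natAbs := by
            have : 0 ≤ ‖c‖ * r ^ m.natAbs := by positivity
            linarith

end EllipticCurveAlgebra

namespace EllipticCurveAlgebra

open Complex Finset

/-! ### Wirtinger derivatives -/

/-- `F` is real differentiable at `τ`, with `∂_τ F = p` and `∂_τ̄ F = q`. -/
def HasWirtinger (F : ℂ → ℂ) (p q τ : ℂ) : Prop :=
  HasFDerivAt F (p • ContinuousLinearMap.id ℝ ℂ + q • (conjCLE : ℂ →L[ℝ] ℂ)) τ

section Wirtinger

variable {F G : ℂ → ℂ} {p q p' q' τ : ℂ}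

theorem HasWirtinger.dTau_eq (h : HasWirtinger F p q τ) : dTau F τ = p := by
  rw [dTau, HasFDerivAt.fderiv h]
  simp
  linear_combination (p / 2 - q / 2) * (-I_mul_I)

theorem HasWirtinger.unique (h : HasWirtinger F p q τ) (h' : HasWirtinger F p' q' τ) : q = q' := by
  have e := HasFDerivAt.unique h h'
  have e1 := congrArg (fun L : ℂ →L[ℝ] ℂ => L 1) e
  have e2 := congrArg (fun L : ℂ →L[ℝ] ℂ => L I) e
  simp at e1 e2
  linear_combination e1 / 2 + I / 2 * e2 - (p - q - p' + q') / 2 * I_mul_I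

theorem HasWirtinger.congr (h : HasWirtinger F p q τ) (e : G =ᶠ[nhds τ] F) : HasWirtinger G p q τ :=
  HasFDerivAt.congr_of_eventuallyEq h e

theorem hasWirtinger_of_hasDerivAt (h : HasDerivAt F p τ) : HasWirtinger F p 0 τ := by
  refine (h.hasFDerivAt.restrictScalars ℝ).congr_fderiv ?_
  ext; simp [mul_comm]

theorem HasWirtinger.mul (h : HasWirtinger F p q τ) (h' : HasWirtinger G p' q' τ) :
    HasWirtinger (fun z => F z * G z) (p * G τ + F τ * p') (q * G τ + F τ * q') τ := by
  refine (HasFDerivAt.mul h h').congr_fderiv ?_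
  ext; simp; ring

theorem HasWirtinger.comp (h : HasWirtinger F p q τ) (hG : HasDerivAt G p' (F τ)) :
    HasWirtinger (fun z => G (F z)) (p' * p) (p' * q) τ := by
  refine (hG.comp_hasFDerivAt τ h).congr_fderiv ?_
  ext; simp; ring

theorem HasWirtinger.sum {ι : Type*} {s : Finset ι} {F : ι → ℂ → ℂ} {p q : ι → ℂ}
    (h : ∀ i ∈ s, HasWirtinger (F i) (p i) (q i) τ) :
    HasWirtinger (fun z => ∑ i ∈ s, F i z) (∑ i ∈ s, p i) (∑ i ∈ s, q i) τ := by
  refine (HasFDerivAt.fun_sum h).congr_fderiv ?_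
  ext; simp [Finset.sum_add_distrib, Finset.sum_mul]

theorem hasWirtinger_tauDiff : HasWirtinger tauDiff 1 (-1) τ := by
  refine (((hasFDerivAt_id τ).sub (conjCLE : ℂ →L[ℝ] ℂ).hasFDerivAt).congr_fderiv ?_ :)
  ext; simp [sub_eq_add_neg]

end Wirtinger

theorem tauDiff_ne_zero {τ : ℂ} (hτ : 0 < τ.im) : tauDiff τ ≠ 0 := by
  rw [tauDiff, sub_conj]
  simp [hτ.ne']

theorem hasWirtinger_div_tauDiff_pow {c : ℂ → ℂ} {c' τ : ℂ} (hτ : 0 < τ.im) (hc : HasDerivAt c c' τ)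
    (m : ℕ) : HasWirtinger (fun z => c z / tauDiff z ^ m)
      (c' / tauDiff τ ^ m - m * c τ / tauDiff τ ^ (m + 1)) (m * c τ / tauDiff τ ^ (m + 1)) τ := by
  have h0 := tauDiff_ne_zero hτ
  have hp := (hasDerivAt_pow m (tauDiff τ)).inv (pow_ne_zero m h0)
  have h := (hasWirtinger_of_hasDerivAt hc).mul (hasWirtinger_tauDiff.comp hp)
  have e : (m : ℂ) * tauDiff τ ^ (m - 1) / (tauDiff τ ^ m) ^ 2 = m / tauDiff τ ^ (m + 1) := by
    cases m with
    | zero => simp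
    | succ m => field_simp; simp; ring
  simp only [neg_div, e] at h
  refine (h.congr (Filter.Eventually.of_forall fun z => div_eq_mul_inv _ _) :) |> fun h => ?_
  unfold HasWirtinger at h ⊢
  convert h using 3 <;> simp <;> ring

/-! ### Uniqueness of the expansion in powers of `1 / (τ - τ̄)` -/

/-- Applying `∂_τ̄` multiplies the `m`-th term by `m / (τ - τ̄)`; this allows to eliminate the highest term
of a relation. -/
theorem eq_zero_of_sum_div_tauDiff_pow (N : ℕ) (c : ℕ → ℂ → ℂ)
    (hc : ∀ m, DifferentiableOn ℂ (c m) {τ | 0 < τ.im})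
    (h : ∀ τ : ℂ, 0 < τ.im → ∑ m ∈ range N, c m τ / tauDiff τ ^ m = 0) :
    ∀ m < N, ∀ τ : ℂ, 0 < τ.im → c m τ = 0 := by
  induction N generalizing c with
  | zero => intro m hm; omega
  | succ N ih =>
    have hd : ∀ τ : ℂ, 0 < τ.im → ∑ m ∈ range (N + 1), (m : ℂ) * c m τ / tauDiff τ ^ m = 0 := by
      intro τ hτ
      have h0 := tauDiff_ne_zero hτ
      have h1 := HasWirtinger.sum (s := range (N + 1)) fun m _ => hasWirtinger_div_tauDiff_pow hτ
        ((hc m).differentiableAt (isOpen_im_pos.mem_nhds hτ)).hasDerivAt m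
      have h2 : HasWirtinger (fun z => ∑ m ∈ range (N + 1), c m z / tauDiff z ^ m) 0 0 τ :=
        (hasWirtinger_of_hasDerivAt (hasDerivAt_const τ (0 : ℂ))).congr
          (Filter.eventually_of_mem (isOpen_im_pos.mem_nhds hτ) fun z hz => h z hz)
      have h3 := h1.unique h2
      calc ∑ m ∈ range (N + 1), (m : ℂ) * c m τ / tauDiff τ ^ m
          = tauDiff τ * ∑ m ∈ range (N + 1), (m : ℂ) * c m τ / tauDiff τ ^ (m + 1) := by
            rw [mul_sum]; refine sum_congr rfl fun m _ => ?_; field_simp; ring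
        _ = 0 := by rw [h3, mul_zero]
    have hlow := ih (fun m τ => ((N : ℂ) - m) * c m τ) (fun m => (hc m).const_mul _) fun τ hτ => by
      have e := congrArg₂ (fun x y => (N : ℂ) * x - y) (h τ hτ) (hd τ hτ)
      simp only [mul_sum, ← sum_sub_distrib, mul_zero, sub_zero] at e
      rw [sum_range_succ] at e
      rw [← e]
      simp only [mul_div_assoc, sub_self, add_zero]
      exact sum_congr rfl fun m _ => by ring
    have hlow' : ∀ m < N, ∀ τ : ℂ, 0 < τ.im → c m τ = 0 := fun m hm τ hτ =>
      (mul_eq_zero.1 (hlow m hm τ hτ)).resolve_left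
        (sub_ne_zero.2 (Nat.cast_injective.ne (by omega)))
    intro m hm τ hτ
    rcases Nat.lt_succ_iff_lt_or_eq.1 hm with hm | rfl
    · exact hlow' m hm τ hτ
    · have := h τ hτ
      rw [sum_range_succ, sum_eq_zero fun k hk => by rw [hlow' k (mem_range.1 hk) τ hτ, zero_div],
        zero_add, div_eq_zero_iff] at this
      exact this.resolve_right (pow_ne_zero _ (tauDiff_ne_zero hτ))

/-- The constant term does not depend on the chosen expansion. -/
theorem IsExpansion.constTerm_eq {F : ℂ → ℂ} {N : ℕ} {c : ℕ → ℂ → ℂ} (h : IsExpansion F N c) {τ : ℂ}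
    (hτ : 0 < τ.im) : constTerm F τ = c 0 τ := by
  have hF : IsAlmostHolomorphic F := ⟨(N, c), h⟩
  rw [constTerm, dif_pos hF]
  have h' := hF.choose_spec
  set N' := hF.choose.1
  set c' := hF.choose.2
  -- the difference of the two expansions, both continued by zero
  let d : ℕ → ℂ → ℂ := fun m τ => (if m ≤ N' then c' m τ else 0) - if m ≤ N then c m τ else 0
  have hd : ∀ m, DifferentiableOn ℂ (d m) {τ | 0 < τ.im} := fun m => by
    have h1 := h.1 m
    have h2 := h'.1 m
    by_cases m ≤ N' <;> by_cases m ≤ N <;> simp only [d, *, if_true, if_false] <;> fun_prop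
  have hpad : ∀ (M : ℕ) (e : ℕ → ℂ) (x : ℂ), M ≤ N + N' →
      ∑ m ∈ range (N + N' + 1), (if m ≤ M then e m else 0) / x ^ m =
        ∑ m ∈ range (M + 1), e m / x ^ m := by
    intro M e x hM
    rw [← sum_subset (range_subset_range.2 (by omega : M + 1 ≤ N + N' + 1))]
    · exact sum_congr rfl fun m hm => by rw [if_pos (by simpa [Nat.lt_succ_iff] using hm)]
    · intro m _ hm
      rw [if_neg (by simpa [Nat.lt_succ_iff] using hm), zero_div]
  have key := eq_zero_of_sum_div_tauDiff_pow (N + N' + 1) d hd (fun σ hσ => by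
    simp only [d, sub_div, sum_sub_distrib]
    rw [hpad N' (fun m => c' m σ) _ (by omega), hpad N (fun m => c m σ) _ (by omega), ← h.2 σ hσ,
      ← h'.2 σ hσ, sub_self]) 0 (by omega) τ hτ
  simpa [d, sub_eq_zero] using key

end EllipticCurveAlgebra

namespace EllipticCurveAlgebra

open Finset

/-! ### Expansion of the forms `g_{a,b}` -/

/-- The coefficient of `(τ - τ̄)^{-m}` in `g_{a,0}`. -/
noncomputable def eisCoeff (a m : ℕ) (τ : ℂ) : ℂ :=
  if Odd a then
    if m = 0 then (a.factorial : ℂ) * eis (a + 1) τ else if m = 1 ∧ a = 1 then -twoPiI else 0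
  else 0

/-- The coefficient of `(τ - τ̄)^{-m}` in `g_{a,b}`. -/
noncomputable def formCoeff : ℕ → ℕ → ℕ → ℂ → ℂ
  | a, 0, m => eisCoeff a m
  | 0, b + 1, m => eisCoeff (b + 1) m
  | a + 1, b + 1, 0 => fun τ => twoPiI * deriv (formCoeff a b 0) τ
  | a + 1, b + 1, m + 1 => fun τ =>
      twoPiI * (deriv (formCoeff a b (m + 1)) τ + ((a : ℂ) + b + 1 - m) * formCoeff a b m τ)

theorem twoPiI_ne_zero : twoPiI ≠ 0 := by
  unfold twoPiI; exact Complex.two_pi_I_ne_zero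

theorem formCoeff_zero_left (b m : ℕ) : formCoeff 0 b m = eisCoeff b m := by
  cases b <;> rw [formCoeff]

theorem formCoeff_zero_right (a m : ℕ) : formCoeff a 0 m = eisCoeff a m := by
  cases a <;> rw [formCoeff]

theorem formCoeff_succ_zero (a b : ℕ) (τ : ℂ) :
    formCoeff (a + 1) (b + 1) 0 τ = twoPiI * deriv (formCoeff a b 0) τ := by rw [formCoeff]

theorem formCoeff_succ_succ (a b m : ℕ) (τ : ℂ) : formCoeff (a + 1) (b + 1) (m + 1) τ =
    twoPiI * (deriv (formCoeff a b (m + 1)) τ + ((a : ℂ) + b + 1 - m) * formCoeff a b m τ) := by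
  rw [formCoeff]

/-- Induction along the recursion that defines the forms. -/
theorem diagonal_induction {P : ℕ → ℕ → Prop} (h0 : ∀ a, P a 0) (h0' : ∀ b, P 0 b)
    (h : ∀ a b, P a b → P (a + 1) (b + 1)) (a b : ℕ) : P a b := by
  induction a generalizing b with
  | zero => exact h0' b
  | succ a ih => cases b with
    | zero => exact h0 _
    | succ b => exact h a b (ih b)

theorem differentiableOn_eisCoeff (a m : ℕ) : DifferentiableOn ℂ (eisCoeff a m) {τ | 0 < τ.im} := by
  unfold eisCoeff
  by_cases ha : Odd a
  · simp only [ha, if_true]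
    split_ifs
    · exact (differentiableOn_eis ha).const_mul _
    · exact differentiableOn_const _
    · exact differentiableOn_const _
  · simp only [ha, if_false]
    exact differentiableOn_const _

theorem differentiableOn_formCoeff (a b m : ℕ) :
    DifferentiableOn ℂ (formCoeff a b m) {τ | 0 < τ.im} := by
  induction a, b using diagonal_induction generalizing m with
  | h0 a => rw [formCoeff_zero_right]; exact differentiableOn_eisCoeff a m
  | h0' b => rw [formCoeff_zero_left]; exact differentiableOn_eisCoeff b m
  | h a b ih =>
    cases m with
    | zero =>
      rw [funext (formCoeff_succ_zero a b)]
      exact ((ih 0).deriv isOpen_im_pos).const_mul _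
    | succ m =>
      rw [funext (formCoeff_succ_succ a b m)]
      exact (((ih (m + 1)).deriv isOpen_im_pos).add ((ih m).const_mul _)).const_mul _

theorem hasDerivAt_formCoeff (a b m : ℕ) {τ : ℂ} (hτ : 0 < τ.im) :
    HasDerivAt (formCoeff a b m) (deriv (formCoeff a b m) τ) τ :=
  ((differentiableOn_formCoeff a b m).differentiableAt (isOpen_im_pos.mem_nhds hτ)).hasDerivAt

theorem eisCoeff_eq_zero {a m : ℕ} (h : 1 < m) : eisCoeff a m = 0 := by
  funext τ
  simp [eisCoeff, show m ≠ 0 by omega, show m ≠ 1 by omega]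

/-- `g_{a,b}` has degree at most `a + b + 1` in `1 / (τ - τ̄)`. -/
theorem formCoeff_eq_zero {a b m : ℕ} (h : a + b + 1 < m) : formCoeff a b m = 0 := by
  induction a, b using diagonal_induction generalizing m with
  | h0 a => rw [formCoeff_zero_right]; exact eisCoeff_eq_zero (by omega)
  | h0' b => rw [formCoeff_zero_left]; exact eisCoeff_eq_zero (by omega)
  | h a b ih =>
    obtain ⟨m, rfl⟩ : ∃ k, m = k + 1 := ⟨m - 1, by omega⟩
    funext τ
    rw [formCoeff_succ_succ, ih (m := m) (by omega), ih (m := m + 1) (by omega)]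
    simp

theorem sum_eisCoeff {a N : ℕ} (hN : 2 ≤ N) {τ : ℂ} :
    (if Odd a then (a.factorial : ℂ) * eisStar (a + 1) τ else 0) =
      ∑ m ∈ range N, eisCoeff a m τ / tauDiff τ ^ m := by
  rw [← sum_subset (range_subset_range.2 hN) fun m _ hm => by
    rw [eisCoeff_eq_zero (by simpa using hm)]; simp]
  rw [sum_range_succ, sum_range_one]
  unfold eisCoeff eisStar
  split_ifs <;> simp_all; ring

theorem isExpansion_gForm (a b : ℕ) : IsExpansion (gForm a b) (a + b + 1) (formCoeff a b) := by
  refine ⟨differentiableOn_formCoeff a b, ?_⟩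
  induction a, b using diagonal_induction with
  | h0 a =>
    intro τ _
    simp only [formCoeff_zero_right]
    rw [← sum_eisCoeff (by omega)]
    cases a <;> rw [gForm]
  | h0' b =>
    intro τ _
    simp only [formCoeff_zero_left]
    rw [← sum_eisCoeff (by omega)]
    cases b <;> rw [gForm]
  | h a b ih =>
    intro τ hτ
    have h0 := tauDiff_ne_zero hτ
    have hW := (HasWirtinger.sum (s := range (a + b + 1 + 1)) fun m _ =>
      hasWirtinger_div_tauDiff_pow hτ (hasDerivAt_formCoeff a b m hτ) m).congr
        (Filter.eventually_of_mem (isOpen_im_pos.mem_nhds hτ) fun z hz => ih z hz)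
    have e : gForm (a + 1) (b + 1) τ = twoPiI * hatD (a + b + 1) (gForm a b) τ := by rw [gForm]
    set M := a + b + 1 + 1 with hM
    have hvanish : ∀ m, M ≤ m → formCoeff a b m = 0 := fun m hm => formCoeff_eq_zero (by omega)
    -- raising multiplies the term with `(τ - τ̄)^{-m}` by `(a + b + 1 - m) / (τ - τ̄)` and differentiates
    -- its coefficient
    have hlhs : ∑ m ∈ range M, (deriv (formCoeff a b m) τ / tauDiff τ ^ m -
          m * formCoeff a b m τ / tauDiff τ ^ (m + 1)) +
        ((a + b + 1 : ℕ) : ℂ) / tauDiff τ * ∑ m ∈ range M, formCoeff a b m τ / tauDiff τ ^ m =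
        ∑ m ∈ range M, deriv (formCoeff a b m) τ / tauDiff τ ^ m +
          ∑ m ∈ range M, ((a : ℂ) + b + 1 - m) * formCoeff a b m τ / tauDiff τ ^ (m + 1) := by
      rw [mul_sum, ← sum_add_distrib, ← sum_add_distrib]
      refine sum_congr rfl fun m _ => ?_
      push_cast
      field_simp
      ring
    have hshift : ∑ m ∈ range M, deriv (formCoeff a b m) τ / tauDiff τ ^ m =
        ∑ m ∈ range M, deriv (formCoeff a b (m + 1)) τ / tauDiff τ ^ (m + 1) +
          deriv (formCoeff a b 0) τ := by
      have := sum_range_succ' (fun m => deriv (formCoeff a b m) τ / tauDiff τ ^ m) M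
      rw [sum_range_succ, hvanish M le_rfl] at this
      simpa using this
    have hrhs : ∑ m ∈ range (M + 1 + 1), formCoeff (a + 1) (b + 1) m τ / tauDiff τ ^ m =
        ∑ m ∈ range M, formCoeff (a + 1) (b + 1) (m + 1) τ / tauDiff τ ^ (m + 1) +
          formCoeff (a + 1) (b + 1) 0 τ := by
      rw [sum_range_succ', sum_range_succ, formCoeff_succ_succ _ _ M, hvanish M le_rfl,
        hvanish (M + 1) (by omega)]
      simp
    rw [e, hatD, hW.dTau_eq, ih τ hτ, show a + 1 + (b + 1) + 1 + 1 = M + 1 + 1 by omega, hlhs, hshift,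
      hrhs, formCoeff_succ_zero, add_right_comm, ← sum_add_distrib, mul_add, mul_sum]
    congr 1
    refine sum_congr rfl fun m _ => ?_
    rw [formCoeff_succ_succ]
    ring

theorem isAlmostHolomorphic_gForm (a b : ℕ) : IsAlmostHolomorphic (gForm a b) :=
  ⟨(_, _), isExpansion_gForm a b⟩

theorem deriv_eisCoeff_succ (a m : ℕ) (τ : ℂ) : deriv (eisCoeff a (m + 1)) τ = 0 := by
  have : eisCoeff a (m + 1) = fun _ => if Odd a then if m = 0 ∧ a = 1 then -twoPiI else 0 else 0 := by
    funext σ; simp [eisCoeff]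
  rw [this]; simp

/-- The only non-zero coefficients of `g_{a,0}` are those with `m = 0`, and with `m = 1` if `a = 1`. -/
theorem eisCoeff_mul (a m : ℕ) (τ : ℂ) : (m : ℂ) * ((a : ℂ) - m) * eisCoeff a m τ = 0 := by
  rcases m with _ | _ | m
  · simp
  · by_cases ha : a = 1
    · simp [ha]
    · simp [eisCoeff, ha]
  · rw [eisCoeff_eq_zero (by omega)]; simp

/-- The recursion turns the hypothesis, a relation among the coefficients of `g_{a,b}`, into the derivative
relation between `g_{a+1,b+1}` and `g_{a,b}`. -/
theorem mul_formCoeff_succ_of_deriv {a b m : ℕ} {τ : ℂ}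
    (h : ((m : ℂ) + 1) * deriv (formCoeff a b (m + 1)) τ =
      ((a : ℂ) * b - ((a : ℂ) + b - m) * m) * formCoeff a b m τ) :
    ((m : ℂ) + 1) * formCoeff (a + 1) (b + 1) (m + 1) τ =
      twoPiI * (((a : ℂ) + 1) * (b + 1)) * formCoeff a b m τ := by
  rw [formCoeff_succ_succ]
  linear_combination twoPiI * h

/-- The forms `g_{a,b}` are eigenforms for `∂_X` followed by raising; in terms of the coefficients this is a
relation between neighbouring coefficients, proved by induction on the recursion. -/
theorem deriv_formCoeff_succ (a b m : ℕ) {τ : ℂ} (hτ : 0 < τ.im) :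
    ((m : ℂ) + 1) * deriv (formCoeff a b (m + 1)) τ =
      ((a : ℂ) * b - ((a : ℂ) + b - m) * m) * formCoeff a b m τ := by
  induction a, b using diagonal_induction generalizing m τ with
  | h0 a =>
    rw [formCoeff_zero_right, formCoeff_zero_right, deriv_eisCoeff_succ]
    push_cast
    linear_combination eisCoeff_mul a m τ
  | h0' b =>
    rw [formCoeff_zero_left, formCoeff_zero_left, deriv_eisCoeff_succ]
    push_cast
    linear_combination eisCoeff_mul b m τ
  | h a b ih =>
    have hd : ((m : ℂ) + 1) * deriv (formCoeff (a + 1) (b + 1) (m + 1)) τ =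
        twoPiI * (((a : ℂ) + 1) * (b + 1)) * deriv (formCoeff a b m) τ := by
      have hev : (fun z => ((m : ℂ) + 1) * formCoeff (a + 1) (b + 1) (m + 1) z) =ᶠ[nhds τ]
          fun z => twoPiI * (((a : ℂ) + 1) * (b + 1)) * formCoeff a b m z :=
        Filter.eventually_of_mem (isOpen_im_pos.mem_nhds hτ) fun z hz =>
          mul_formCoeff_succ_of_deriv (ih m hz)
      have := hev.deriv_eq
      rwa [deriv_const_mul _ (hasDerivAt_formCoeff _ _ _ hτ).differentiableAt,
        deriv_const_mul _ (hasDerivAt_formCoeff _ _ _ hτ).differentiableAt] at this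
    rw [hd]
    cases m with
    | zero =>
      rw [formCoeff_succ_zero]
      push_cast
      ring
    | succ m =>
      have hR := mul_formCoeff_succ_of_deriv (ih m hτ)
      have hS := formCoeff_succ_succ a b m τ
      push_cast
      linear_combination ((a : ℂ) + b + 1 - m) * hR - ((a : ℂ) + 1) * (b + 1) * hS

/-- The coefficients of `g_{a,b}` in positive powers of `(τ - τ̄)⁻¹` are determined by those of
`g_{a-1,b-1}`. -/
theorem mul_formCoeff_succ (a b m : ℕ) {τ : ℂ} (hτ : 0 < τ.im) :
    ((m : ℂ) + 1) * formCoeff (a + 1) (b + 1) (m + 1) τ =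
      twoPiI * (((a : ℂ) + 1) * (b + 1)) * formCoeff a b m τ :=
  mul_formCoeff_succ_of_deriv (deriv_formCoeff_succ a b m hτ)

/-! ### The forms as polynomials in `X = 1 / (τ - τ̄)` -/

open Polynomial in
/-- The polynomial in `X = 1 / (τ - τ̄)` whose coefficients are those of `g_{a,b}` at the point `τ`. -/
noncomputable def formPoly (τ : ℂ) (a b : ℕ) : ℂ[X] :=
  ∑ m ∈ range (a + b + 2), C (formCoeff a b m τ) * X ^ m

section FormPoly

open Polynomial

variable {τ : ℂ}

theorem coeff_formPoly (a b m : ℕ) : (formPoly τ a b).coeff m = formCoeff a b m τ := by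
  simp only [formPoly, finsetSum_coeff, coeff_C_mul_X_pow, Finset.sum_ite_eq, Finset.mem_range]
  split_ifs with h
  · rfl
  · rw [formCoeff_eq_zero (by omega)]; rfl

theorem eval_formPoly (hτ : 0 < τ.im) (a b : ℕ) :
    (formPoly τ a b).eval (1 / tauDiff τ) = gForm a b τ := by
  rw [(isExpansion_gForm a b).2 τ hτ, formPoly, eval_finsetSum]
  refine sum_congr rfl fun m _ => ?_
  simp [div_eq_mul_inv]

theorem coeff_zero_formPoly (hτ : 0 < τ.im) (a b : ℕ) :
    (formPoly τ a b).coeff 0 = constTerm (gForm a b) τ := by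
  rw [coeff_formPoly, (isExpansion_gForm a b).constTerm_eq hτ]

theorem derivative_formPoly_succ (hτ : 0 < τ.im) (a b : ℕ) :
    derivative (formPoly τ (a + 1) (b + 1)) =
      C (twoPiI * (((a : ℂ) + 1) * (b + 1))) * formPoly τ a b := by
  ext m
  rw [coeff_derivative, coeff_C_mul, coeff_formPoly, coeff_formPoly, ← mul_formCoeff_succ a b m hτ]
  ring

/-- The constant comes from the non-holomorphic term of `e_2^*`. -/
theorem derivative_formPoly_zero_right (a : ℕ) :
    derivative (formPoly τ a 0) = if a = 1 then C (-twoPiI) else 0 := by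
  ext m
  rw [coeff_derivative, coeff_formPoly, formCoeff_zero_right]
  by_cases ha : a = 1
  · cases m <;> simp [ha, eisCoeff, coeff_C]
  · simp [ha, eisCoeff]

theorem derivative_formPoly_zero_left (b : ℕ) :
    derivative (formPoly τ 0 b) = if b = 1 then C (-twoPiI) else 0 := by
  ext m
  rw [coeff_derivative, coeff_formPoly, formCoeff_zero_left]
  by_cases hb : b = 1
  · cases m <;> simp [hb, eisCoeff, coeff_C]
  · simp [hb, eisCoeff]

end FormPoly

end EllipticCurveAlgebra

namespace EllipticCurveAlgebra

open NCSeries Gen Polynomial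

/-! ### Evolution of the structure constants -/

/-- The numerical factor of the structure constants. -/
noncomputable def muFactor (ε : ℤˣ) : ℕ → ℕ → ℕ → ℕ → ℂ := muCoeff ε fun _ _ => 1

theorem muCoeff_eq (ε : ℤˣ) (G : ℕ → ℕ → ℂ) (a b c d : ℕ) :
    muCoeff ε G a b c d = muFactor ε a b c d * G (a + c) (b + d) := by
  unfold muFactor muCoeff
  split_ifs <;> ring

/-- The part of `muFactor` that depends only on the sum of the indices. -/
noncomputable def muWeight (ε : ℤˣ) (s : ℕ) : ℂ :=
  if Odd s then ((ε : ℤ) : ℂ) ^ ((s + 1).choose 2) / twoPiI ^ (s + 1) else 0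

theorem muFactor_eq (ε : ℤˣ) (a b c d : ℕ) : muFactor ε a b c d =
    (-1) ^ (a + b) * muWeight ε (a + b + c + d) /
      ((a.factorial : ℂ) * b.factorial * c.factorial * d.factorial) := by
  unfold muFactor muCoeff muWeight
  split_ifs
  · rw [mul_one, div_eq_mul_one_div, div_eq_mul_one_div (_ ^ _) (twoPiI ^ _)]; ring
  · simp

theorem units_cast_mul_self (ε : ℤˣ) : ((ε : ℤ) : ℂ) * ((ε : ℤ) : ℂ) = 1 := by
  rcases Int.units_eq_one_or ε with rfl | rfl <;> simp

/-- The two binomial exponents differ by the odd number `2s + 3`, which leaves one factor `ε`. -/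
theorem muWeight_add_two (ε : ℤˣ) (s : ℕ) :
    muWeight ε s = ((ε : ℤ) : ℂ) * twoPiI ^ 2 * muWeight ε (s + 2) := by
  have hodd : Odd (s + 2) ↔ Odd s := by simp [Nat.odd_add]
  unfold muWeight
  simp only [hodd]
  split_ifs
  · have hch : (s + 2 + 1).choose 2 = (s + 1).choose 2 + 2 * (s + 1) + 1 := by
      simp [Nat.choose_succ_succ]; ring
    have h0 := twoPiI_ne_zero
    have hε := units_cast_mul_self ε
    have hpow : ((ε : ℤ) : ℂ) ^ (s + 2 + 1).choose 2 = ((ε : ℤ) : ℂ) ^ (s + 1).choose 2 * ((ε : ℤ) : ℂ) := by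
      rw [hch, pow_succ, pow_add, pow_mul, sq, hε, one_pow, mul_one]
    rw [hpow]
    rw [← one_mul (((ε : ℤ) : ℂ) ^ (s + 1).choose 2 / twoPiI ^ (s + 1)), ← hε]
    field_simp
    ring
  · simp

theorem muFactor_lower_ab (ε : ℤˣ) (a b c d : ℕ) : muFactor ε a b c d =
    ((ε : ℤ) : ℂ) * twoPiI ^ 2 * ((a + 1) * (b + 1)) * muFactor ε (a + 1) (b + 1) c d := by
  rw [muFactor_eq, muFactor_eq, muWeight_add_two, show a + 1 + (b + 1) + c + d = a + b + c + d + 2 by ring,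
    Nat.factorial_succ, Nat.factorial_succ]
  have := a.cast_add_one_ne_zero (R := ℂ)
  have := b.cast_add_one_ne_zero (R := ℂ)
  have hf : ∀ n : ℕ, (n.factorial : ℂ) ≠ 0 := fun n => by exact_mod_cast n.factorial_ne_zero
  have := hf a; have := hf b; have := hf c; have := hf d
  push_cast
  field_simp
  ring

theorem muFactor_lower_bc (ε : ℤˣ) (a b c d : ℕ) : muFactor ε a b c d =
    -(((ε : ℤ) : ℂ) * twoPiI ^ 2 * ((b + 1) * (c + 1)) * muFactor ε a (b + 1) (c + 1) d) := by
  rw [muFactor_eq, muFactor_eq, muWeight_add_two, show a + (b + 1) + (c + 1) + d = a + b + c + d + 2 by ring,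
    Nat.factorial_succ, Nat.factorial_succ]
  have := b.cast_add_one_ne_zero (R := ℂ)
  have := c.cast_add_one_ne_zero (R := ℂ)
  have hf : ∀ n : ℕ, (n.factorial : ℂ) ≠ 0 := fun n => by exact_mod_cast n.factorial_ne_zero
  have := hf a; have := hf b; have := hf c; have := hf d
  push_cast
  field_simp
  ring

theorem muFactor_rotate (ε : ℤˣ) (a b c d : ℕ) : muFactor ε c d a b = -muFactor ε a b c d :=
  muCoeff_rotate ε _ a b c d

theorem muFactor_lower_cd (ε : ℤˣ) (a b c d : ℕ) : muFactor ε a b c d =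
    ((ε : ℤ) : ℂ) * twoPiI ^ 2 * ((c + 1) * (d + 1)) * muFactor ε a b (c + 1) (d + 1) := by
  have h := muFactor_lower_ab ε c d a b
  rw [muFactor_rotate, muFactor_rotate ε a b] at h
  linear_combination -h

theorem muFactor_lower_da (ε : ℤˣ) (a b c d : ℕ) : muFactor ε a b c d =
    -(((ε : ℤ) : ℂ) * twoPiI ^ 2 * ((d + 1) * (a + 1)) * muFactor ε (a + 1) b c (d + 1)) := by
  have h := muFactor_lower_bc ε c d a b
  rw [muFactor_rotate, muFactor_rotate ε (a + 1) b] at h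
  linear_combination -h

/-- The structure constants of the products at `τ`, as polynomials in `X = 1 / (τ - τ̄)`. -/
noncomputable def muPoly (ε : ℤˣ) (τ : ℂ) (a b c d : ℕ) : ℂ[X] :=
  C (muFactor ε a b c d) * formPoly τ (a + c) (b + d)

theorem muPoly_rotate (ε : ℤˣ) (τ : ℂ) (a b c d : ℕ) : muPoly ε τ c d a b = -muPoly ε τ a b c d := by
  rw [muPoly, muPoly, muFactor_rotate, add_comm c a, add_comm d b, C_neg, neg_mul]

section Lower

variable (ε : ℤˣ) (τ : ℂ) (a b c d : ℕ)

theorem lowAB_muPoly : lowAB (muPoly ε τ) a b c d =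
    C (((ε : ℤ) : ℂ) * twoPiI ^ 2 * (a * b) * muFactor ε a b c d) *
      formPoly τ (a + c - 1) (b + d - 1) := by
  rcases a with _ | a
  · simp [lowAB]
  rcases b with _ | b
  · simp [lowAB]
  rw [lowAB, if_pos ⟨a.succ_pos, b.succ_pos⟩, muPoly, Nat.add_sub_cancel, Nat.add_sub_cancel,
    muFactor_lower_ab, show a + 1 + c - 1 = a + c by omega, show b + 1 + d - 1 = b + d by omega]
  push_cast
  rfl

theorem lowBC_muPoly : lowBC (muPoly ε τ) a b c d =
    -C (((ε : ℤ) : ℂ) * twoPiI ^ 2 * (b * c) * muFactor ε a b c d) *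
      formPoly τ (a + c - 1) (b + d - 1) := by
  rcases b with _ | b
  · simp [lowBC]
  rcases c with _ | c
  · simp [lowBC]
  rw [lowBC, if_pos ⟨b.succ_pos, c.succ_pos⟩, muPoly, Nat.add_sub_cancel, Nat.add_sub_cancel,
    muFactor_lower_bc, show a + (c + 1) - 1 = a + c by omega, show b + 1 + d - 1 = b + d by omega, C_neg]
  push_cast
  rfl

theorem lowCD_muPoly : lowCD (muPoly ε τ) a b c d =
    C (((ε : ℤ) : ℂ) * twoPiI ^ 2 * (c * d) * muFactor ε a b c d) *
      formPoly τ (a + c - 1) (b + d - 1) := by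
  rcases c with _ | c
  · simp [lowCD]
  rcases d with _ | d
  · simp [lowCD]
  rw [lowCD, if_pos ⟨c.succ_pos, d.succ_pos⟩, muPoly, Nat.add_sub_cancel, Nat.add_sub_cancel,
    muFactor_lower_cd, show a + (c + 1) - 1 = a + c by omega, show b + (d + 1) - 1 = b + d by omega]
  push_cast
  rfl

theorem lowDA_muPoly : lowDA (muPoly ε τ) a b c d =
    -C (((ε : ℤ) : ℂ) * twoPiI ^ 2 * (d * a) * muFactor ε a b c d) *
      formPoly τ (a + c - 1) (b + d - 1) := by
  rcases a with _ | a
  · simp [lowDA]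
  rcases d with _ | d
  · simp [lowDA]
  rw [lowDA, if_pos ⟨a.succ_pos, d.succ_pos⟩, muPoly, Nat.add_sub_cancel, Nat.add_sub_cancel,
    muFactor_lower_da, show a + 1 + c - 1 = a + c by omega, show b + (d + 1) - 1 = b + d by omega, C_neg]
  push_cast
  rfl

/-- The four ways of lowering add up to the factor `ab + bc + cd + da = (a + c)(b + d)`, which is the one in the
derivative of `g_{a+c,b+d}`. -/
theorem lowered_muPoly : lowered (C (psiConst ε)) (muPoly ε τ) a b c d =
    C (twoPiI * ((a + c) * (b + d)) * muFactor ε a b c d) * formPoly τ (a + c - 1) (b + d - 1) := by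
  have h0 := twoPiI_ne_zero
  have hc : psiConst ε * (((ε : ℤ) : ℂ) * twoPiI ^ 2) = -twoPiI := by
    rw [psiConst]
    field_simp
    linear_combination -units_cast_mul_self ε
  have hc' : twoPiI * (((a : ℂ) + c) * (b + d)) * muFactor ε a b c d =
      -psiConst ε * (((ε : ℤ) : ℂ) * twoPiI ^ 2 * (a * b) * muFactor ε a b c d +
        ((ε : ℤ) : ℂ) * twoPiI ^ 2 * (b * c) * muFactor ε a b c d +
        ((ε : ℤ) : ℂ) * twoPiI ^ 2 * (c * d) * muFactor ε a b c d +
        ((ε : ℤ) : ℂ) * twoPiI ^ 2 * (d * a) * muFactor ε a b c d) := by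
    linear_combination (((a : ℂ) + c) * (b + d) * muFactor ε a b c d) * hc
  rw [lowered, lowAB_muPoly, lowBC_muPoly, lowCD_muPoly, lowDA_muPoly, hc']
  simp only [C_add, C_mul, C_neg]
  ring

end Lower

/-- The numerical factor of the products with four inputs, times the derivative `-2πi` of `g_{1,0}`. -/
theorem muFactor_mul_twoPiI_of_sum_eq_one (ε : ℤˣ) {a b c d : ℕ} (h : a + b + c + d = 1) :
    muFactor ε a b c d * -twoPiI = (-1) ^ (a + b) * psiConst ε := by
  have h0 := twoPiI_ne_zero
  have hfac : (a.factorial : ℂ) * b.factorial * c.factorial * d.factorial = 1 := by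
    have : ∀ n ≤ 1, n.factorial = 1 := fun n hn => Nat.factorial_eq_one.2 hn
    rw [this a (by omega), this b (by omega), this c (by omega), this d (by omega)]
    simp
  rw [muFactor_eq, hfac, h, muWeight, if_pos odd_one, psiConst]
  norm_num
  field_simp

/-- The evolution of the structure constants in `X = 1 / (τ - τ̄)`. -/
theorem derivative_muPoly (ε : ℤˣ) {τ : ℂ} (hτ : 0 < τ.im) (a b c d : ℕ) :
    derivative (muPoly ε τ a b c d) =
      lowest (C (psiConst ε)) a b c d + lowered (C (psiConst ε)) (muPoly ε τ) a b c d := by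
  rw [lowered_muPoly, muPoly, derivative_C_mul]
  have hlow : ∀ n, a + b + c + d = n → C (muFactor ε a b c d) * (if n = 1 then C (-twoPiI) else 0) =
      lowest (C (psiConst ε)) a b c d := by
    rintro n rfl
    rw [lowest]
    split_ifs with h
    · rw [← C_mul, muFactor_mul_twoPiI_of_sum_eq_one ε h]; simp
    · simp
  rcases Nat.eq_zero_or_pos (a + c) with hac | hac
  · have hac' : (a : ℂ) + c = 0 := by exact_mod_cast hac
    rw [hac, derivative_formPoly_zero_left, hlow _ (by omega), hac']
    simp
  rcases Nat.eq_zero_or_pos (b + d) with hbd | hbd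
  · have hbd' : (b : ℂ) + d = 0 := by exact_mod_cast hbd
    rw [hbd, derivative_formPoly_zero_right, hlow _ (by omega), hbd']
    simp
  obtain ⟨m, hm⟩ : ∃ m, a + c = m + 1 := ⟨a + c - 1, by omega⟩
  obtain ⟨n, hn⟩ : ∃ n, b + d = n + 1 := ⟨b + d - 1, by omega⟩
  have hm' : (a : ℂ) + c = m + 1 := by exact_mod_cast hm
  have hn' : (b : ℂ) + d = n + 1 := by exact_mod_cast hn
  rw [lowest_eq_zero _ (by omega), hm, hn, hm', hn', derivative_formPoly_succ hτ, zero_add,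
    Nat.add_sub_cancel, Nat.add_sub_cancel, ← mul_assoc, ← C_mul]
  congr 2
  ring

end EllipticCurveAlgebra

namespace EllipticCurveAlgebra

open NCSeries Gen Polynomial

/-! ### Change of coefficients and evolution of the products -/

section Map

variable {R S : Type} [CommRing R] [CommRing S] (φ : R →+* S)

theorem map_twoSeries (z : Gen) : map φ (twoSeries R z) = twoSeries S z := by
  have h : ∀ x y : Gen, ∀ w, (letter x * letter y : NCSeries Gen S) w =
      φ ((letter x * letter y : NCSeries Gen R) w) := fun x y w => by
    rw [← map_apply, NCSeries.map_mul, map_letter, map_letter]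
  ext w
  cases z <;> simp [twoSeries, h]

theorem map_higherSeries (h : ℕ → ℕ → ℕ → ℕ → R) (z : Gen) :
    map φ (higherSeries h z) = higherSeries (fun i j k l => φ (h i j k l)) z := by
  have h0 : map φ (0 : NCSeries Gen R) = 0 := by ext w; simp
  cases z <;> simp only [higherSeries, serEta, serTheta, serIdO, serIdL, map_powSum, NCSeries.map_mul,
    map_letter, map_smul_one, map_neg, h0]

theorem map_muSeries (h : ℕ → ℕ → ℕ → ℕ → R) (z : Gen) :
    map φ (muSeries h z) = muSeries (fun i j k l => φ (h i j k l)) z := by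
  rw [muSeries, muSeries, ← map_twoSeries φ, ← map_higherSeries]
  ext w; simp

theorem map_koszulSign (x : Gen) : φ (koszulSign R x) = koszulSign S x := by
  simp [koszulSign, koszul]

end Map

theorem dX_higherSeries (h : ℕ → ℕ → ℕ → ℕ → ℂ[X]) (z : Gen) :
    dX (higherSeries h z) = higherSeries (fun i j k l => derivative (h i j k l)) z := by
  have h0 : dX (0 : NCSeries Gen ℂ[X]) = 0 := by ext1 w; simp
  cases z <;> simp only [higherSeries, serEta, serTheta, serIdO, serIdL, dX_powSum, dX_letter_mul,
    dX_smul_one, derivative_neg, h0]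

theorem dX_twoSeries (z : Gen) : dX (twoSeries ℂ[X] z) = 0 := by
  rw [← map_twoSeries C]
  ext1 w; simp

theorem map_psiSeries (ε : ℤˣ) (z : Gen) : map C (psiSeries ε z) = psiSer (C (psiConst ε)) z := by
  have h : ∀ x y t : Gen, ∀ w, (letter x * (letter y * letter t) : NCSeries Gen ℂ[X]) w =
      C ((letter x * (letter y * letter t) : NCSeries Gen ℂ) w) := fun x y t w => by
    rw [← map_apply, NCSeries.map_mul, NCSeries.map_mul, map_letter, map_letter, map_letter]
  ext1 w
  simp [psiSeries, psiSer, h]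

/-- The products at `τ`, as polynomials in `X = 1 / (τ - τ̄)`, evolve by the commutator with `ψ₃`. -/
theorem dX_muSeries_muPoly (ε : ℤˣ) {τ : ℂ} (hτ : 0 < τ.im) (z : Gen) :
    dX (muSeries (muPoly ε τ) z) = DC (psiSeries ε) (muSeries (muPoly ε τ) z) -
      D (fun x => C (koszulSign ℂ x)) (muSeries (muPoly ε τ)) (map C (psiSeries ε z)) := by
  have h1 : (fun y => map C (psiSeries ε y)) = psiSer (C (psiConst ε)) := funext (map_psiSeries ε)
  have h2 : (fun x => C (koszulSign ℂ x)) = koszulSign ℂ[X] := funext (map_koszulSign C)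
  rw [DC, h1, h2, map_psiSeries, muSeries_commutator _ _ (muPoly_rotate ε τ), muSeries, dX_add,
    dX_twoSeries, zero_add, dX_higherSeries]
  congr 1
  funext i j k l
  exact derivative_muPoly ε hτ i j k l

/-- At `X = 0` the products are those of `A_τ^hol`. -/
theorem coeffX_zero_muSeries (ε : ℤˣ) {τ : ℂ} (hτ : 0 < τ.im) (z : Gen) :
    coeffX 0 (muSeries (muPoly ε τ) z) = column (muHol ε τ) z := by
  have h : ∀ U : NCSeries Gen ℂ[X], coeffX 0 U = map constantCoeff U := fun U => by ext w; simp
  rw [muHol, column_mu, h, map_muSeries]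
  congr 1
  funext i j k l
  rw [muPoly, _root_.map_mul, constantCoeff_apply, constantCoeff_apply, coeff_C_zero, coeff_zero_formPoly hτ, muCoeff_eq]

/-- At `X = 1 / (τ - τ̄)` the products are those of `A_τ`. -/
theorem map_eval_muSeries (ε : ℤˣ) {τ : ℂ} (hτ : 0 < τ.im) (z : Gen) :
    map (evalRingHom (1 / tauDiff τ)) (muSeries (muPoly ε τ) z) = column (muMod ε τ) z := by
  rw [muMod, column_mu, map_muSeries]
  congr 1
  funext i j k l
  rw [muPoly, _root_.map_mul, coe_evalRingHom, eval_C, eval_formPoly hτ, muCoeff_eq]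

/-! ### The morphism -/

theorem isHomog_psiSeries (ε : ℤˣ) (z : Gen) : IsHomog Gen.sdeg (psiSeries ε z) z.sdeg := by
  have h : ∀ x y t : Gen, IsHomog Gen.sdeg (letter x * (letter y * letter t) : NCSeries Gen ℂ)
      (x.sdeg + (y.sdeg + t.sdeg)) := fun x y t =>
    (isHomog_letter x).mul ((isHomog_letter y).mul (isHomog_letter t))
  cases z with
  | xi => intro w hw; exact absurd (by simp [psiSeries, psiSign]) hw
  | xiL => intro w hw; exact absurd (by simp [psiSeries, psiSign]) hw
  | _ => exact (h _ _ _).smul _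

/-- The signs of the letters extend to a character of the grading. -/
theorem twist_koszulSign {R : Type} [CommRing R] {u : NCSeries Gen R} {d : ℤ}
    (hu : IsHomog Gen.sdeg u d) : twist (koszulSign R) u = koszul R d • u :=
  hu.twist fun w => prod_koszulSign w

/-- The substitution of the series of the `fₙ` at `τ` for the variables: the flow of `ψ₃` at time
`1 / (τ - τ̄)`. -/
noncomputable def flowAt (ε : ℤˣ) (τ : ℂ) : NCSeries Gen ℂ →ₗ[ℂ] NCSeries Gen ℂ where
  toFun u := map (evalRingHom (1 / tauDiff τ)) (flow (psiSeries ε) u)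
  map_add' u v := by
    rw [flow_add (psiSeries_apply_eq_zero ε)]
    ext w; simp
  map_smul' r u := by
    rw [flow_smul (psiSeries_apply_eq_zero ε)]
    ext w; simp

theorem flowAt_apply (ε : ℤˣ) (τ : ℂ) (u : NCSeries Gen ℂ) :
    flowAt ε τ u = map (evalRingHom (1 / tauDiff τ)) (flow (psiSeries ε) u) := rfl

theorem flowAt_mul (ε : ℤˣ) (τ : ℂ) (u v : NCSeries Gen ℂ) :
    flowAt ε τ (u * v) = flowAt ε τ u * flowAt ε τ v := by
  rw [flowAt_apply, flow_mul (psiSeries_apply_eq_zero ε), NCSeries.map_mul]; rfl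

theorem flowAt_one (ε : ℤˣ) (τ : ℂ) : flowAt ε τ 1 = 1 := by
  rw [flowAt_apply, flow_one (psiSeries_apply_eq_zero ε)]
  ext w; cases w <;> simp

theorem fAt_eq (ε : ℤˣ) (τ : ℂ) : fAt ε τ = fun w z => flowAt ε τ (letter z) w := by
  funext w z
  rw [fAt, fMap_eq_flow ε _ w rfl]; rfl

theorem flowAt_letter_nil (ε : ℤˣ) (τ : ℂ) (z : Gen) : flowAt ε τ (letter z) [] = 0 := by
  rw [flowAt_apply, map_apply, flow_letter_nil, map_zero]

theorem fAt_singleton (ε : ℤˣ) (τ : ℂ) (x : Gen) : fAt ε τ [x] = basisVec ℂ x := by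
  funext z
  rw [fAt, List.length_singleton, fMap, basisVec, Pi.single_apply]
  by_cases h : x = z
  · simp [h]
  · simp [h, Ne.symm h]

/-- The flow intertwines the derivations given by the products of `A_τ^hol` and of `A_τ`. -/
theorem D_flowAt (ε : ℤˣ) {τ : ℂ} (hτ : 0 < τ.im) (u : NCSeries Gen ℂ) :
    D (koszulSign ℂ) (column (muMod ε τ)) (flowAt ε τ u) =
      flowAt ε τ (D (koszulSign ℂ) (column (muHol ε τ)) u) := by
  have h := D_flow (psiSeries_apply_eq_zero ε) (fun y => twist_koszulSign (isHomog_psiSeries ε y))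
    (fun y => muSeries_nil (muPoly ε τ) y) (dX_muSeries_muPoly ε hτ) u
  have h' := congrArg (NCSeries.map (evalRingHom (1 / tauDiff τ))) h
  simp only [map_D, map_eval_muSeries ε hτ, coeffX_zero_muSeries ε hτ, coe_evalRingHom, eval_C] at h'
  exact h'

theorem mu_nil (ε : ℤˣ) (G : ℕ → ℕ → ℂ) (z : Gen) : mu ε G [] z = 0 :=
  muHigher_eq_zero ε G (by simp) z

theorem muMod_nil (ε : ℤˣ) (τ : ℂ) (z : Gen) : muMod ε τ [] z = 0 := mu_nil ε _ z

theorem muHol_nil (ε : ℤˣ) (τ : ℂ) (z : Gen) : muHol ε τ [] z = 0 := mu_nil ε _ z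

theorem column_mu_nil (ε : ℤˣ) (G : ℕ → ℕ → ℂ) (z : Gen) : column (mu ε G) z [] = 0 :=
  mu_nil ε G z

theorem degree_mu (ε : ℤˣ) (G : ℕ → ℕ → ℂ) (w : List Gen) (z : Gen) (h : mu ε G w z ≠ 0) :
    z.sdeg = wordDeg w + 1 := by
  have h' : column (mu ε G) z w ≠ 0 := h
  rw [column_mu] at h'
  have := isHomog_muSeries _ z w h'
  rw [wordDeg]; omega

theorem twist_column_mu (ε : ℤˣ) (G : ℕ → ℕ → ℂ) (z : Gen) :
    twist (koszulSign ℂ) (column (mu ε G) z) = -(koszulSign ℂ z • column (mu ε G) z) := by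
  rw [column_mu, twist_koszulSign (isHomog_muSeries _ z), sub_eq_add_neg, koszul_add,
    koszul_of_odd (n := -1) (by decide), mul_neg_one, neg_smul]
  rfl

/-- The flow transports the square of the derivation of `A_τ^hol` to that of `A_τ`, and it is injective. -/
theorem isAInfinityAlgebra_muHol (ε : ℤˣ) {τ : ℂ} (hτ : 0 < τ.im)
    (h : IsAInfinityAlgebra (muMod ε τ)) : IsAInfinityAlgebra (muHol ε τ) := by
  refine ⟨mu_nil ε _, degree_mu ε _, fun w z => ?_⟩
  have hsq : ∀ u, D (koszulSign ℂ) (column (muMod ε τ)) (D (koszulSign ℂ) (column (muMod ε τ)) u) = 0 :=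
    D_sq_eq_zero koszulSign_mul_self (column_mu_nil ε _) (twist_column_mu ε _) fun y => by
      ext w
      rw [← insertSum_eq_D _ _ (muMod_nil ε τ), h.relations]; rfl
  have h0 : flowAt ε τ (D (koszulSign ℂ) (column (muHol ε τ)) (column (muHol ε τ) z)) = 0 := by
    have e := D_letter (s := koszulSign ℂ) (q := column (muHol ε τ)) (muHol_nil ε τ) z
    rw [← e, ← D_flowAt ε hτ, ← D_flowAt ε hτ, hsq]
  rw [insertSum_eq_D _ _ (muHol_nil ε τ)]
  have h1 := eq_zero_of_eval_flow (psiSeries_apply_eq_zero ε) (1 / tauDiff τ)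
    fun w => congrArg (fun u => u.coeff w) h0
  exact congrArg (fun u => u.coeff w) h1

theorem isAInfinityMorphism_fAt (ε : ℤˣ) {τ : ℂ} (hτ : 0 < τ.im) :
    IsAInfinityMorphism (muMod ε τ) (muHol ε τ) (fAt ε τ) := by
  rw [fAt_eq]
  refine ⟨flowAt_letter_nil ε τ, fun w z hw => ?_, fun w z => ?_⟩
  · have h : flow (psiSeries ε) (letter z) w ≠ 0 := fun h => hw (by simp [flowAt_apply, h])
    exact (IsHomog.flow (isHomog_psiSeries ε) (isHomog_letter z) w h).symm
  · rw [composeSum_eq _ (flowAt_mul ε τ) (flowAt_one ε τ) (flowAt_letter_nil ε τ),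
      insertSum_eq_D _ _ (muMod_nil ε τ)]
    change _ = D (koszulSign ℂ) (column (muMod ε τ)) (flowAt ε τ (letter z)) w
    rw [D_flowAt ε hτ, D_letter _ (muHol_nil ε τ)]

theorem applyOps_singleton {R : Type} [CommRing R] (m : Ops R) (u : Gen → R) (z : Gen) :
    applyOps m [u] z = ∑ y : Gen, u y * m [y] z := rfl

/-- Both differentials vanish and `f₁` is the identity. -/
theorem isQuasiIso_fAt (ε : ℤˣ) (τ : ℂ) : IsQuasiIso (muMod ε τ) (muHol ε τ) (fAt ε τ) := by
  have hmu : ∀ (G : ℕ → ℕ → ℂ) (u : Gen → ℂ), applyOps (mu ε G) [u] = 0 := fun G u => by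
    funext z
    rw [applyOps_singleton]
    exact Finset.sum_eq_zero fun y _ => by
      rw [show mu ε G [y] z = 0 from muHigher_eq_zero ε G (by simp) z, mul_zero]
  have hf : ∀ u : Gen → ℂ, applyOps (fAt ε τ) [u] = u := fun u => by
    funext z
    simp [applyOps_singleton, fAt_singleton, basisVec, Pi.single_apply]
  refine ⟨fun u => ?_, fun u _ ⟨v', hv⟩ => ⟨0, ?_⟩, fun u' _ => ⟨u', 0, hmu _ _, ?_⟩⟩
  · rw [hf, hf, muMod, muHol, hmu, hmu]
  · rw [muMod, hmu, ← hf u, hv, muHol, hmu]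
  · rw [hf, muHol, hmu, add_zero]

/-- The pairing, as a quadratic series, is killed by `ψ₃` and hence fixed by the flow. -/
theorem isCyclicMorphism_fAt (ε : ℤˣ) (τ : ℂ) : IsCyclicMorphism (fAt ε τ) := by
  refine ⟨fun x y => ?_, fun w hw => ?_⟩
  · rw [fAt_singleton, fAt_singleton, pairing_basisVec]
    simp [basisVec, Pi.single_apply]
  set P : NCSeries Gen ℂ := ∑ x : Gen, ∑ y : Gen, (pairGen x y : ℂ) • (letter x * letter y) with hP
  have hflow : flowAt ε τ P = P := by
    rw [flowAt_apply, flow_eq_of_D_eq_zero (psiSeries_apply_eq_zero ε) (D_pairing_eq_zero _)]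
    ext w; simp [hP]
  have hlen : P w = 0 := by
    have hm : ∀ a b : Gen, (letter a * letter b : NCSeries Gen ℂ) w = 0 := fun a b => by
      rw [letter_mul_letter, mono_apply, if_neg]
      rintro rfl; simp at hw
    simp [hP, hm]
  rw [← hflow, hP] at hlen
  simp only [map_sum, map_smul, flowAt_mul, NCSeries.sum_apply, NCSeries.smul_apply, mul_apply] at hlen
  rw [fAt_eq]
  have hends : ∀ F : ℕ → ℂ, F 0 = 0 → F w.length = 0 →
      ∑ i ∈ Finset.Ico 1 w.length, F i = ∑ i ∈ Finset.range (w.length + 1), F i := by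
    intro F h0 hn
    rw [Finset.sum_range_succ, hn, add_zero, Finset.range_eq_Ico,
      Finset.sum_eq_sum_Ico_succ_bot (a := 0) (by omega) F, h0, zero_add]
  -- the terms in which one of the two blocks is empty vanish, as the `fₙ` start with `n = 1`
  rw [hends _ (by simp [pairing, flowAt_letter_nil]) (by simp [pairing, flowAt_letter_nil]), ← hlen]
  simp only [pairing, Finset.mul_sum]
  rw [Finset.sum_comm]
  refine Finset.sum_congr rfl fun x _ => ?_
  rw [Finset.sum_comm]
  exact Finset.sum_congr rfl fun y _ => Finset.sum_congr rfl fun i _ => by ring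

end EllipticCurveAlgebra

theorem mainTheorem7 (ε : ℤˣ) :
    -- the constant term map is defined on the forms that enter the structure constants
    (∀ a b : ℕ, IsAlmostHolomorphic (gForm a b)) ∧
    IsCyclicOps (psiThree ε) ∧
    -- formal integration is only applied to powers `m ≥ 2` of `1 / (τ - τ̄)`
    (∀ i j k : ℕ, 1 ≤ i → 1 ≤ j → 1 ≤ k → ∀ w : List Gen, w.length = i + j + k → ∀ z : Gen,
      (Polynomial.X : Polynomial ℂ) ^ 2 ∣ applyOps (psiThree ε)
        [fMap ε i (w.take i), fMap ε j ((w.drop i).take j), fMap ε k (w.drop (i + j))] z) ∧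
    ∀ τ : ℂ, 0 < τ.im →
      IsCyclicOps (muMod ε τ) ∧ IsCyclicOps (muHol ε τ) ∧
      (IsAInfinityAlgebra (muMod ε τ) → IsAInfinityAlgebra (muHol ε τ)) ∧
      IsAInfinityMorphism (muMod ε τ) (muHol ε τ) (fAt ε τ) ∧
      IsQuasiIso (muMod ε τ) (muHol ε τ) (fAt ε τ) ∧
      IsCyclicMorphism (fAt ε τ) := by
  refine ⟨isAlmostHolomorphic_gForm, isCyclicOps_psiThree ε, fun i j k _ _ _ w _ z => ?_,
    fun τ hτ => ⟨isCyclicOps_mu ε _, isCyclicOps_mu ε _, isAInfinityAlgebra_muHol ε hτ,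
      isAInfinityMorphism_fAt ε hτ, isQuasiIso_fAt ε τ, isCyclicMorphism_fAt ε τ⟩⟩
  rw [applyOps_psiThree]
  exact dvd_mul_right _ _
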